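/- Let $\widetilde M$ be a (Hausdorff, second countable) complex manifold of dimension $n$, and let $\Gamma$ be a group acting on $\widetilde M$ freely and properly discontinuously by holomorphic automorphisms, such that $M=\widetilde M/\Gamma$ is compact. Let $\Gamma=\Gamma_1\supset\Gamma_2\supset\cdots$ be a tower of subgroups of $\Gamma$, that is, a nested sequence of normal subgroups of finite index with $\bigcap_j\Gamma_j=\{\mathrm{id}\}$, and let $M_j=\widetilde M/\Gamma_j$. Let $h^{n,0}(M_j)$ be the dimension of the space of global holomorphic sections of the canonical line bundle of $M_j$, and let $$K_{\widetilde M}=i^{n^2}2^{-n}\sum_{k} b_k\wedge\overline{b_k}$$ be the Bergman kernel of $\widetilde M$ on the diagonal, where $\{b_k\}$ is any orthonormal basis of the Hilbert space of square integrable holomorphic $(n,0)$-forms on $\widetilde M$ with the inner product $\langle f,g\rangle=i^{n^2}2^{-n}\int_{\widetilde M}f\wedge\bar g$. The nonnegative $(n,n)$-form $K_{\widetilde M}$ is $\Gamma$-invariant; its push-down to $M$ is denoted by $K_{\widetilde M}$ as well. Then every $h^{n,0}(M_j)$ and the integral $\int_M K_{\widetilde M}$ are finite, and $$\limsup_{j\to\infty}\frac{h^{n,0}(M_j)}{[\Gamma:\Gamma_j]}\le\int_M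 K_{\widetilde M}.$$ -/

import Mathlib

open scoped Manifold ContDiff ENNReal ComplexConjugate

noncomputable section

namespace BergmanTower

/-! Complex manifolds of dimension `n` are modelled on `ℂⁿ = (Fin n → ℂ)`, with its product topology
and its Lebesgue measure `volume`, which is the measure of `ω_n = ∏ⱼ (i/2) dzⱼ ∧ dz̄ⱼ`. -/

section Forms

variable (n : ℕ) (X : Type*) [TopologicalSpace X] [ChartedSpace (Fin n → ℂ) X]

/-- Forms of type `(n, 0)` on `X`, without regularity: at each point a complex `n`-linear alternating
form on the holomorphic tangent space. -/
abbrev TopForm : Type _ :=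
  ∀ x : X, (TangentSpace 𝓘(ℂ, Fin n → ℂ) x) [⋀^Fin n]→ₗ[ℂ] ℂ

/-- Functions of `n` holomorphic tangent vectors at a point, with values in `R`. An `(n, n)`-form `η`
on `X` is given by such a function: the one whose value at the coordinate frame `∂/∂zⱼ` of a
holomorphic chart is the coefficient of `η` with respect to `ω_n` in that chart. -/
abbrev FrameFun (R : Type*) : Type _ :=
  ∀ x : X, (Fin n → TangentSpace 𝓘(ℂ, Fin n → ℂ) x) → R

variable {n X}

/-- The frame `∂/∂z₁, …, ∂/∂zₙ` of the chart `φ` at the point with coordinates `z`. -/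
def coordFrame (φ : OpenPartialHomeomorph X (Fin n → ℂ)) (z : Fin n → ℂ) (i : Fin n) :
    TangentSpace 𝓘(ℂ, Fin n → ℂ) (φ.symm z) :=
  mfderiv 𝓘(ℂ, Fin n → ℂ) 𝓘(ℂ, Fin n → ℂ) φ.symm z (Pi.single i (1 : ℂ) : Fin n → ℂ)

/-- The coefficient `f*` of `f = f* dz₁ ∧ ⋯ ∧ dzₙ` in the chart `φ`, as a function of `z`. -/
def formCoeff (φ : OpenPartialHomeomorph X (Fin n → ℂ)) (f : TopForm n X) (z : Fin n → ℂ) : ℂ :=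
  f (φ.symm z) (coordFrame φ z)

/-- The coefficient `η*` of `η = η* ω_n` in the chart `φ`, as a function of `z`. -/
def frameCoeff {R : Type*} (φ : OpenPartialHomeomorph X (Fin n → ℂ)) (η : FrameFun n X R)
    (z : Fin n → ℂ) : R :=
  η (φ.symm z) (coordFrame φ z)

/-- The measure on `φ.source` that is `η* ω_n` in the chart `φ`, for `η ≥ 0`, extended by zero. -/
def chartMeasure (φ : OpenPartialHomeomorph X (Fin n → ℂ)) (η : FrameFun n X ℝ≥0∞) :
    @MeasureTheory.Measure X (borel X) :=
  @MeasureTheory.Measure.map _ X _ (borel X) φ.symm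
    ((MeasureTheory.volume.restrict φ.target).withDensity (frameCoeff φ η))

/-- The Borel measure on `X` given by an `(n, n)`-form `η ≥ 0`: the measures that `η` induces on the
chart domains agree on overlaps, and glue to the least measure that dominates all of them. -/
def formMeasure (η : FrameFun n X ℝ≥0∞) : @MeasureTheory.Measure X (borel X) :=
  ⨆ φ ∈ atlas (Fin n → ℂ) X, chartMeasure φ η

/-- The integral `∫_X η ∈ [0, ∞]` of an `(n, n)`-form `η ≥ 0`. -/
def lintegralForm (η : FrameFun n X ℝ≥0∞) : ℝ≥0∞ :=
  formMeasure η Set.univ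

/-- The integral `∫_X η` of an integrable complex `(n, n)`-form `η`, through the positive and negative
parts of its real and imaginary parts. -/
def integralForm (η : FrameFun n X ℂ) : ℂ :=
  (((lintegralForm fun x v => ENNReal.ofReal (η x v).re).toReal
      - (lintegralForm fun x v => ENNReal.ofReal (-(η x v).re)).toReal : ℝ) : ℂ)
    + Complex.I * (((lintegralForm fun x v => ENNReal.ofReal (η x v).im).toReal
      - (lintegralForm fun x v => ENNReal.ofReal (-(η x v).im)).toReal : ℝ) : ℂ)

variable (n X) in
/-- Holomorphic `(n, 0)`-forms, that is, global holomorphic sections of the canonical line bundle: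
in each chart of `X` the coefficient is holomorphic. -/
def holomorphicForms : Submodule ℂ (TopForm n X) where
  carrier := {f | ∀ φ ∈ atlas (Fin n → ℂ) X, DifferentiableOn ℂ (formCoeff φ f) φ.target}
  zero_mem' := fun _ _ => differentiableOn_const (0 : ℂ)
  add_mem' := fun hf hg φ hφ => (hf φ hφ).add (hg φ hφ)
  smul_mem' := fun c _ hf φ hφ => (hf φ hφ).const_smul c

variable (n X) in
/-- `h^{n,0}(X)`, the dimension of the space of global holomorphic sections of the canonical line
bundle. -/
def hodgeNumber : ℕ :=
  Module.finrank ℂ (holomorphicForms n X)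

/-- `‖f‖² = i^{n²} 2⁻ⁿ ∫_X f ∧ f̄ ∈ [0, ∞]`. In a chart, with `f = f* dz₁ ∧ ⋯ ∧ dzₙ`, one has
`i^{n²} 2⁻ⁿ f ∧ f̄ = |f*|² ω_n`. -/
def normSq (f : TopForm n X) : ℝ≥0∞ :=
  lintegralForm fun x v => ‖f x v‖ₑ ^ 2

/-- `⟨f, g⟩ = i^{n²} 2⁻ⁿ ∫_X f ∧ ḡ`, for square integrable `f` and `g`. -/
def innerForm (f g : TopForm n X) : ℂ :=
  integralForm fun x v => f x v * conj (g x v)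

variable (n X) in
/-- The square integrable holomorphic `(n, 0)`-forms. -/
def squareIntegrableForms : Set (TopForm n X) :=
  {f | f ∈ holomorphicForms n X ∧ normSq f < ⊤}

/-- `B` is an orthonormal basis of the Hilbert space of square integrable holomorphic `(n, 0)`-forms:
it is orthonormal, and its linear span is dense. -/
structure IsOrthonormalBasis (B : Set (TopForm n X)) : Prop where
  subset : B ⊆ squareIntegrableForms n X
  inner_self : ∀ b ∈ B, innerForm b b = 1
  inner_of_ne : ∀ b ∈ B, ∀ b' ∈ B, b ≠ b' → innerForm b b' = 0
  dense_span : ∀ f ∈ squareIntegrableForms n X, ∀ ε : ℝ≥0∞, 0 < ε →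
    ∃ g ∈ Submodule.span ℂ B, normSq (f - g) < ε

/-- The Bergman kernel on the diagonal, `K = i^{n²} 2⁻ⁿ ∑_{b ∈ B} b ∧ b̄`, for an orthonormal basis `B`
of the square integrable holomorphic `(n, 0)`-forms. Its coefficient in a chart is `∑_{b ∈ B} |b*|²`. -/
def bergmanKernel (B : Set (TopForm n X)) : FrameFun n X ℝ≥0∞ :=
  fun x v => ∑' b : B, ‖(b : TopForm n X) x v‖ₑ ^ 2

end Forms

section Quotient

variable {n : ℕ} (Γ : Type*) [Group Γ] {X : Type*} [TopologicalSpace X] [MulAction Γ X]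
  [ChartedSpace (Fin n → ℂ) X] [T2Space X] [LocallyCompactSpace X] [ContinuousConstSMul Γ X]
  [ProperlyDiscontinuousSMul Γ X] [IsCancelSMul Γ X]

variable (X) in
/-- The projection of `X` onto the quotient `X / Γ`. -/
def proj (x : X) : MulAction.orbitRel.Quotient Γ X :=
  Quotient.mk (MulAction.orbitRel Γ X) x

/-- The push-down to `X / Γ` of a `Γ`-invariant form `η` on `X`: its value at `y = proj x` is the value
of `η` at `x`, transported by the isomorphism `mfderiv proj x` of tangent spaces. By invariance the
choice of `x` does not matter. -/
def pushDown {R : Type*} (η : FrameFun n X R) :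
    FrameFun n (MulAction.orbitRel.Quotient Γ X) R :=
  fun y v => η (Quotient.out y) fun i =>
    (mfderiv 𝓘(ℂ, Fin n → ℂ) 𝓘(ℂ, Fin n → ℂ) (proj Γ X) (Quotient.out y)).inverse (v i)

instance continuousConstSMul_subgroup {Γ X : Type*} [Group Γ] [TopologicalSpace X] [MulAction Γ X]
    [ContinuousConstSMul Γ X] (S : Subgroup Γ) : ContinuousConstSMul S X :=
  ⟨fun γ => continuous_const_smul (γ : Γ)⟩

/-- The quotient by a free and properly discontinuous action by automorphisms is a complex manifold,
with the charts of `MulAction.instChartedSpaceQuotient`. -/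
theorem isManifold_quotient [IsManifold 𝓘(ℂ, Fin n → ℂ) ω X]
    (hΓ : ∀ γ : Γ, ContMDiff 𝓘(ℂ, Fin n → ℂ) 𝓘(ℂ, Fin n → ℂ) ω fun x : X => γ • x) :
    IsManifold 𝓘(ℂ, Fin n → ℂ) ω (MulAction.orbitRel.Quotient Γ X) := by
  apply isManifold_of_contDiffOn
  rintro e e' ⟨q, rfl⟩ ⟨q', rfl⟩
  have hl : IsLocalHomeomorph (Quotient.mk (MulAction.orbitRel Γ X)) :=
    (isQuotientCoveringMap_quotientMk_of_properlyDiscontinuousSMul (E := X)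
      (G := Γ)).isCoveringMap.isLocalHomeomorph
  have hs : Function.Surjective (Quotient.mk (MulAction.orbitRel Γ X)) := Quotient.mk_surjective
  generalize hs.hasRightInverse.choose q = a
  generalize hs.hasRightInverse.choose q' = b
  rintro z ⟨hz, -⟩
  simp only [modelWithCornersSelf_coe_symm, Set.preimage_id] at hz
  simp only [modelWithCornersSelf_coe, modelWithCornersSelf_coe_symm, Function.comp_id,
    Function.id_comp]
  apply ContDiffAt.contDiffWithinAt
  simp only [OpenPartialHomeomorph.trans_source, OpenPartialHomeomorph.symm_source,
    OpenPartialHomeomorph.trans_target, Set.mem_inter_iff, Set.mem_preimage,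
    OpenPartialHomeomorph.coe_trans_symm, Function.comp_apply,
    IsLocalHomeomorph.localInverseAt_symm] at hz
  obtain ⟨⟨hz1, hz2⟩, hz3, hz4⟩ := hz
  set x := (chartAt (Fin n → ℂ) a).symm z with hx
  set x' := hl.localInverseAt b (Quotient.mk _ x) with hx'
  have hxx : (Quotient.mk (MulAction.orbitRel Γ X) x') = Quotient.mk _ x :=
    hl.apply_localInverseAt_of_mem hz3
  obtain ⟨γ, hγ⟩ : ∃ γ : Γ, γ • x = x' := Quotient.exact hxx
  have hcont : ContinuousAt (chartAt (Fin n → ℂ) a).symm z :=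
    (chartAt (Fin n → ℂ) a).continuousAt_symm hz1
  have hT : (hl.localInverseAt b).target ∈ nhds (γ • x) := by
    rw [hγ]
    exact (hl.localInverseAt b).open_target.mem_nhds ((hl.localInverseAt b).map_source hz3)
  have hev : ∀ᶠ w in nhds z, γ • (chartAt (Fin n → ℂ) a).symm w ∈ (hl.localInverseAt b).target :=
    (hcont.const_smul γ).eventually hT
  have key : ContDiffAt ℂ ω
      (fun w => chartAt (Fin n → ℂ) b (γ • (chartAt (Fin n → ℂ) a).symm w)) z := by
    have h1 : ContMDiffAt 𝓘(ℂ, Fin n → ℂ) 𝓘(ℂ, Fin n → ℂ) ω (chartAt (Fin n → ℂ) a).symm z :=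
      (contMDiffOn_chart_symm (x := a)).contMDiffAt
        ((chartAt (Fin n → ℂ) a).open_target.mem_nhds hz1)
    have h2 : ContMDiffAt 𝓘(ℂ, Fin n → ℂ) 𝓘(ℂ, Fin n → ℂ) ω (chartAt (Fin n → ℂ) b) (γ • x) := by
      refine (contMDiffOn_chart (x := b)).contMDiffAt
        ((chartAt (Fin n → ℂ) b).open_source.mem_nhds ?_)
      rw [hγ]
      exact hz4
    exact (h2.comp z ((hΓ γ).contMDiffAt.comp z h1)).contDiffAt
  refine key.congr_of_eventuallyEq ?_
  filter_upwards [hev] with w hw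
  have h3 : hl.localInverseAt b (Quotient.mk (MulAction.orbitRel Γ X)
      ((chartAt (Fin n → ℂ) a).symm w)) = γ • (chartAt (Fin n → ℂ) a).symm w := by
    have h4 : Quotient.mk (MulAction.orbitRel Γ X) ((chartAt (Fin n → ℂ) a).symm w) =
        Quotient.mk (MulAction.orbitRel Γ X) (γ • (chartAt (Fin n → ℂ) a).symm w) :=
      (Quotient.sound ⟨γ, rfl⟩ : Quotient.mk (MulAction.orbitRel Γ X)
        (γ • (chartAt (Fin n → ℂ) a).symm w) = _).symm
    rw [h4]
    simpa using (hl.localInverseAt b).right_inv hw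
  simp only [OpenPartialHomeomorph.coe_trans, OpenPartialHomeomorph.coe_trans_symm,
    Function.comp_apply, IsLocalHomeomorph.localInverseAt_symm, h3]

/-- A tower of subgroups of `Γ`: a nested sequence `Γ = Γ₀ ⊇ Γ₁ ⊇ ⋯` of normal subgroups of finite
index with trivial intersection. -/
structure IsTower (S : ℕ → Subgroup Γ) : Prop where
  zero : S 0 = ⊤
  antitone : Antitone S
  iInf : ⨅ j, S j = ⊥
  normal : ∀ j, (S j).Normal
  finiteIndex : ∀ j, (S j).FiniteIndex

end Quotient

end BergmanTower

end

open scoped Manifold ContDiff ENNReal ComplexConjugate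

noncomputable section

namespace BergmanTower

open Metric Filter Topology MeasureTheory Set

/-! ### Cauchy estimates and Montel's theorem for bounded holomorphic functions. -/

section Normal

/-! Pull the holomorphic forms on `X / S` back to `S`-invariant forms on `X`, for `S` normal of
finite index in `Γ`. The squared norm over `X / S` is then a sum, over the cosets of `S`, of
energies over one fundamental domain `D` of `Γ`. The dimension of this space is at most the integral
over `X / S` of its extremal function, the supremum of `|f|²` over the unit ball
(`finrank_le_lintegral`). Since `S` is normal, `Γ` preserves the unit ball, so every coset
contributes the same bound and `h / [Γ : S]` is at most the integral over `D` of the extremal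
function (`finiteDimensional_and_hodgeNumber_le`). The equality that holds here is not needed.

On `X` itself, the sum over an orthonormal basis is the extremal function of the `L²` unit ball
(`bergmanKernel_eq_iSup`). Hence the Bergman kernel is `Γ`-invariant, and its push-down integrates
to the integral over `D` of that extremal function (`lintegralForm_pushDown_bergmanKernel`).

What remains is upper semicontinuity: the limsup of the integrals over `D` for `S j` is at most the
one for `X`. Cut `D` into finitely many cells, each inside a polydisc such that the concentric one
of twice the radius injects into `X / Γ`, hence into every `X / S`. The sub-mean value property of
`|f|²` then bounds all the extremal functions by the reciprocal volume of a polydisc, independently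
of `j`. This makes the integrals finite, makes the unit balls normal families, and supplies the
dominating function for the reverse Fatou lemma (`limsup_extremalIntegral_le`).

The pointwise inequality is `limsup_extremal_le`. Take forms in the unit balls of `X / S j` whose
squared values at a point exceed a given bound below the limsup; a subsequence converges to a
holomorphic form `g` on `X`. Because the tower has trivial intersection, any finite set of
translates of `D` injects into `X / S j` for large `j`, and Fatou's lemma bounds the energy of `g`
over these translates by 1. So `g` lies in the unit ball of `X` (`exists_subseq_tendsto_form`). -/

theorem mapsTo_closedBall_of_norm_le {V : Type*} [NormedAddCommGroup V] {f : V → ℂ} {c : V} {s R : ℝ} (hs : 0 < s)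
    (hb : ∀ z ∈ ball c s, ‖f z‖ ≤ R) : MapsTo f (ball c s) (closedBall (f c) (2 * R)) := by
  intro z hz
  rw [mem_closedBall, dist_eq_norm]
  linarith [norm_sub_le (f z) (f c), hb z hz, hb c (mem_ball_self hs)]

variable {V : Type*} [NormedAddCommGroup V] [NormedSpace ℂ V]

/-- Schwarz lemma: `f` maps the ball into the ball of radius `2 * R` about `f c`. -/
theorem norm_sub_le_of_bounded {f : V → ℂ} {c z : V} {s R : ℝ}
    (hd : DifferentiableOn ℂ f (ball c s)) (hb : ∀ z ∈ ball c s, ‖f z‖ ≤ R) (hz : z ∈ ball c s) :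
    ‖f z - f c‖ ≤ 2 * R / s * ‖z - c‖ := by
  have hs : 0 < s := nonempty_ball.1 ⟨z, hz⟩
  simpa [dist_eq_norm] using Complex.dist_le_div_mul_dist_of_mapsTo_ball hd
    (mapsTo_closedBall_of_norm_le hs hb) hz

theorem norm_fderiv_le_of_bounded {f : V → ℂ} {c : V} {s R : ℝ} (hs : 0 < s)
    (hd : DifferentiableOn ℂ f (ball c s)) (hb : ∀ z ∈ ball c s, ‖f z‖ ≤ R) :
    ‖fderiv ℂ f c‖ ≤ 2 * R / s :=
  Complex.norm_fderiv_le_div_of_mapsTo_ball hd (mapsTo_closedBall_of_norm_le hs hb) hs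

/-- Second order Cauchy estimate for a bounded holomorphic function. -/
theorem norm_sub_fderiv_le_of_bounded {f : V → ℂ} {c z : V} {s R : ℝ}
    (hd : DifferentiableOn ℂ f (ball c s)) (hb : ∀ z ∈ ball c s, ‖f z‖ ≤ R) (hz : z ∈ ball c s) :
    ‖f z - f c - fderiv ℂ f c (z - c)‖ ≤ 4 * R * (‖z - c‖ / s) ^ 2 := by
  have hs : 0 < s := nonempty_ball.1 ⟨z, hz⟩
  have hR : 0 ≤ R := (norm_nonneg _).trans (hb z hz)
  -- Subtracting the linear part makes `u - u c` vanish to second order at `c`, so the Schwarz lemma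
  -- of higher order gives a quadratic bound. The linear part is at most `2 * R` on the ball, hence
  -- the range radius `4 * R`.
  set u : V → ℂ := fun w => f w - fderiv ℂ f c (w - c) with hu
  have hud : DifferentiableOn ℂ u (ball c s) :=
    hd.sub ((fderiv ℂ f c).differentiable.comp (differentiable_id.sub_const c)).differentiableOn
  have huc : u c = f c := by simp [hu]
  have hmaps : MapsTo u (ball c s) (closedBall (u c) (4 * R)) := by
    intro w hw
    rw [mem_closedBall, dist_eq_norm, huc]
    have h1 : ‖fderiv ℂ f c (w - c)‖ ≤ 2 * R := by
      refine ((fderiv ℂ f c).le_opNorm _).trans ?_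
      have h2 := norm_fderiv_le_of_bounded hs hd hb
      have h3 : ‖w - c‖ ≤ s := by rw [← dist_eq_norm]; exact (mem_ball.1 hw).le
      calc ‖fderiv ℂ f c‖ * ‖w - c‖ ≤ 2 * R / s * s := by gcongr
        _ = 2 * R := by field_simp
    have h4 : u w - f c = (f w - f c) - fderiv ℂ f c (w - c) := by simp only [hu]; ring
    rw [h4]
    linarith [norm_sub_le (f w - f c) (fderiv ℂ f c (w - c)), norm_sub_le (f w) (f c), hb w hw,
      hb c (mem_ball_self hs)]
  have hlo : (fun w => u w - u c) =o[𝓝 c] (fun w => ‖w - c‖ ^ 1) := by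
    have h := (hd.differentiableAt (ball_mem_nhds c hs)).hasFDerivAt.isLittleO
    simp only [pow_one]
    refine (h.norm_right).congr_left fun w => ?_
    rw [huc]
    simp only [hu]
    ring
  have := Complex.dist_le_mul_div_pow_of_mapsTo_ball_of_isLittleO hud hmaps hlo hz
  rw [dist_eq_norm, huc, dist_eq_norm] at this
  have h5 : f z - f c - fderiv ℂ f c (z - c) = u z - f c := by simp only [hu]; ring
  rwa [h5]

/-- A pointwise limit of uniformly bounded holomorphic functions is holomorphic. -/
theorem differentiableOn_of_tendsto_of_bounded [FiniteDimensional ℂ V] {A : Set V} (hA : IsOpen A)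
    {f : ℕ → V → ℂ} {g : V → ℂ} {R : ℝ} (hd : ∀ k, DifferentiableOn ℂ (f k) A)
    (hb : ∀ k, ∀ z ∈ A, ‖f k z‖ ≤ R) (hg : ∀ z ∈ A, Tendsto (fun k => f k z) atTop (𝓝 (g z))) :
    DifferentiableOn ℂ g A := by
  intro c hc
  obtain ⟨s, hs, hsA⟩ := Metric.isOpen_iff.1 hA c hc
  have hd' := fun k => (hd k).mono hsA
  have hb' := fun k z hz => hb k z (hsA hz)
  have : ProperSpace (V →L[ℂ] ℂ) := FiniteDimensional.proper ℂ _
  -- The derivatives at `c` are bounded in a finite dimensional space, so some subsequence converges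
  -- to `L`. The second order estimate is uniform in `k` and passes to the limit, which makes `L`
  -- the derivative of `g`.
  obtain ⟨L, -, φ, hφ, hL⟩ := tendsto_subseq_of_bounded
    (isBounded_closedBall (x := (0 : V →L[ℂ] ℂ)) (r := 2 * R / s))
    (x := fun k => fderiv ℂ (f k) c)
    fun k => by simpa using norm_fderiv_le_of_bounded hs (hd' k) (hb' k)
  have key : ∀ z ∈ ball c s, ‖g z - g c - L (z - c)‖ ≤ 4 * R * (‖z - c‖ / s) ^ 2 := by
    intro z hz
    have h1 : Tendsto (fun k => f (φ k) z - f (φ k) c - fderiv ℂ (f (φ k)) c (z - c)) atTop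
        (𝓝 (g z - g c - L (z - c))) :=
      (((hg z (hsA hz)).comp hφ.tendsto_atTop).sub ((hg c hc).comp hφ.tendsto_atTop)).sub
        (((ContinuousLinearMap.apply ℂ ℂ (z - c)).continuous.tendsto L).comp hL)
    exact le_of_tendsto h1.norm (Eventually.of_forall fun k =>
      norm_sub_fderiv_le_of_bounded (hd' _) (hb' _) hz)
  have hO : (fun z => g z - g c - L (z - c)) =O[𝓝 c] fun z => ‖z - c‖ ^ 2 := by
    refine Asymptotics.IsBigO.of_bound (4 * R / s ^ 2) ?_
    filter_upwards [ball_mem_nhds c hs] with z hz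
    refine (key z hz).trans (le_of_eq ?_)
    rw [norm_pow, norm_norm]
    field_simp
  have hlo : (fun z : V => ‖z - c‖ ^ 2) =o[𝓝 c] fun z => z - c := by
    have h := Asymptotics.isLittleO_norm_pow_id (E' := V) (one_lt_two)
    have ht : Tendsto (fun z : V => z - c) (𝓝 c) (𝓝 0) := by
      simpa using (continuous_id.sub continuous_const).tendsto (f := fun z : V => z - c) c
    exact h.comp_tendsto ht
  have : HasFDerivAt g L c := HasFDerivAt.of_isLittleO (hO.trans_isLittleO hlo)
  exact this.differentiableAt.differentiableWithinAt

/-- Montel's theorem, with pointwise convergence, for countably many sequences at once. -/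
theorem exists_subseq_tendsto_of_bounded [SecondCountableTopology V] {ι : Type*} [Countable ι]
    {A : ι → Set V} (hA : ∀ i, IsOpen (A i)) {R : ι → ℝ} (f : ℕ → ι → V → ℂ)
    (hd : ∀ k i, DifferentiableOn ℂ (f k i) (A i)) (hb : ∀ k i, ∀ z ∈ A i, ‖f k i z‖ ≤ R i) :
    ∃ φ : ℕ → ℕ, StrictMono φ ∧ ∀ i, ∀ z ∈ A i, ∃ w, Tendsto (fun k => f (φ k) i z) atTop (𝓝 w) := by
  classical
  let d : ℕ → V := TopologicalSpace.denseSeq V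
  let u : ℕ → (ι × ℕ → ℂ) := fun k p => if d p.2 ∈ A p.1 then f k p.1 (d p.2) else 0
  have hK : IsCompact (Set.pi univ fun p : ι × ℕ => closedBall (0 : ℂ) |R p.1|) :=
    isCompact_univ_pi fun p => isCompact_closedBall _ _
  obtain ⟨a, -, φ, hφ, hu⟩ := hK.tendsto_subseq (x := u) (by
    intro k p _
    simp only [u, mem_closedBall, dist_zero_right]
    split_ifs with h
    · exact (hb k _ _ h).trans (le_abs_self _)
    · simp)
  refine ⟨φ, hφ, fun i z hz => cauchySeq_tendsto_of_complete ?_⟩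
  obtain ⟨s, hs, hsA⟩ := Metric.isOpen_iff.1 (hA i) z hz
  have hlip : ∀ k, ∀ w ∈ ball z s, ‖f k i w - f k i z‖ ≤ 2 * R i / s * ‖w - z‖ := fun k w hw =>
    norm_sub_le_of_bounded ((hd k i).mono hsA) (fun y hy => hb k i y (hsA hy)) hw
  have hR : 0 ≤ R i := (norm_nonneg _).trans (hb 0 i z hz)
  rw [Metric.cauchySeq_iff']
  intro ε hε
  -- The `+ 1` keeps the denominator positive when `R i = 0`.
  set δ := min s (ε / 3 / (2 * R i / s + 1)) with hδ
  have hδ0 : 0 < δ := by positivity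
  obtain ⟨w, hw, m, rfl⟩ : (ball z δ ∩ range d).Nonempty :=
    (TopologicalSpace.denseRange_denseSeq V).inter_open_nonempty _ isOpen_ball
      ⟨z, mem_ball_self hδ0⟩
  have hwδ : ‖d m - z‖ < δ := by rwa [← dist_eq_norm]
  have hws : d m ∈ ball z s := ball_subset_ball (min_le_left _ _) hw
  have hmA : d m ∈ A i := hsA hws
  have hcau : CauchySeq fun k => f (φ k) i (d m) := by
    have h := (tendsto_pi_nhds.1 hu (i, m)).cauchySeq
    simpa [u, hmA, Function.comp_def] using h
  obtain ⟨N, hN⟩ := Metric.cauchySeq_iff'.1 hcau (ε / 3) (by positivity)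
  refine ⟨N, fun k hk => ?_⟩
  have hsm : ∀ j, ‖f j i (d m) - f j i z‖ < ε / 3 := by
    intro j
    refine (hlip j _ hws).trans_lt ?_
    have h1 : ‖d m - z‖ < ε / 3 / (2 * R i / s + 1) := hwδ.trans_le (min_le_right _ _)
    have h0 : 0 < 2 * R i / s + 1 := by positivity
    rw [lt_div_iff₀ h0] at h1
    nlinarith [norm_nonneg (d m - z)]
  have h1 := hsm (φ k)
  have h2 := hsm (φ N)
  have h3 := hN k hk
  rw [dist_eq_norm] at h3 ⊢
  have h4 : f (φ k) i z - f (φ N) i z = -(f (φ k) i (d m) - f (φ k) i z)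
    + (f (φ k) i (d m) - f (φ N) i (d m)) + (f (φ N) i (d m) - f (φ N) i z) := by ring
  rw [h4]
  refine (norm_add₃_le).trans_lt ?_
  rw [norm_neg]
  linarith

end Normal

/-! ### The sub-mean value property on polydiscs. -/

section MeanValue

variable {n : ℕ}

theorem measurable_indicator_of_continuousOn {α β : Type*} [TopologicalSpace α] [MeasurableSpace α]
    [BorelSpace α] [TopologicalSpace β] [MeasurableSpace β] [BorelSpace β] [Zero β]
    {f : α → β} {s : Set α} (hs : MeasurableSet s) (hf : ContinuousOn f s) :
    Measurable (s.indicator f) := by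
  classical
  rw [← Set.piecewise_eq_indicator]
  exact hf.measurable_piecewise continuousOn_const hs

theorem measurePreserving_smul_of_norm_eq_one {a : ℂ} (ha : ‖a‖ = 1) :
    MeasurePreserving (fun w : Fin n → ℂ => a • w) := by
  have h : MeasurePreserving (fun w : ℂ => a • w) := by
    have := (rotation ⟨a, by simp [Submonoid.unitSphere, ha]⟩).measurePreserving
    exact this
  exact volume_preserving_pi fun _ => h

/-- Mean value property of the holomorphic function `t ↦ g (z + t • w) ^ 2` on the unit circle. The
closed unit disc stays in its domain because `‖t • w‖ ≤ ‖w‖ < r`. -/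
theorem enorm_sq_mul_le_lintegral_circle {V : Type*} [NormedAddCommGroup V] [NormedSpace ℂ V]
    {g : V → ℂ} {z w : V} {r : ℝ} (hd : DifferentiableOn ℂ g (ball z r)) (hw : w ∈ ball 0 r) :
    ‖g z‖ₑ ^ 2 * ENNReal.ofReal (2 * Real.pi) ≤
      ∫⁻ θ in Ioc 0 (2 * Real.pi), ‖g (z + circleMap 0 1 θ • w)‖ₑ ^ 2 := by
  set h : ℂ → ℂ := fun t => g (z + t • w) ^ 2 with hh
  have hlin : Differentiable ℂ fun t : ℂ => z + t • w := by fun_prop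
  have hdiff : DifferentiableOn ℂ h ((fun t : ℂ => z + t • w) ⁻¹' ball z r) :=
    (hd.comp hlin.differentiableOn (mapsTo_preimage _ _)).pow 2
  have hcl : closedBall (0 : ℂ) |1| ⊆ (fun t : ℂ => z + t • w) ⁻¹' ball z r := by
    intro t ht
    simp only [mem_closedBall, dist_zero_right, mem_preimage, mem_ball, dist_self_add_left,
      norm_smul, abs_one] at ht hw ⊢
    exact (mul_le_of_le_one_left (norm_nonneg _) ht).trans_lt hw
  have hav := (hdiff.diffContOnCl_ball hcl).circleAverage
  have h0 : (2 * Real.pi) • h 0 = ∫ θ in Ioc 0 (2 * Real.pi), h (circleMap 0 1 θ) := by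
    rw [← hav, Real.circleAverage_def, smul_smul, mul_inv_cancel₀ (by positivity), one_smul,
      intervalIntegral.integral_of_le (by positivity)]
  have h1 : ‖(2 * Real.pi) • h 0‖ₑ = ‖g z‖ₑ ^ 2 * ENNReal.ofReal (2 * Real.pi) := by
    rw [enorm_smul, hh]
    simp only [zero_smul, add_zero, enorm_pow]
    rw [mul_comm, Real.enorm_of_nonneg (by positivity)]
  rw [← h1, h0]
  refine (enorm_integral_le_lintegral_enorm _).trans (le_of_eq ?_)
  simp [hh, enorm_pow]

/-- The sub-mean value property of `|g|²` on polydiscs. -/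
theorem enorm_sq_mul_volume_ball_le {g : (Fin n → ℂ) → ℂ} {z : Fin n → ℂ} {r : ℝ}
    (hd : DifferentiableOn ℂ g (ball z r)) :
    ‖g z‖ₑ ^ 2 * volume (ball z r) ≤ ∫⁻ w in ball z r, ‖g w‖ₑ ^ 2 := by
  set F : (Fin n → ℂ) → ℝ≥0∞ := (ball 0 r).indicator fun w => ‖g (z + w)‖ₑ ^ 2 with hF
  have hmaps : MapsTo (fun w : Fin n → ℂ => z + w) (ball 0 r) (ball z r) := by
    intro w hw; simpa using hw
  have hFm : Measurable F := by
    refine measurable_indicator_of_continuousOn measurableSet_ball ?_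
    exact ((ENNReal.continuous_pow 2).comp continuous_enorm).comp_continuousOn
      (hd.continuousOn.comp (by fun_prop) hmaps)
  -- Unit scalars preserve both the polydisc and Lebesgue measure. After the circle estimates are
  -- integrated over `w` and the integrals exchanged, every `θ` therefore contributes the same
  -- amount and the factor `2π` cancels.
  have hrot : ∀ θ : ℝ, ∫⁻ w, F (circleMap 0 1 θ • w) = ∫⁻ w, F w := fun θ =>
    (measurePreserving_smul_of_norm_eq_one (by simp)).lintegral_comp hFm
  have hint : ∫⁻ w, F w = ∫⁻ w in ball z r, ‖g w‖ₑ ^ 2 := by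
    rw [← lintegral_indicator measurableSet_ball,
      ← lintegral_add_left_eq_self ((ball z r).indicator fun w => ‖g w‖ₑ ^ 2) z]
    refine lintegral_congr fun w => ?_
    simp only [hF, indicator, mem_ball, dist_zero_right, dist_self_add_left]
  have hvol : volume (ball (0 : Fin n → ℂ) r) = volume (ball z r) := by
    rw [Measure.addHaar_ball_center volume z]
  have hstep : ∫⁻ w in ball (0 : Fin n → ℂ) r, ‖g z‖ₑ ^ 2 * ENNReal.ofReal (2 * Real.pi) ≤
      ∫⁻ w, ∫⁻ θ in Ioc 0 (2 * Real.pi), F (circleMap 0 1 θ • w) := by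
    refine (setLIntegral_mono' measurableSet_ball fun w hw => ?_).trans
      (setLIntegral_le_lintegral (ball (0 : Fin n → ℂ) r) _)
    refine (enorm_sq_mul_le_lintegral_circle hd hw).trans (le_of_eq (lintegral_congr fun θ => ?_))
    have : circleMap 0 1 θ • w ∈ ball (0 : Fin n → ℂ) r := by
      simpa [norm_smul] using hw
    rw [hF, indicator_of_mem this]
  have hswap : ∫⁻ w, ∫⁻ θ in Ioc 0 (2 * Real.pi), F (circleMap 0 1 θ • w) =
      ∫⁻ θ in Ioc 0 (2 * Real.pi), ∫⁻ w, F (circleMap 0 1 θ • w) := by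
    refine lintegral_lintegral_swap (Measurable.aemeasurable ?_)
    refine hFm.comp (Continuous.measurable ?_)
    exact ((continuous_circleMap 0 1).comp continuous_snd).smul continuous_fst
  rw [hswap] at hstep
  simp only [hrot, lintegral_const, hint, Measure.restrict_apply, MeasurableSet.univ, univ_inter,
    Real.volume_Ioc, sub_zero, hvol] at hstep
  have hpi : ENNReal.ofReal (2 * Real.pi) ≠ 0 := by simp [Real.pi_pos]
  rw [mul_right_comm] at hstep
  exact (ENNReal.mul_le_mul_iff_left hpi ENNReal.ofReal_ne_top).1 hstep

end MeanValue

/-! ### Determinants and top-degree alternating forms. -/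

section LinearAlgebra

variable {n : ℕ}

theorem det_of_map (A : (Fin n → ℂ) →ₗ[ℂ] (Fin n → ℂ)) (v : Fin n → Fin n → ℂ) :
    (Matrix.of fun i => A (v i)).det = LinearMap.det A * (Matrix.of v).det := by
  have : (Matrix.of fun i => A (v i)) = Matrix.of v * (LinearMap.toMatrix' A).transpose := by
    ext i j
    have h := congrFun (LinearMap.toMatrix'_mulVec A (v i)) j
    rw [Matrix.of_apply, ← h, Matrix.mul_apply, Matrix.mulVec, dotProduct]
    simp [mul_comm]
  rw [this, Matrix.det_mul, Matrix.det_transpose, LinearMap.det_toMatrix', mul_comm]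

theorem det_of_single : (Matrix.of fun i : Fin n => (Pi.single i 1 : Fin n → ℂ)).det = 1 := by
  have : (Matrix.of fun i : Fin n => (Pi.single i 1 : Fin n → ℂ)) = 1 := by
    ext i j
    simp [Matrix.one_apply, Pi.single_apply, eq_comm]
  rw [this, Matrix.det_one]

theorem alternatingMap_eq_det_mul (f : (Fin n → ℂ) [⋀^Fin n]→ₗ[ℂ] ℂ) (v : Fin n → Fin n → ℂ) :
    f v = (Matrix.of v).det * f fun i => Pi.single i 1 := by
  have h := congrArg (fun g => g v) (f.eq_smul_basis_det (Pi.basisFun ℂ (Fin n)))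
  simp only [AlternatingMap.smul_apply, Pi.basisFun_det] at h
  rw [h, smul_eq_mul, mul_comm]
  congr 1
  congr 1
  ext i
  simp

end LinearAlgebra

/-- Every tangent space is by definition `Fin n → ℂ`. Reading a form as a non-dependent function
lets the base point be replaced by an equal one without casts. -/
theorem apply_congr_point {n : ℕ} {X R : Type*} (η : ∀ _ : X, (Fin n → Fin n → ℂ) → R) {x y : X} (h : x = y)
    {v w : Fin n → Fin n → ℂ} (hv : v = w) : η x v = η y w := by
  subst h; subst hv; rfl

/-! ### Coordinate frames and the transformation laws of forms. -/

section Charts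

variable {n : ℕ} {X Y : Type*} [TopologicalSpace X] [ChartedSpace (Fin n → ℂ) X]
  [TopologicalSpace Y] [ChartedSpace (Fin n → ℂ) Y]

/-- Holomorphic charts. -/
structure IsHolChart (ψ : OpenPartialHomeomorph X (Fin n → ℂ)) : Prop where
  contMDiffOn : ContMDiffOn 𝓘(ℂ, Fin n → ℂ) 𝓘(ℂ, Fin n → ℂ) ω ψ ψ.source
  contMDiffOn_symm : ContMDiffOn 𝓘(ℂ, Fin n → ℂ) 𝓘(ℂ, Fin n → ℂ) ω ψ.symm ψ.target

theorem IsHolChart.of_mem_atlas [IsManifold 𝓘(ℂ, Fin n → ℂ) ω X]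
    {φ : OpenPartialHomeomorph X (Fin n → ℂ)} (h : φ ∈ atlas (Fin n → ℂ) X) : IsHolChart φ :=
  ⟨contMDiffOn_of_mem_maximalAtlas (IsManifold.subset_maximalAtlas h),
    contMDiffOn_symm_of_mem_maximalAtlas (IsManifold.subset_maximalAtlas h)⟩

variable {ψ : OpenPartialHomeomorph X (Fin n → ℂ)} {φ : OpenPartialHomeomorph Y (Fin n → ℂ)}

theorem IsHolChart.contMDiffAt (h : IsHolChart ψ) {x : X} (hx : x ∈ ψ.source) :
    ContMDiffAt 𝓘(ℂ, Fin n → ℂ) 𝓘(ℂ, Fin n → ℂ) ω ψ x :=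
  h.contMDiffOn.contMDiffAt (ψ.open_source.mem_nhds hx)

theorem IsHolChart.contMDiffAt_symm (h : IsHolChart ψ) {z : Fin n → ℂ} (hz : z ∈ ψ.target) :
    ContMDiffAt 𝓘(ℂ, Fin n → ℂ) 𝓘(ℂ, Fin n → ℂ) ω ψ.symm z :=
  h.contMDiffOn_symm.contMDiffAt (ψ.open_target.mem_nhds hz)

theorem contDiffAt_transition (hψ : IsHolChart ψ) (hφ : IsHolChart φ) {p : X → Y} {z : Fin n → ℂ}
    (hp : ContMDiffAt 𝓘(ℂ, Fin n → ℂ) 𝓘(ℂ, Fin n → ℂ) ω p (ψ.symm z)) (hz : z ∈ ψ.target)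
    (hpz : p (ψ.symm z) ∈ φ.source) : ContDiffAt ℂ ω (fun w => φ (p (ψ.symm w))) z :=
  ((hφ.contMDiffAt hpz).comp z (hp.comp z (hψ.contMDiffAt_symm hz))).contDiffAt

/-- Chain rule for the two factorisations of `p ∘ ψ.symm` near `z`: directly, and as `φ.symm` after
the coordinate expression of `p`. -/
theorem mfderiv_coordFrame (hψ : IsHolChart ψ) (hφ : IsHolChart φ) {p : X → Y} {z : Fin n → ℂ}
    (hp : ContMDiffAt 𝓘(ℂ, Fin n → ℂ) 𝓘(ℂ, Fin n → ℂ) ω p (ψ.symm z)) (hz : z ∈ ψ.target)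
    (hpz : p (ψ.symm z) ∈ φ.source) (i : Fin n) :
    (mfderiv 𝓘(ℂ, Fin n → ℂ) 𝓘(ℂ, Fin n → ℂ) p (ψ.symm z) (coordFrame ψ z i) : Fin n → ℂ) =
      mfderiv 𝓘(ℂ, Fin n → ℂ) 𝓘(ℂ, Fin n → ℂ) φ.symm (φ (p (ψ.symm z)))
        (fderiv ℂ (fun w => φ (p (ψ.symm w))) z (Pi.single i 1 : Fin n → ℂ)) := by
  have hT := contDiffAt_transition hψ hφ hp hz hpz
  have h1 : HasMFDerivAt 𝓘(ℂ, Fin n → ℂ) 𝓘(ℂ, Fin n → ℂ) (fun w => p (ψ.symm w)) z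
      ((mfderiv 𝓘(ℂ, Fin n → ℂ) 𝓘(ℂ, Fin n → ℂ) p (ψ.symm z)).comp
        (mfderiv 𝓘(ℂ, Fin n → ℂ) 𝓘(ℂ, Fin n → ℂ) ψ.symm z)) :=
    (hp.mdifferentiableAt (by simp)).hasMFDerivAt.comp z
      ((hψ.contMDiffAt_symm hz).mdifferentiableAt (by simp)).hasMFDerivAt
  have h2 : HasMFDerivAt 𝓘(ℂ, Fin n → ℂ) 𝓘(ℂ, Fin n → ℂ)
      (fun w => φ.symm (φ (p (ψ.symm w)))) z
      ((mfderiv 𝓘(ℂ, Fin n → ℂ) 𝓘(ℂ, Fin n → ℂ) φ.symm (φ (p (ψ.symm z)))).comp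
        (fderiv ℂ (fun w => φ (p (ψ.symm w))) z)) :=
    HasMFDerivAt.comp z
      (((hφ.contMDiffAt_symm (φ.map_source hpz)).mdifferentiableAt (by simp)).hasMFDerivAt)
      ((hT.differentiableAt (by simp)).hasFDerivAt.hasMFDerivAt)
  have hev : (fun w => p (ψ.symm w)) =ᶠ[𝓝 z] fun w => φ.symm (φ (p (ψ.symm w))) := by
    have hc : ContinuousAt (fun w => p (ψ.symm w)) z :=
      hp.continuousAt.comp (hψ.contMDiffAt_symm hz).continuousAt
    filter_upwards [hc (φ.open_source.mem_nhds hpz)] with w hw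
    exact (φ.left_inv hw).symm
  have h3 := h2.congr_of_eventuallyEq hev
  have h4 := hasMFDerivAt_unique h1 h3
  exact congrArg (fun L : (Fin n → ℂ) →L[ℂ] (Fin n → ℂ) => L (Pi.single i 1 : Fin n → ℂ)) h4

/-- Transformation law of `(n, n)`-forms `η ≥ 0`. -/
def IsDensity (η : FrameFun n X ℝ≥0∞) : Prop :=
  ∀ (x : X) (v : Fin n → Fin n → ℂ),
    η x v = ‖(Matrix.of v).det‖ₑ ^ 2 * η x fun i => (Pi.single i 1 : Fin n → ℂ)

/-- With `p` the identity this is the change of chart. The squared modulus of the complex Jacobian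
determinant is what the real change of variables formula requires. -/
theorem IsDensity.apply_mfderiv_coordFrame (hψ : IsHolChart ψ) (hφ : IsHolChart φ) {p : X → Y}
    {z : Fin n → ℂ} (hp : ContMDiffAt 𝓘(ℂ, Fin n → ℂ) 𝓘(ℂ, Fin n → ℂ) ω p (ψ.symm z))
    (hz : z ∈ ψ.target) (hpz : p (ψ.symm z) ∈ φ.source) {η : FrameFun n Y ℝ≥0∞}
    (hη : IsDensity η) :
    η (p (ψ.symm z)) (fun i => mfderiv 𝓘(ℂ, Fin n → ℂ) 𝓘(ℂ, Fin n → ℂ) p (ψ.symm z)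
        (coordFrame ψ z i)) =
      ‖(fderiv ℂ (fun w => φ (p (ψ.symm w))) z).det‖ₑ ^ 2 *
        frameCoeff φ η (φ (p (ψ.symm z))) := by
  have hx := φ.left_inv hpz
  have h1 := apply_congr_point (fun y (v : Fin n → Fin n → ℂ) => η y v) hx.symm
    (funext fun i => mfderiv_coordFrame hψ hφ hp hz hpz i)
  refine h1.trans ?_
  rw [frameCoeff]
  set A : (Fin n → ℂ) →L[ℂ] (Fin n → ℂ) :=
    mfderiv 𝓘(ℂ, Fin n → ℂ) 𝓘(ℂ, Fin n → ℂ) φ.symm (φ (p (ψ.symm z))) with hA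
  set L := fderiv ℂ (fun w => φ (p (ψ.symm w))) z
  have h2 := hη (φ.symm (φ (p (ψ.symm z)))) fun i => A (L (Pi.single i 1 : Fin n → ℂ))
  have h3 := hη (φ.symm (φ (p (ψ.symm z)))) fun i => A (Pi.single i 1 : Fin n → ℂ)
  refine h2.trans ?_
  have h4 : coordFrame φ (φ (p (ψ.symm z))) = fun i => A (Pi.single i 1 : Fin n → ℂ) := rfl
  rw [h4, h3, ← mul_assoc]
  congr 1
  have e1 := det_of_map (A : (Fin n → ℂ) →ₗ[ℂ] (Fin n → ℂ)) fun i => L (Pi.single i 1 : Fin n → ℂ)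
  have e2 := det_of_map (A : (Fin n → ℂ) →ₗ[ℂ] (Fin n → ℂ)) fun i => (Pi.single i 1 : Fin n → ℂ)
  have e3 := det_of_map (L : (Fin n → ℂ) →ₗ[ℂ] (Fin n → ℂ)) fun i => (Pi.single i 1 : Fin n → ℂ)
  rw [det_of_single, mul_one] at e2 e3
  simp only [ContinuousLinearMap.coe_coe] at e1 e2 e3
  rw [e1, e2, e3, enorm_mul, mul_pow, mul_comm]

/-- The coefficient of the pullback of an `(n, 0)`-form. -/
theorem apply_mfderiv_coordFrame (hψ : IsHolChart ψ) (hφ : IsHolChart φ) {p : X → Y}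
    {z : Fin n → ℂ} (hp : ContMDiffAt 𝓘(ℂ, Fin n → ℂ) 𝓘(ℂ, Fin n → ℂ) ω p (ψ.symm z))
    (hz : z ∈ ψ.target) (hpz : p (ψ.symm z) ∈ φ.source) (f : TopForm n Y) :
    f (p (ψ.symm z)) (fun i => mfderiv 𝓘(ℂ, Fin n → ℂ) 𝓘(ℂ, Fin n → ℂ) p (ψ.symm z)
        (coordFrame ψ z i)) =
      (fderiv ℂ (fun w => φ (p (ψ.symm w))) z).det * formCoeff φ f (φ (p (ψ.symm z))) := by
  have hx := φ.left_inv hpz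
  have h1 := apply_congr_point (fun y (v : Fin n → Fin n → ℂ) => f y v) hx.symm
    (funext fun i => mfderiv_coordFrame hψ hφ hp hz hpz i)
  refine h1.trans ?_
  rw [formCoeff]
  set A : (Fin n → ℂ) →L[ℂ] (Fin n → ℂ) :=
    mfderiv 𝓘(ℂ, Fin n → ℂ) 𝓘(ℂ, Fin n → ℂ) φ.symm (φ (p (ψ.symm z))) with hA
  set L := fderiv ℂ (fun w => φ (p (ψ.symm w))) z
  have h2 := alternatingMap_eq_det_mul (f (φ.symm (φ (p (ψ.symm z)))))
    fun i => A (L (Pi.single i 1 : Fin n → ℂ))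
  have h3 := alternatingMap_eq_det_mul (f (φ.symm (φ (p (ψ.symm z)))))
    fun i => A (Pi.single i 1 : Fin n → ℂ)
  refine h2.trans ?_
  have h4 : coordFrame φ (φ (p (ψ.symm z))) = fun i => A (Pi.single i 1 : Fin n → ℂ) := rfl
  rw [h4]
  refine Eq.trans ?_ (congrArg _ h3.symm)
  rw [← mul_assoc]
  congr 1
  have e1 := det_of_map (A : (Fin n → ℂ) →ₗ[ℂ] (Fin n → ℂ)) fun i => L (Pi.single i 1 : Fin n → ℂ)
  have e2 := det_of_map (A : (Fin n → ℂ) →ₗ[ℂ] (Fin n → ℂ)) fun i => (Pi.single i 1 : Fin n → ℂ)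
  have e3 := det_of_map (L : (Fin n → ℂ) →ₗ[ℂ] (Fin n → ℂ)) fun i => (Pi.single i 1 : Fin n → ℂ)
  rw [det_of_single, mul_one] at e2 e3
  simp only [ContinuousLinearMap.coe_coe] at e1 e2 e3
  rw [e1, e2, e3, mul_comm]

end Charts

/-! ### Borel sets read in a chart. -/

section CoordSet

variable {n : ℕ} {X : Type*} [TopologicalSpace X]

/-- The image of `P` in the chart `ψ`. -/
def coordSet (ψ : OpenPartialHomeomorph X (Fin n → ℂ)) (P : Set X) : Set (Fin n → ℂ) :=
  ψ.target ∩ ψ.symm ⁻¹' P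

theorem measurableSet_coordSet (ψ : OpenPartialHomeomorph X (Fin n → ℂ)) {P : Set X}
    (hP : MeasurableSet[borel X] P) : MeasurableSet (coordSet ψ P) := by
  borelize X
  have h1 : Measurable (ψ.target.domRestrict ψ.symm) :=
    (continuousOn_iff_continuous_domRestrict.1 ψ.continuousOn_symm).measurable
  have h2 : coordSet ψ P = Subtype.val '' (ψ.target.domRestrict ψ.symm ⁻¹' P) := by
    ext w
    simp [coordSet, Set.domRestrict, and_comm]
  rw [h2]
  exact ψ.open_target.measurableSet.subtype_image (h1 hP)

theorem coordSet_inter_source (φ : OpenPartialHomeomorph X (Fin n → ℂ)) (P : Set X) :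
    coordSet φ (P ∩ φ.source) = coordSet φ P := by
  ext w
  exact ⟨fun h => ⟨h.1, h.2.1⟩, fun h => ⟨h.1, h.2, φ.map_target h.1⟩⟩

end CoordSet

/-! ### Chart measures, their gluing, and integration over a partition into chart pieces. -/

section Transition

variable {n : ℕ} {X : Type*} [TopologicalSpace X] [ChartedSpace (Fin n → ℂ) X]
  {ψ φ : OpenPartialHomeomorph X (Fin n → ℂ)} {z : Fin n → ℂ}

theorem IsDensity.frameCoeff_eq (hψ : IsHolChart ψ) (hφ : IsHolChart φ) (hz : z ∈ ψ.target)
    (hφz : ψ.symm z ∈ φ.source) {η : FrameFun n X ℝ≥0∞} (hη : IsDensity η) :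
    frameCoeff ψ η z = ‖(fderiv ℂ (fun w => φ (ψ.symm w)) z).det‖ₑ ^ 2 *
        frameCoeff φ η (φ (ψ.symm z)) := by
  have h := hη.apply_mfderiv_coordFrame hψ hφ (p := fun x => x) contMDiffAt_id hz hφz
  rw [← h, frameCoeff]
  congr 1
  ext1 i
  rw [show mfderiv 𝓘(ℂ, Fin n → ℂ) 𝓘(ℂ, Fin n → ℂ) (fun x : X => x) (ψ.symm z) =
    ContinuousLinearMap.id ℂ _ from mfderiv_id]
  rfl

theorem formCoeff_eq (hψ : IsHolChart ψ) (hφ : IsHolChart φ) (hz : z ∈ ψ.target)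
    (hφz : ψ.symm z ∈ φ.source) (f : TopForm n X) :
    formCoeff ψ f z = (fderiv ℂ (fun w => φ (ψ.symm w)) z).det *
        formCoeff φ f (φ (ψ.symm z)) := by
  have h := BergmanTower.apply_mfderiv_coordFrame hψ hφ (p := fun x => x) contMDiffAt_id hz hφz f
  rw [← h, formCoeff]
  congr 1
  ext1 i
  rw [show mfderiv 𝓘(ℂ, Fin n → ℂ) 𝓘(ℂ, Fin n → ℂ) (fun x : X => x) (ψ.symm z) =
    ContinuousLinearMap.id ℂ _ from mfderiv_id]
  rfl

theorem enorm_det_restrictScalars (L : (Fin n → ℂ) →L[ℂ] (Fin n → ℂ)) :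
    ENNReal.ofReal |(L.restrictScalars ℝ).det| = ‖L.det‖ₑ ^ 2 := by
  have h : (L.restrictScalars ℝ).det = ‖L.det‖ ^ 2 := by
    have := LinearMap.det_restrictScalars (R := ℝ) (S := ℂ) (f := (L : (Fin n → ℂ) →ₗ[ℂ] (Fin n → ℂ)))
    rw [Algebra.norm_complex_apply, Complex.normSq_eq_norm_sq] at this
    exact this
  rw [h, abs_of_nonneg (by positivity), ← ofReal_norm, ENNReal.ofReal_pow (norm_nonneg _)]

/-- Change of variables along the transition map, whose real Jacobian is the squared modulus of the
complex one. This is the agreement of the chart measures on overlaps. -/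
theorem IsDensity.lintegral_coordSet_eq (hψ : IsHolChart ψ) (hφ : IsHolChart φ) {P : Set X}
    (hP : MeasurableSet[borel X] P) (hPψ : P ⊆ ψ.source) (hPφ : P ⊆ φ.source)
    {η : FrameFun n X ℝ≥0∞} (hη : IsDensity η) :
    ∫⁻ z in coordSet φ P, frameCoeff φ η z = ∫⁻ z in coordSet ψ P, frameCoeff ψ η z := by
  have himg : (fun w => φ (ψ.symm w)) '' coordSet ψ P = coordSet φ P := by
    ext w
    constructor
    · rintro ⟨z, ⟨hz, hzP⟩, rfl⟩
      exact ⟨φ.map_source (hPφ hzP), by simpa [φ.left_inv (hPφ hzP)] using hzP⟩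
    · rintro ⟨hw, hwP⟩
      refine ⟨ψ (φ.symm w), ⟨ψ.map_source (hPψ hwP), ?_⟩, ?_⟩
      · simpa [ψ.left_inv (hPψ hwP)] using hwP
      · simp [ψ.left_inv (hPψ hwP), φ.right_inv hw]
  have hinj : InjOn (fun w => φ (ψ.symm w)) (coordSet ψ P) := by
    intro a ha b hb hab
    exact ψ.symm.injOn ha.1 hb.1 (φ.injOn (hPφ ha.2) (hPφ hb.2) hab)
  have hder : ∀ z ∈ coordSet ψ P, HasFDerivWithinAt (fun w => φ (ψ.symm w))
      ((fderiv ℂ (fun w => φ (ψ.symm w)) z).restrictScalars ℝ) (coordSet ψ P) z := by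
    intro z hz
    have h := contDiffAt_transition hψ hφ (p := fun x => x) contMDiffAt_id hz.1 (hPφ hz.2)
    exact (h.differentiableAt (by simp)).hasFDerivAt.restrictScalars ℝ |>.hasFDerivWithinAt
  rw [← himg, lintegral_image_eq_lintegral_abs_det_fderiv_mul volume
    (measurableSet_coordSet ψ hP) hder hinj]
  refine setLIntegral_congr_fun (measurableSet_coordSet ψ hP) fun z hz => ?_
  rw [enorm_det_restrictScalars, hη.frameCoeff_eq hψ hφ hz.1 (hPφ hz.2)]

theorem chartMeasure_apply (φ : OpenPartialHomeomorph X (Fin n → ℂ)) (η : FrameFun n X ℝ≥0∞)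
    {P : Set X} (hP : MeasurableSet[borel X] P) :
    chartMeasure φ η P = ∫⁻ z in coordSet φ P, frameCoeff φ η z := by
  borelize X
  -- `φ.symm` is controlled only on `φ.target`, which carries all the mass, so almost everywhere
  -- measurability is what is available and what suffices.
  have hm : AEMeasurable φ.symm
      ((volume.restrict φ.target).withDensity (frameCoeff φ η)) :=
    (φ.continuousOn_symm.aemeasurable φ.open_target.measurableSet).mono_ac
      (withDensity_absolutelyContinuous _ _)
  rw [chartMeasure, Measure.map_apply_of_aemeasurable hm hP]
  have hae : φ.symm ⁻¹' P =ᵐ[(volume.restrict φ.target).withDensity (frameCoeff φ η)]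
      coordSet φ P := by
    refine (withDensity_absolutelyContinuous _ _).ae_eq ?_
    filter_upwards [ae_restrict_mem φ.open_target.measurableSet] with w hw
    exact propext ⟨fun h => ⟨hw, h⟩, fun h => h.2⟩
  rw [measure_congr hae, withDensity_apply _ (measurableSet_coordSet φ hP),
    Measure.restrict_restrict (measurableSet_coordSet φ hP), coordSet, inter_right_comm, inter_self]

/-- A countable disjoint Borel cover by pieces of holomorphic chart domains. -/
structure IsChartPartition {A : Type*} (ψ : A → OpenPartialHomeomorph X (Fin n → ℂ))
    (D : A → Set X) : Prop where
  isHolChart : ∀ a, IsHolChart (ψ a)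
  measurableSet : ∀ a, MeasurableSet[borel X] (D a)
  subset_source : ∀ a, D a ⊆ (ψ a).source
  disjoint : Pairwise (Function.onFun Disjoint D)
  iUnion : ⋃ a, D a = univ

theorem IsChartPartition.tsum_measure {A : Type*} [Countable A]
    {ψ : A → OpenPartialHomeomorph X (Fin n → ℂ)} {D : A → Set X} (h : IsChartPartition ψ D)
    (ν : @Measure X (borel X)) {P : Set X} (hP : MeasurableSet[borel X] P) :
    ν P = ∑' a, ν (D a ∩ P) := by
  borelize X
  rw [← measure_iUnion (fun a b hab => (h.disjoint hab).mono inter_subset_left inter_subset_left)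
    (fun a => (h.measurableSet a).inter hP), ← iUnion_inter, h.iUnion, univ_inter]

theorem IsChartPartition.chartMeasure_eq_tsum {A : Type*} [Countable A]
    {ψ : A → OpenPartialHomeomorph X (Fin n → ℂ)} {D : A → Set X} (h : IsChartPartition ψ D)
    {φ : OpenPartialHomeomorph X (Fin n → ℂ)} (hφ : IsHolChart φ) {η : FrameFun n X ℝ≥0∞}
    (hη : IsDensity η) {P : Set X} (hP : MeasurableSet[borel X] P) :
    chartMeasure φ η P = ∑' a, chartMeasure (ψ a) η (D a ∩ (P ∩ φ.source)) := by
  borelize X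
  have hPs : MeasurableSet (P ∩ φ.source) := hP.inter φ.open_source.measurableSet
  have h1 : chartMeasure φ η P = chartMeasure φ η (P ∩ φ.source) := by
    rw [chartMeasure_apply φ η hP, chartMeasure_apply φ η hPs, coordSet_inter_source]
  rw [h1, h.tsum_measure _ hPs]
  refine tsum_congr fun a => ?_
  have hm := (h.measurableSet a).inter hPs
  rw [chartMeasure_apply _ _ hm, chartMeasure_apply _ _ hm]
  exact hη.lintegral_coordSet_eq (h.isHolChart a) hφ hm
    (inter_subset_left.trans (h.subset_source a)) (inter_subset_right.trans inter_subset_right)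

theorem exists_isChartPartition_atlas [SecondCountableTopology X]
    [IsManifold 𝓘(ℂ, Fin n → ℂ) ω X] :
    ∃ (A : Type) (_ : Countable A) (ψ : A → OpenPartialHomeomorph X (Fin n → ℂ)) (D : A → Set X),
      (∀ a, ψ a ∈ atlas (Fin n → ℂ) X) ∧ IsChartPartition ψ D := by
  borelize X
  rcases isEmpty_or_nonempty X with hX | ⟨⟨x₀⟩⟩
  · exact ⟨Empty, inferInstance, fun a => a.elim, fun a => a.elim, fun a => a.elim,
      fun a => a.elim, fun a => a.elim, fun a => a.elim, fun a => a.elim, Subsingleton.elim _ _⟩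
  obtain ⟨s, hs, hcov⟩ := TopologicalSpace.countable_cover_nhds
    fun x : X => (chartAt (Fin n → ℂ) x).open_source.mem_nhds (mem_chart_source _ x)
  have hne : s.Nonempty := by
    by_contra h
    rw [not_nonempty_iff_eq_empty.1 h] at hcov
    simp only [mem_empty_iff_false, iUnion_of_empty, iUnion_empty] at hcov
    exact absurd (mem_univ x₀) (hcov ▸ notMem_empty x₀)
  obtain ⟨u, rfl⟩ := hs.exists_eq_range hne
  refine ⟨ℕ, inferInstance, fun k => chartAt (Fin n → ℂ) (u k),
    disjointed fun k => (chartAt (Fin n → ℂ) (u k)).source, fun k => chart_mem_atlas _ _,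
    fun k => .of_mem_atlas (chart_mem_atlas _ _),
    fun k => .disjointed (fun j => (chartAt (Fin n → ℂ) (u j)).open_source.measurableSet) k,
    fun k => disjointed_subset _ k, disjoint_disjointed _, ?_⟩
  rw [iUnion_disjointed]
  simpa using hcov

/-- The measure glued from the pieces dominates every chart measure, hence their supremum.
Conversely, on each piece it is at most that supremum. -/
theorem IsChartPartition.formMeasure_apply [SecondCountableTopology X]
    [IsManifold 𝓘(ℂ, Fin n → ℂ) ω X] {A : Type*} [Countable A]
    {ψ : A → OpenPartialHomeomorph X (Fin n → ℂ)} {D : A → Set X} (h : IsChartPartition ψ D)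
    {η : FrameFun n X ℝ≥0∞} (hη : IsDensity η) {P : Set X} (hP : MeasurableSet[borel X] P) :
    formMeasure η P = ∑' a, ∫⁻ z in coordSet (ψ a) (D a ∩ P), frameCoeff (ψ a) η z := by
  borelize X
  have hrw : ∀ a, ∫⁻ z in coordSet (ψ a) (D a ∩ P), frameCoeff (ψ a) η z =
      chartMeasure (ψ a) η (D a ∩ P) := fun a =>
    (chartMeasure_apply _ _ ((h.measurableSet a).inter hP)).symm
  simp only [hrw]
  refine le_antisymm ?_ ?_
  · set ν : Measure X := Measure.sum fun a => (chartMeasure (ψ a) η).restrict (D a) with hν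
    have hνP : ∀ {Q : Set X}, MeasurableSet Q → ν Q = ∑' a, chartMeasure (ψ a) η (D a ∩ Q) := by
      intro Q hQ
      rw [hν, Measure.sum_apply _ hQ]
      refine tsum_congr fun a => ?_
      rw [Measure.restrict_apply hQ, inter_comm]
    rw [← hνP hP]
    have hle : formMeasure η ≤ ν := by
      refine iSup₂_le fun φ hφ => Measure.le_iff.2 fun Q hQ => ?_
      rw [h.chartMeasure_eq_tsum (.of_mem_atlas hφ) hη hQ, hνP hQ]
      exact ENNReal.tsum_le_tsum fun a =>
        measure_mono (inter_subset_inter_right _ inter_subset_left)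
    exact hle P
  -- The charts `ψ a` need not belong to the atlas over which the supremum is taken, so each piece
  -- is cut further along a partition by atlas charts.
  · obtain ⟨A', _, ψ', D', hat, h'⟩ := exists_isChartPartition_atlas (n := n) (X := X)
    rw [h.tsum_measure (formMeasure η) hP]
    refine ENNReal.tsum_le_tsum fun a => ?_
    have hm : MeasurableSet (D a ∩ P) := (h.measurableSet a).inter hP
    rw [h'.chartMeasure_eq_tsum (h.isHolChart a) hη hm, h'.tsum_measure (formMeasure η) hm]
    refine ENNReal.tsum_le_tsum fun k => ?_
    refine (measure_mono (inter_subset_inter_right _ inter_subset_left)).trans ?_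
    have hle : chartMeasure (ψ' k) η ≤ formMeasure η := by
      unfold formMeasure
      exact le_iSup₂_of_le (ψ' k) (hat k) le_rfl
    exact hle _

theorem IsChartPartition.lintegralForm_eq [SecondCountableTopology X]
    [IsManifold 𝓘(ℂ, Fin n → ℂ) ω X] {A : Type*} [Countable A]
    {ψ : A → OpenPartialHomeomorph X (Fin n → ℂ)} {D : A → Set X} (h : IsChartPartition ψ D)
    {η : FrameFun n X ℝ≥0∞} (hη : IsDensity η) :
    lintegralForm η = ∑' a, ∫⁻ z in coordSet (ψ a) (D a), frameCoeff (ψ a) η z := by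
  rw [lintegralForm, h.formMeasure_apply hη (@MeasurableSet.univ _ (borel X))]
  simp only [inter_univ]

end Transition

/-! ### Pullback of forms, and holomorphy in arbitrary holomorphic charts. -/

section Pullback

variable {n : ℕ} {X Y Z : Type*} [TopologicalSpace X] [ChartedSpace (Fin n → ℂ) X]
  [TopologicalSpace Y] [ChartedSpace (Fin n → ℂ) Y]
  [TopologicalSpace Z] [ChartedSpace (Fin n → ℂ) Z]

/-- The pullback of `(n, 0)`-forms under `p`. -/
def pullback (p : X → Y) : TopForm n Y →ₗ[ℂ] TopForm n X where
  toFun f x := (f (p x)).compLinearMap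
    (mfderiv 𝓘(ℂ, Fin n → ℂ) 𝓘(ℂ, Fin n → ℂ) p x).toLinearMap
  map_add' _ _ := rfl
  map_smul' _ _ := rfl

theorem pullback_apply (p : X → Y) (f : TopForm n Y) (x : X)
    (v : Fin n → TangentSpace 𝓘(ℂ, Fin n → ℂ) x) :
    pullback p f x v = f (p x) fun i => mfderiv 𝓘(ℂ, Fin n → ℂ) 𝓘(ℂ, Fin n → ℂ) p x (v i) := rfl

theorem pullback_id (f : TopForm n X) : pullback (fun x => x) f = f := by
  funext x
  ext v
  rw [pullback_apply, show mfderiv 𝓘(ℂ, Fin n → ℂ) 𝓘(ℂ, Fin n → ℂ) (fun x : X => x) x =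
    ContinuousLinearMap.id ℂ _ from mfderiv_id]
  rfl

theorem pullback_pullback {p : Y → Z} {q : X → Y}
    (hp : ContMDiff 𝓘(ℂ, Fin n → ℂ) 𝓘(ℂ, Fin n → ℂ) ω p)
    (hq : ContMDiff 𝓘(ℂ, Fin n → ℂ) 𝓘(ℂ, Fin n → ℂ) ω q) (f : TopForm n Z) :
    pullback q (pullback p f) = pullback (fun x => p (q x)) f := by
  funext x
  ext v
  simp only [pullback_apply]
  have h : mfderiv 𝓘(ℂ, Fin n → ℂ) 𝓘(ℂ, Fin n → ℂ) (fun x => p (q x)) x = _ :=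
    mfderiv_comp x ((hp (q x)).mdifferentiableAt (by simp)) ((hq x).mdifferentiableAt (by simp))
  rw [h]
  rfl

theorem differentiableAt_det {T : (Fin n → ℂ) → (Fin n → ℂ)} {z : Fin n → ℂ}
    (hT : ContDiffAt ℂ ω T z) : DifferentiableAt ℂ (fun w => (fderiv ℂ T w).det) z := by
  have h1 : DifferentiableAt ℂ (fderiv ℂ T) z :=
    (hT.fderiv_right (m := ω) (by simp)).differentiableAt (by simp)
  have h2 : (fun w => (fderiv ℂ T w).det) =
      fun w => (Matrix.of fun i => fderiv ℂ T w (Pi.single i 1)).det := by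
    funext w
    have := det_of_map (fderiv ℂ T w : (Fin n → ℂ) →ₗ[ℂ] (Fin n → ℂ)) fun i => Pi.single i 1
    rw [det_of_single, mul_one] at this
    exact this.symm
  rw [h2]
  simp only [Matrix.det_apply, Matrix.of_apply]
  refine DifferentiableAt.fun_sum fun σ _ => DifferentiableAt.const_smul ?_ _
  have h4 : ∀ i ∈ Finset.univ, DifferentiableAt ℂ
      (fun w => fderiv ℂ T w (Pi.single (σ i) 1) i) z := fun i _ =>
    differentiableAt_pi.1 (h1.clm_apply (differentiableAt_const _)) i
  exact (HasFDerivAt.finsetProd fun i hi => (h4 i hi).hasFDerivAt).differentiableAt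

theorem differentiableOn_formCoeff_pullback [IsManifold 𝓘(ℂ, Fin n → ℂ) ω Y]
    {ψ : OpenPartialHomeomorph X (Fin n → ℂ)} (hψ : IsHolChart ψ) {p : X → Y}
    (hp : ContMDiff 𝓘(ℂ, Fin n → ℂ) 𝓘(ℂ, Fin n → ℂ) ω p) {f : TopForm n Y}
    (hf : f ∈ holomorphicForms n Y) :
    DifferentiableOn ℂ (formCoeff ψ (pullback p f)) ψ.target := by
  intro z hz
  set φ := chartAt (Fin n → ℂ) (p (ψ.symm z)) with hφ
  have hφh : IsHolChart φ := .of_mem_atlas (chart_mem_atlas _ _)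
  have hpz : p (ψ.symm z) ∈ φ.source := mem_chart_source _ _
  have hT := contDiffAt_transition hψ hφh (hp _) hz hpz
  have hc : ContinuousAt (fun w => p (ψ.symm w)) z :=
    (hp _).continuousAt.comp (hψ.contMDiffAt_symm hz).continuousAt
  have hev : formCoeff ψ (pullback p f) =ᶠ[𝓝 z]
      fun w => (fderiv ℂ (fun w => φ (p (ψ.symm w))) w).det * formCoeff φ f (φ (p (ψ.symm w))) := by
    filter_upwards [hc (φ.open_source.mem_nhds hpz), ψ.open_target.mem_nhds hz] with w hw hwt
    exact apply_mfderiv_coordFrame hψ hφh (hp _) hwt hw f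
  have hd : DifferentiableAt ℂ (formCoeff φ f) (φ (p (ψ.symm z))) :=
    (hf φ (chart_mem_atlas _ _)).differentiableAt (φ.open_target.mem_nhds (φ.map_source hpz))
  have h := (differentiableAt_det hT).mul
    (DifferentiableAt.comp z hd (hT.differentiableAt (by simp)))
  exact (h.congr_of_eventuallyEq hev).differentiableWithinAt

theorem differentiableOn_formCoeff [IsManifold 𝓘(ℂ, Fin n → ℂ) ω X]
    {ψ : OpenPartialHomeomorph X (Fin n → ℂ)} (hψ : IsHolChart ψ) {f : TopForm n X}
    (hf : f ∈ holomorphicForms n X) : DifferentiableOn ℂ (formCoeff ψ f) ψ.target := by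
  have := differentiableOn_formCoeff_pullback hψ contMDiff_id hf
  rwa [show pullback id f = f from pullback_id f] at this

theorem pullback_mem_holomorphicForms [IsManifold 𝓘(ℂ, Fin n → ℂ) ω X]
    [IsManifold 𝓘(ℂ, Fin n → ℂ) ω Y] {p : X → Y}
    (hp : ContMDiff 𝓘(ℂ, Fin n → ℂ) 𝓘(ℂ, Fin n → ℂ) ω p) {f : TopForm n Y}
    (hf : f ∈ holomorphicForms n Y) : pullback p f ∈ holomorphicForms n X :=
  fun _ hφ => differentiableOn_formCoeff_pullback (.of_mem_atlas hφ) hp hf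

/-- Holomorphy can be checked in any family of holomorphic charts covering the manifold. -/
theorem mem_holomorphicForms_of_cover [IsManifold 𝓘(ℂ, Fin n → ℂ) ω X] {f : TopForm n X}
    (h : ∀ x : X, ∃ ψ : OpenPartialHomeomorph X (Fin n → ℂ), IsHolChart ψ ∧ x ∈ ψ.source ∧
      DifferentiableAt ℂ (formCoeff ψ f) (ψ x)) : f ∈ holomorphicForms n X := by
  intro φ hφ z hz
  have hφh : IsHolChart φ := .of_mem_atlas hφ
  obtain ⟨ψ, hψ, hx, hd⟩ := h (φ.symm z)
  have hT := contDiffAt_transition hφh hψ (p := fun x => x) contMDiffAt_id hz hx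
  have hc : ContinuousAt φ.symm z := (hφh.contMDiffAt_symm hz).continuousAt
  have hev : formCoeff φ f =ᶠ[𝓝 z]
      fun w => (fderiv ℂ (fun w => ψ (φ.symm w)) w).det * formCoeff ψ f (ψ (φ.symm w)) := by
    filter_upwards [hc (ψ.open_source.mem_nhds hx), φ.open_target.mem_nhds hz] with w hw hwt
    exact formCoeff_eq hφh hψ hwt hw f
  have h := (differentiableAt_det hT).mul
    (DifferentiableAt.comp z hd (hT.differentiableAt (by simp)))
  exact (h.congr_of_eventuallyEq hev).differentiableWithinAt

variable {φ : OpenPartialHomeomorph X (Fin n → ℂ)} {ψ : OpenPartialHomeomorph Y (Fin n → ℂ)}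

/-- Serves the charts obtained by transporting `φ` along `p`: its translates by `Γ`, and the charts
it induces on a quotient. -/
theorem coordFrame_eq_mfderiv (hφ : IsHolChart φ) {p : X → Y}
    (hp : ContMDiff 𝓘(ℂ, Fin n → ℂ) 𝓘(ℂ, Fin n → ℂ) ω p)
    (h : ∀ w ∈ φ.target, ψ.symm w = p (φ.symm w)) {z : Fin n → ℂ} (hz : z ∈ φ.target) (i : Fin n) :
    (coordFrame ψ z i : Fin n → ℂ) =
      mfderiv 𝓘(ℂ, Fin n → ℂ) 𝓘(ℂ, Fin n → ℂ) p (φ.symm z) (coordFrame φ z i) := by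
  have h1 : HasMFDerivAt 𝓘(ℂ, Fin n → ℂ) 𝓘(ℂ, Fin n → ℂ) (fun w => p (φ.symm w)) z
      ((mfderiv 𝓘(ℂ, Fin n → ℂ) 𝓘(ℂ, Fin n → ℂ) p (φ.symm z)).comp
        (mfderiv 𝓘(ℂ, Fin n → ℂ) 𝓘(ℂ, Fin n → ℂ) φ.symm z)) :=
    ((hp _).mdifferentiableAt (by simp)).hasMFDerivAt.comp z
      ((hφ.contMDiffAt_symm hz).mdifferentiableAt (by simp)).hasMFDerivAt
  have h2 := (h1.congr_of_eventuallyEq (f₁ := ψ.symm)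
    (by filter_upwards [φ.open_target.mem_nhds hz] with w hw using h w hw)).mfderiv
  exact congrArg (fun L : (Fin n → ℂ) →L[ℂ] (Fin n → ℂ) => L (Pi.single i 1 : Fin n → ℂ)) h2

theorem formCoeff_eq_formCoeff_pullback (hφ : IsHolChart φ) {p : X → Y}
    (hp : ContMDiff 𝓘(ℂ, Fin n → ℂ) 𝓘(ℂ, Fin n → ℂ) ω p)
    (h : ∀ w ∈ φ.target, ψ.symm w = p (φ.symm w)) {z : Fin n → ℂ} (hz : z ∈ φ.target)
    (f : TopForm n Y) : formCoeff ψ f z = formCoeff φ (pullback p f) z :=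
  apply_congr_point (fun y (v : Fin n → Fin n → ℂ) => f y v) (h z hz)
    (funext fun i => coordFrame_eq_mfderiv hφ hp h hz i)

theorem isDensity_enorm_sq (f : TopForm n X) : IsDensity fun x v => ‖f x v‖ₑ ^ 2 := by
  intro x v
  have key : ∀ a b d : ℂ, a = d * b → ‖a‖ₑ ^ 2 = ‖d‖ₑ ^ 2 * ‖b‖ₑ ^ 2 := by
    rintro a b d rfl
    rw [enorm_mul, mul_pow]
  exact key _ _ _ (alternatingMap_eq_det_mul (f x) v)

theorem IsDensity.tsum {β : Type*} {η : β → FrameFun n X ℝ≥0∞} (h : ∀ b, IsDensity (η b)) :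
    IsDensity fun x v => ∑' b, η b x v := by
  intro x v
  rw [← ENNReal.tsum_mul_left]
  exact tsum_congr fun b => h b x v

/-- `c` stands for plus or minus the real or imaginary part, the four pieces from which
`integralForm` is built. -/
theorem isDensity_ofReal {c : ℂ → ℝ} (hc : ∀ (r : ℝ) z, 0 ≤ r → c (r * z) = r * c z)
    (f g : TopForm n X) : IsDensity fun x v => ENNReal.ofReal (c (f x v * conj (g x v))) := by
  intro x v
  have key : ∀ a b a' b' d : ℂ, a = d * b → a' = d * b' → ENNReal.ofReal (c (a * conj a')) =
      ‖d‖ₑ ^ 2 * ENNReal.ofReal (c (b * conj b')) := by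
    rintro a b a' b' d rfl rfl
    have h3 : d * b * conj (d * b') = ((‖d‖ ^ 2 : ℝ) : ℂ) * (b * conj b') := by
      rw [map_mul, mul_mul_mul_comm, Complex.mul_conj, Complex.normSq_eq_norm_sq]
    rw [h3, hc _ _ (by positivity), ENNReal.ofReal_mul (by positivity),
      ENNReal.ofReal_pow (norm_nonneg _), ofReal_norm]
  exact key _ _ _ _ _ (alternatingMap_eq_det_mul (f x) v) (alternatingMap_eq_det_mul (g x) v)

end Pullback

/-! ### The quotient projection, its local sections, and push-down. -/

section Proj

variable {n : ℕ} (Γ : Type*) [Group Γ] {X : Type*} [MulAction Γ X]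

theorem proj_smul (γ : Γ) (x : X) : proj Γ X (γ • x) = proj Γ X x :=
  Quotient.sound ⟨γ, rfl⟩

variable {Γ} in
theorem exists_smul_eq_of_proj_eq {x y : X} (h : proj Γ X x = proj Γ X y) : ∃ γ : Γ, γ • x = y :=
  Quotient.exact h.symm

variable [TopologicalSpace X] [T2Space X] [LocallyCompactSpace X] [ContinuousConstSMul Γ X]
  [ProperlyDiscontinuousSMul Γ X] [IsCancelSMul Γ X]

variable (X) in
theorem isLocalHomeomorph_proj : IsLocalHomeomorph (proj Γ X) :=
  (isQuotientCoveringMap_quotientMk_of_properlyDiscontinuousSMul (E := X)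
    (G := Γ)).isCoveringMap.isLocalHomeomorph

variable [ChartedSpace (Fin n → ℂ) X]

/-- The charts of the quotient. -/
theorem exists_chartAt_quotient_eq (q : MulAction.orbitRel.Quotient Γ X) :
    ∃ b : X, proj Γ X b = q ∧ chartAt (Fin n → ℂ) q =
      ((isLocalHomeomorph_proj Γ X).localInverseAt b).trans (chartAt (Fin n → ℂ) b) :=
  ⟨(Quotient.mk_surjective (s := MulAction.orbitRel Γ X)).hasRightInverse.choose q,
    (Quotient.mk_surjective (s := MulAction.orbitRel Γ X)).hasRightInverse.choose_spec q, rfl⟩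

theorem IsDensity.pushDown {η : FrameFun n X ℝ≥0∞} (hη : IsDensity η) :
    IsDensity (pushDown Γ η) := by
  intro y v
  set A : (Fin n → ℂ) →L[ℂ] (Fin n → ℂ) :=
    (mfderiv 𝓘(ℂ, Fin n → ℂ) 𝓘(ℂ, Fin n → ℂ) (proj Γ X) (Quotient.out y)).inverse
  have h1 := hη (Quotient.out y) fun i => A (v i)
  have h2 := hη (Quotient.out y) fun i => A (Pi.single i 1 : Fin n → ℂ)
  have e1 := det_of_map (A : (Fin n → ℂ) →ₗ[ℂ] (Fin n → ℂ)) v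
  have e2 := det_of_map (A : (Fin n → ℂ) →ₗ[ℂ] (Fin n → ℂ)) fun i => (Pi.single i 1 : Fin n → ℂ)
  rw [det_of_single, mul_one] at e2
  simp only [ContinuousLinearMap.coe_coe] at e1 e2
  refine h1.trans (Eq.trans ?_ (congrArg _ h2.symm))
  rw [e1, e2, enorm_mul, mul_pow, ← mul_assoc, mul_comm (‖(Matrix.of v).det‖ₑ ^ 2)]

variable [IsManifold 𝓘(ℂ, Fin n → ℂ) ω X]

/-- The quotient chart at `proj Γ X x` comes from the chart at some representative `γ • x`. Since
`proj` is invariant, it can be computed near `γ • x`, where it is the inverse quotient chart after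
the chart of `X`. -/
theorem contMDiff_proj
    (hΓ : ∀ γ : Γ, ContMDiff 𝓘(ℂ, Fin n → ℂ) 𝓘(ℂ, Fin n → ℂ) ω fun x : X => γ • x)
    : ContMDiff 𝓘(ℂ, Fin n → ℂ) 𝓘(ℂ, Fin n → ℂ) ω (proj Γ X) := by
  have := isManifold_quotient Γ hΓ
  intro x
  have hl := isLocalHomeomorph_proj Γ X
  obtain ⟨b, hb, hc⟩ := exists_chartAt_quotient_eq (n := n) Γ (proj Γ X x)
  obtain ⟨γ, rfl⟩ := exists_smul_eq_of_proj_eq hb.symm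
  have hcs : ∀ z, (chartAt (Fin n → ℂ) (proj Γ X x)).symm z =
      proj Γ X ((chartAt (Fin n → ℂ) (γ • x)).symm z) := by
    intro z
    rw [hc, OpenPartialHomeomorph.coe_trans_symm, hl.localInverseAt_symm]
    rfl
  have hcx : chartAt (Fin n → ℂ) (proj Γ X x) (proj Γ X x) = chartAt (Fin n → ℂ) (γ • x) (γ • x) := by
    rw [hc, OpenPartialHomeomorph.coe_trans, Function.comp_apply]
    congr 1
    rw [← hb]
    exact hl.localInverseAt_apply_self
  have h1 : ContMDiffAt 𝓘(ℂ, Fin n → ℂ) 𝓘(ℂ, Fin n → ℂ) ω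
      (chartAt (Fin n → ℂ) (proj Γ X x)).symm (chartAt (Fin n → ℂ) (γ • x) (γ • x)) := by
    rw [← hcx]
    exact (IsHolChart.of_mem_atlas (chart_mem_atlas _ _)).contMDiffAt_symm (mem_chart_target _ _)
  have h2 : ContMDiffAt 𝓘(ℂ, Fin n → ℂ) 𝓘(ℂ, Fin n → ℂ) ω (chartAt (Fin n → ℂ) (γ • x)) (γ • x) :=
    (IsHolChart.of_mem_atlas (chart_mem_atlas _ _)).contMDiffAt (mem_chart_source _ _)
  have h3 := h1.comp x (h2.comp x (hΓ γ x))
  refine h3.congr_of_eventuallyEq ?_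
  have hev : ∀ᶠ x' in 𝓝 x, γ • x' ∈ (chartAt (Fin n → ℂ) (γ • x)).source :=
    (hΓ γ).continuous.continuousAt ((chartAt (Fin n → ℂ) (γ • x)).open_source.mem_nhds
      (mem_chart_source _ _))
  filter_upwards [hev] with x' hx'
  simp only [Function.comp_apply, hcs]
  rw [(chartAt (Fin n → ℂ) (γ • x)).left_inv hx', proj_smul]

/-- Holomorphic local sections of the projection. -/
theorem exists_local_section
    (hΓ : ∀ γ : Γ, ContMDiff 𝓘(ℂ, Fin n → ℂ) 𝓘(ℂ, Fin n → ℂ) ω fun x : X => γ • x)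
    (x : X) : ∃ s : MulAction.orbitRel.Quotient Γ X → X,
    ContMDiffAt 𝓘(ℂ, Fin n → ℂ) 𝓘(ℂ, Fin n → ℂ) ω s (proj Γ X x) ∧ s (proj Γ X x) = x ∧
    (∀ᶠ y in 𝓝 (proj Γ X x), proj Γ X (s y) = y) ∧ ∀ᶠ x' in 𝓝 x, s (proj Γ X x') = x' := by
  have := isManifold_quotient Γ hΓ
  have hl := isLocalHomeomorph_proj Γ X
  obtain ⟨b, hb, hc⟩ := exists_chartAt_quotient_eq (n := n) Γ (proj Γ X x)
  obtain ⟨γ, rfl⟩ := exists_smul_eq_of_proj_eq hb.symm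
  set c := chartAt (Fin n → ℂ) (proj Γ X x) with hcdef
  set d := chartAt (Fin n → ℂ) (γ • x) with hd
  have hcs : ∀ z, c.symm z = proj Γ X (d.symm z) := by
    intro z
    rw [hc, OpenPartialHomeomorph.coe_trans_symm, hl.localInverseAt_symm]
    rfl
  have hct : ∀ y, c y = d (hl.localInverseAt (γ • x) y) := by
    intro y
    rw [hc]
    rfl
  have hcx : c (proj Γ X x) = d (γ • x) := by
    rw [hct, ← hb]
    exact congrArg d hl.localInverseAt_apply_self
  have h1 : ContMDiffAt 𝓘(ℂ, Fin n → ℂ) 𝓘(ℂ, Fin n → ℂ) ω c (proj Γ X x) :=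
    (IsHolChart.of_mem_atlas (chart_mem_atlas _ _)).contMDiffAt (mem_chart_source _ _)
  have h2 : ContMDiffAt 𝓘(ℂ, Fin n → ℂ) 𝓘(ℂ, Fin n → ℂ) ω d.symm (c (proj Γ X x)) := by
    rw [hcx]
    exact (IsHolChart.of_mem_atlas (chart_mem_atlas _ _)).contMDiffAt_symm (mem_chart_target _ _)
  refine ⟨fun y => γ⁻¹ • d.symm (c y), (hΓ γ⁻¹ _).comp _ (h2.comp _ h1), ?_, ?_, ?_⟩
  · simp only [hcx]
    rw [d.left_inv (mem_chart_source _ _), inv_smul_smul]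
  · filter_upwards [c.open_source.mem_nhds (mem_chart_source (Fin n → ℂ) (proj Γ X x))] with y hy
    rw [proj_smul, ← hcs, c.left_inv hy]
  · have e1 : ∀ᶠ x' in 𝓝 x, γ • x' ∈ d.source :=
      (hΓ γ).continuous.continuousAt (d.open_source.mem_nhds (mem_chart_source _ _))
    have e2 : ∀ᶠ x' in 𝓝 x, γ • x' ∈ (hl.localInverseAt (γ • x)).target :=
      (hΓ γ).continuous.continuousAt ((hl.localInverseAt (γ • x)).open_target.mem_nhds
        hl.self_mem_localInverseAt_target)
    filter_upwards [e1, e2] with x' h1 h2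
    have h4 := (hl.localInverseAt (γ • x)).right_inv h2
    rw [hl.localInverseAt_symm, proj_smul] at h4
    rw [hct, h4, d.left_inv h1, inv_smul_smul]

/-- The projection and a local section through `x` are inverse as germs, so their derivatives are
inverse to each other. -/
theorem mfderiv_proj_bijective
    (hΓ : ∀ γ : Γ, ContMDiff 𝓘(ℂ, Fin n → ℂ) 𝓘(ℂ, Fin n → ℂ) ω fun x : X => γ • x)
    (x : X) : ∃ L : (Fin n → ℂ) →L[ℂ] (Fin n → ℂ),
    (∀ v, L (mfderiv 𝓘(ℂ, Fin n → ℂ) 𝓘(ℂ, Fin n → ℂ) (proj Γ X) x v) = v) ∧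
    ∀ v, mfderiv 𝓘(ℂ, Fin n → ℂ) 𝓘(ℂ, Fin n → ℂ) (proj Γ X) x (L v) = v := by
  obtain ⟨s, hs, hsx, h1, h2⟩ := exists_local_section Γ hΓ x
  have hp := ((contMDiff_proj Γ hΓ x).mdifferentiableAt (by simp)).hasMFDerivAt
  have hsd := (hs.mdifferentiableAt (by simp)).hasMFDerivAt
  have hp' : HasMFDerivAt 𝓘(ℂ, Fin n → ℂ) 𝓘(ℂ, Fin n → ℂ) (proj Γ X) (s (proj Γ X x))
      (mfderiv 𝓘(ℂ, Fin n → ℂ) 𝓘(ℂ, Fin n → ℂ) (proj Γ X) x) := by rw [hsx]; exact hp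
  have e1 := (hsd.comp x hp).congr_of_eventuallyEq (f₁ := fun x' => x')
    (h2.mono fun x' h => h.symm)
  have e2 := (hp'.comp _ hsd).congr_of_eventuallyEq (f₁ := fun y => y) (h1.mono fun x' h => h.symm)
  have i1 := hasMFDerivAt_unique e1 (hasMFDerivAt_id x)
  have i2 := hasMFDerivAt_unique e2 (hasMFDerivAt_id _)
  exact ⟨mfderiv 𝓘(ℂ, Fin n → ℂ) 𝓘(ℂ, Fin n → ℂ) s (proj Γ X x),
    fun v => congrArg (fun L : (Fin n → ℂ) →L[ℂ] (Fin n → ℂ) => L v) i1,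
    fun v => congrArg (fun L : (Fin n → ℂ) →L[ℂ] (Fin n → ℂ) => L v) i2⟩

theorem inverse_mfderiv_proj
    (hΓ : ∀ γ : Γ, ContMDiff 𝓘(ℂ, Fin n → ℂ) 𝓘(ℂ, Fin n → ℂ) ω fun x : X => γ • x)
    (x : X) (v : Fin n → ℂ) :
    (mfderiv 𝓘(ℂ, Fin n → ℂ) 𝓘(ℂ, Fin n → ℂ) (proj Γ X) x).inverse
      (mfderiv 𝓘(ℂ, Fin n → ℂ) 𝓘(ℂ, Fin n → ℂ) (proj Γ X) x v) = v := by
  obtain ⟨L, h1, h2⟩ := mfderiv_proj_bijective Γ hΓ x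
  have : (mfderiv 𝓘(ℂ, Fin n → ℂ) 𝓘(ℂ, Fin n → ℂ) (proj Γ X) x).inverse = L :=
    ContinuousLinearMap.inverse_eq (ContinuousLinearMap.ext h2) (ContinuousLinearMap.ext h1)
  rw [this]
  exact h1 v

theorem pullback_proj_injective
    (hΓ : ∀ γ : Γ, ContMDiff 𝓘(ℂ, Fin n → ℂ) 𝓘(ℂ, Fin n → ℂ) ω fun x : X => γ • x) :
    Function.Injective (pullback (n := n) (proj Γ X)) := by
  rw [injective_iff_map_eq_zero]
  intro f hf
  funext y
  obtain ⟨x, rfl⟩ := Quotient.mk_surjective y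
  ext v
  obtain ⟨L, -, h2⟩ := mfderiv_proj_bijective Γ hΓ x
  have h3 : f (proj Γ X x) (fun i => mfderiv 𝓘(ℂ, Fin n → ℂ) 𝓘(ℂ, Fin n → ℂ) (proj Γ X) x (L (v i)))
      = 0 := congrArg (fun g : TopForm n X => g x fun i => L (v i)) hf
  refine Eq.trans ?_ h3
  exact apply_congr_point (fun y (v : Fin n → Fin n → ℂ) => f y v) rfl
    (funext fun i => (h2 (v i)).symm)

theorem pullback_smul_pullback_proj
    (hΓ : ∀ γ : Γ, ContMDiff 𝓘(ℂ, Fin n → ℂ) 𝓘(ℂ, Fin n → ℂ) ω fun x : X => γ • x)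
    (f : TopForm n (MulAction.orbitRel.Quotient Γ X)) (γ : Γ) :
    pullback (fun x : X => γ • x) (pullback (proj Γ X) f) = pullback (proj Γ X) f := by
  rw [pullback_pullback (contMDiff_proj Γ hΓ) (hΓ γ)]
  simp only [proj_smul]

/-- Invariance of `(n, n)`-forms. -/
def IsInvariant (η : FrameFun n X ℝ≥0∞) : Prop :=
  ∀ (γ : Γ) (x : X) (v : Fin n → TangentSpace 𝓘(ℂ, Fin n → ℂ) x),
    η (γ • x) (fun i => mfderiv 𝓘(ℂ, Fin n → ℂ) 𝓘(ℂ, Fin n → ℂ) (fun x : X => γ • x) x (v i)) = η x v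

/-- The chosen representative of the orbit is some `γ • x`. Invariance of `η` and the chain rule for
`proj = proj ∘ γ` remove the choice. -/
theorem pushDown_apply
    (hΓ : ∀ γ : Γ, ContMDiff 𝓘(ℂ, Fin n → ℂ) 𝓘(ℂ, Fin n → ℂ) ω fun x : X => γ • x)
    {η : FrameFun n X ℝ≥0∞} (hη : IsInvariant Γ η) (x : X)
    (v : Fin n → Fin n → ℂ) : pushDown Γ η (proj Γ X x)
      (fun i => mfderiv 𝓘(ℂ, Fin n → ℂ) 𝓘(ℂ, Fin n → ℂ) (proj Γ X) x (v i)) = η x v := by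
  obtain ⟨γ, hγ⟩ := exists_smul_eq_of_proj_eq (Γ := Γ) (x := x) (y := Quotient.out (proj Γ X x))
    (Quotient.out_eq (proj Γ X x)).symm
  have h1 := hη γ x v
  rw [← h1, pushDown]
  refine apply_congr_point (fun y (v : Fin n → Fin n → ℂ) => η y v) hγ.symm (funext fun i => ?_)
  have h2 : mfderiv 𝓘(ℂ, Fin n → ℂ) 𝓘(ℂ, Fin n → ℂ) (proj Γ X) x =
      (mfderiv 𝓘(ℂ, Fin n → ℂ) 𝓘(ℂ, Fin n → ℂ) (proj Γ X) (γ • x)).comp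
        (mfderiv 𝓘(ℂ, Fin n → ℂ) 𝓘(ℂ, Fin n → ℂ) (fun x : X => γ • x) x) := by
    have h3 := mfderiv_comp x ((contMDiff_proj Γ hΓ (γ • x)).mdifferentiableAt (by simp))
      ((hΓ γ x).mdifferentiableAt (by simp))
    rw [← h3]
    congr 1
    funext y
    exact (proj_smul Γ γ y).symm
  rw [h2, ← hγ]
  exact inverse_mfderiv_proj Γ hΓ (γ • x) _

/-- A chart of `X` on whose domain the projection is injective gives a chart of the quotient. -/
theorem exists_quotient_chart
    (hΓ : ∀ γ : Γ, ContMDiff 𝓘(ℂ, Fin n → ℂ) 𝓘(ℂ, Fin n → ℂ) ω fun x : X => γ • x)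
    [Nonempty X] {φ : OpenPartialHomeomorph X (Fin n → ℂ)}
    (hφ : IsHolChart φ) (hinj : InjOn (proj Γ X) φ.source) :
    ∃ e : OpenPartialHomeomorph (MulAction.orbitRel.Quotient Γ X) (Fin n → ℂ), IsHolChart e ∧
      e.target = φ.target ∧ e.source = proj Γ X '' φ.source ∧
      ∀ z, e.symm z = proj Γ X (φ.symm z) := by
  have hl := isLocalHomeomorph_proj Γ X
  let p : OpenPartialHomeomorph X (MulAction.orbitRel.Quotient Γ X) :=
    OpenPartialHomeomorph.ofContinuousOpen (hinj.toPartialEquiv _ _) hl.continuous.continuousOn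
      hl.isOpenMap φ.open_source
  have hps : p.source = φ.source := rfl
  have hpt : p.target = proj Γ X '' φ.source := rfl
  let e := (φ.symm.trans p).symm
  have hes : ∀ z, e.symm z = proj Γ X (φ.symm z) := fun z => rfl
  have het : e.target = φ.target := by
    simp only [e, OpenPartialHomeomorph.symm_target, OpenPartialHomeomorph.trans_source,
      OpenPartialHomeomorph.symm_source, hps]
    exact inter_eq_left.2 fun z hz => φ.map_target hz
  have hesrc : e.source = proj Γ X '' φ.source := by
    rw [← e.symm_image_target_eq_source, het, ← φ.symm_image_target_eq_source, image_image]
    exact image_congr fun z _ => hes z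
  refine ⟨e, ⟨?_, ?_⟩, het, hesrc, hes⟩
  · intro y hy
    rw [hesrc] at hy
    obtain ⟨x, hx, rfl⟩ := hy
    obtain ⟨s, hs, hsx, h1, -⟩ := exists_local_section Γ hΓ x
    refine ContMDiffAt.contMDiffWithinAt ?_
    have h2 : ContMDiffAt 𝓘(ℂ, Fin n → ℂ) 𝓘(ℂ, Fin n → ℂ) ω φ (s (proj Γ X x)) := by
      rw [hsx]; exact hφ.contMDiffAt hx
    refine (h2.comp _ hs).congr_of_eventuallyEq ?_
    have h3 : ∀ᶠ y in 𝓝 (proj Γ X x), s y ∈ φ.source :=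
      hs.continuousAt (φ.open_source.mem_nhds (by rwa [hsx]))
    filter_upwards [h1, h3] with y hy1 hy2
    have h4 : e.symm (φ (s y)) = y := by rw [hes, φ.left_inv hy2, hy1]
    have h5 : φ (s y) ∈ e.target := by rw [het]; exact φ.map_source hy2
    rw [Function.comp_apply, ← e.right_inv h5, h4]
  · rw [het]
    exact (contMDiff_proj Γ hΓ).comp_contMDiffOn hφ.contMDiffOn_symm

end Proj

/-! ### Translates of forms and charts by the group. -/

section SMulPullback

variable {n : ℕ} {Γ : Type*} [Group Γ] {X : Type*} [TopologicalSpace X] [MulAction Γ X]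
  [ChartedSpace (Fin n → ℂ) X]

theorem pullback_smul_pullback_smul
    (hΓ : ∀ γ : Γ, ContMDiff 𝓘(ℂ, Fin n → ℂ) 𝓘(ℂ, Fin n → ℂ) ω fun x : X => γ • x)
    (γ σ : Γ) (f : TopForm n X) :
    pullback (fun x : X => γ • x) (pullback (fun x : X => σ • x) f) =
      pullback (fun x : X => (σ * γ) • x) f := by
  rw [pullback_pullback (hΓ σ) (hΓ γ)]
  simp only [mul_smul]

end SMulPullback

section Translate

variable {n : ℕ} {Γ : Type*} [Group Γ] {X : Type*} [TopologicalSpace X] [MulAction Γ X]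
  [ContinuousConstSMul Γ X] 

/-- The chart `φ`, moved by `γ`. -/
def translateChart (γ : Γ) (φ : OpenPartialHomeomorph X (Fin n → ℂ)) :
    OpenPartialHomeomorph X (Fin n → ℂ) :=
  (Homeomorph.smul γ⁻¹).transOpenPartialHomeomorph φ

theorem mem_translateChart_source (γ : Γ) (φ : OpenPartialHomeomorph X (Fin n → ℂ)) (x : X) :
    x ∈ (translateChart γ φ).source ↔ γ⁻¹ • x ∈ φ.source := Iff.rfl

theorem translateChart_apply (γ : Γ) (φ : OpenPartialHomeomorph X (Fin n → ℂ)) (x : X) :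
    translateChart γ φ x = φ (γ⁻¹ • x) := rfl

theorem translateChart_symm_apply (γ : Γ) (φ : OpenPartialHomeomorph X (Fin n → ℂ))
    (z : Fin n → ℂ) : (translateChart γ φ).symm z = γ • φ.symm z := by
  change (Homeomorph.smul γ⁻¹).symm (φ.symm z) = _
  simp [Homeomorph.smul]

variable [ChartedSpace (Fin n → ℂ) X]

theorem IsHolChart.translateChart
    (hΓ : ∀ γ : Γ, ContMDiff 𝓘(ℂ, Fin n → ℂ) 𝓘(ℂ, Fin n → ℂ) ω fun x : X => γ • x)
    {φ : OpenPartialHomeomorph X (Fin n → ℂ)} (hφ : IsHolChart φ) (γ : Γ) :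
    IsHolChart (translateChart γ φ) where
  contMDiffOn := hφ.contMDiffOn.comp (hΓ γ⁻¹).contMDiffOn fun _ hx => hx
  contMDiffOn_symm := by
    refine ((hΓ γ).comp_contMDiffOn hφ.contMDiffOn_symm).congr fun z _ => ?_
    exact translateChart_symm_apply γ φ z

theorem formCoeff_translateChart
    (hΓ : ∀ γ : Γ, ContMDiff 𝓘(ℂ, Fin n → ℂ) 𝓘(ℂ, Fin n → ℂ) ω fun x : X => γ • x)
    {φ : OpenPartialHomeomorph X (Fin n → ℂ)} (hφ : IsHolChart φ) (γ : Γ) (f : TopForm n X)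
    {z : Fin n → ℂ} (hz : z ∈ φ.target) :
    formCoeff (BergmanTower.translateChart γ φ) f z =
      formCoeff φ (pullback (fun x : X => γ • x) f) z :=
  formCoeff_eq_formCoeff_pullback hφ (hΓ γ) (fun w _ => translateChart_symm_apply γ φ w) hz f

end Translate

/-! ### Adapted polydisc charts and the fundamental domain. -/

section Adapted

variable (n : ℕ) (Γ : Type*) [Group Γ] (X : Type*) [TopologicalSpace X] [MulAction Γ X]
  [ChartedSpace (Fin n → ℂ) X]

/-- A finite family of polydisc charts on `X`, none of which meets its translates, together with a
partition of `X / Γ` into Borel pieces lying in the images of the concentric polydiscs of half the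
radius. -/
structure AdaptedCharts where
  m : ℕ
  φ : Fin m → OpenPartialHomeomorph X (Fin n → ℂ)
  center : Fin m → Fin n → ℂ
  radius : Fin m → ℝ
  piece : Fin m → Set (MulAction.orbitRel.Quotient Γ X)
  isHolChart : ∀ i, IsHolChart (φ i)
  radius_pos : ∀ i, 0 < radius i
  target_eq : ∀ i, (φ i).target = ball (center i) (2 * radius i)
  eq_one_of_smul_mem : ∀ i (γ : Γ) x, x ∈ (φ i).source → γ • x ∈ (φ i).source → γ = 1
  measurableSet_piece : ∀ i, MeasurableSet[borel _] (piece i)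
  disjoint_piece : Pairwise (Function.onFun Disjoint piece)
  iUnion_piece : ⋃ i, piece i = univ
  piece_subset : ∀ i, ∀ y ∈ piece i, ∃ z ∈ ball (center i) (radius i), proj Γ X ((φ i).symm z) = y

/-- Every point has a neighbourhood disjoint from its nontrivial translates, and a polydisc fits
inside it. Compactness of the quotient leaves finitely many half-radius polydiscs, whose open images
are made disjoint by successive differences. -/
theorem AdaptedCharts.nonempty [T2Space X] [LocallyCompactSpace X] [ContinuousConstSMul Γ X]
    [ProperlyDiscontinuousSMul Γ X] [IsCancelSMul Γ X] [IsManifold 𝓘(ℂ, Fin n → ℂ) ω X]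
    [CompactSpace (MulAction.orbitRel.Quotient Γ X)] : Nonempty (AdaptedCharts n Γ X) := by
  borelize (MulAction.orbitRel.Quotient Γ X)
  have hq := isQuotientCoveringMap_quotientMk_of_properlyDiscontinuousSMul (E := X) (G := Γ)
  have hl := isLocalHomeomorph_proj Γ X
  have hloc : ∀ x : X, ∃ r : ℝ, 0 < r ∧ ball (chartAt (Fin n → ℂ) x x) (2 * r) ⊆
      (chartAt (Fin n → ℂ) x).target ∧ ∀ γ : Γ, ∀ z ∈ ball (chartAt (Fin n → ℂ) x x) (2 * r),
      γ • (chartAt (Fin n → ℂ) x).symm z ∈ (chartAt (Fin n → ℂ) x).symm ''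
        ball (chartAt (Fin n → ℂ) x x) (2 * r) → γ = 1 := by
    intro x
    obtain ⟨U, hU, hUγ⟩ := hq.disjoint x
    set c := chartAt (Fin n → ℂ) x
    have h1 : c.target ∩ c.symm ⁻¹' U ∈ 𝓝 (c x) := by
      refine inter_mem (c.open_target.mem_nhds (mem_chart_target _ _)) ?_
      have hc : ContinuousAt c.symm (c x) := c.continuousAt_symm (mem_chart_target _ _)
      refine hc ?_
      rwa [c.left_inv (mem_chart_source _ _)]
    obtain ⟨ε, hε, hball⟩ := Metric.mem_nhds_iff.1 h1
    refine ⟨ε / 2, by positivity, ?_, ?_⟩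
    · rw [mul_div_cancel₀ _ two_ne_zero]
      exact hball.trans inter_subset_left
    · rw [mul_div_cancel₀ _ two_ne_zero]
      rintro γ z hz ⟨w, hw, hzw⟩
      exact hUγ γ ⟨c.symm w, ⟨c.symm z, (hball hz).2, hzw.symm⟩, (hball hw).2⟩
  choose r hr hball hdisj using hloc
  let ch : (x : X) → OpenPartialHomeomorph X (Fin n → ℂ) := fun x =>
    ((chartAt (Fin n → ℂ) x).symm.restrOpen (ball (chartAt (Fin n → ℂ) x x) (2 * r x))
      isOpen_ball).symm
  have htar : ∀ x, (ch x).target = ball (chartAt (Fin n → ℂ) x x) (2 * r x) := fun x =>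
    inter_eq_right.2 (hball x)
  have hsymm : ∀ x z, (ch x).symm z = (chartAt (Fin n → ℂ) x).symm z := fun x z => rfl
  have hsrc : ∀ x, (ch x).source =
      (chartAt (Fin n → ℂ) x).symm '' ball (chartAt (Fin n → ℂ) x x) (2 * r x) := by
    intro x
    rw [← (ch x).symm_image_target_eq_source, htar]
    rfl
  have hsub : ∀ x, (ch x).source ⊆ (chartAt (Fin n → ℂ) x).source := by
    intro x
    rw [hsrc]
    rintro _ ⟨z, hz, rfl⟩
    exact (chartAt (Fin n → ℂ) x).map_target (hball x hz)
  have hhol : ∀ x, IsHolChart (ch x) := fun x =>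
    ⟨(IsHolChart.of_mem_atlas (chart_mem_atlas _ x)).contMDiffOn.mono (hsub x),
      (IsHolChart.of_mem_atlas (chart_mem_atlas _ x)).contMDiffOn_symm.mono
        (by rw [htar]; exact hball x)⟩
  let W : X → Set (MulAction.orbitRel.Quotient Γ X) := fun x =>
    proj Γ X '' ((ch x).symm '' ball (chartAt (Fin n → ℂ) x x) (r x))
  have hW : ∀ x, IsOpen (W x) := by
    intro x
    refine hl.isOpenMap _ ((ch x).symm.isOpen_image_of_subset_source isOpen_ball ?_)
    rw [OpenPartialHomeomorph.symm_source, htar]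
    exact ball_subset_ball (by linarith [hr x])
  obtain ⟨t, ht⟩ := isCompact_univ.elim_finite_subcover W hW (by
    intro y _
    obtain ⟨x, rfl⟩ := Quotient.mk_surjective y
    refine mem_iUnion.2 ⟨x, x, ⟨chartAt (Fin n → ℂ) x x, mem_ball_self (hr x), ?_⟩, rfl⟩
    rw [hsymm, (chartAt (Fin n → ℂ) x).left_inv (mem_chart_source _ _)])
  let u : Fin t.card → X := fun i => (t.equivFin.symm i : X)
  refine ⟨⟨t.card, fun i => ch (u i), fun i => chartAt (Fin n → ℂ) (u i) (u i), fun i => r (u i),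
    disjointed fun i => W (u i), fun i => hhol _, fun i => hr _, fun i => htar _, ?_,
    fun i => disjointedRec (fun _ _ ht => ht.diff (hW _).measurableSet) (hW _).measurableSet,
    disjoint_disjointed _, ?_, ?_⟩⟩
  · intro i γ x hx hγ
    rw [hsrc] at hx hγ
    obtain ⟨z, hz, rfl⟩ := hx
    exact hdisj _ γ z hz hγ
  · rw [iUnion_disjointed]
    refine eq_univ_of_forall fun y => ?_
    obtain ⟨x, hx, hy⟩ := mem_iUnion₂.1 (ht (mem_univ y))
    refine mem_iUnion.2 ⟨t.equivFin ⟨x, hx⟩, ?_⟩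
    simpa [u] using hy
  · intro i y hy
    obtain ⟨_, ⟨z, hz, rfl⟩, rfl⟩ := disjointed_subset _ _ hy
    exact ⟨z, hz, rfl⟩

end Adapted

namespace AdaptedCharts

variable {n : ℕ} {Γ : Type*} [Group Γ] {X : Type*} [TopologicalSpace X] [MulAction Γ X]
  [ChartedSpace (Fin n → ℂ) X] (C : AdaptedCharts n Γ X)

/-- The part of the polydisc `i` that lies over `piece i`. Together the cells form a fundamental
domain of `Γ`. -/
def cell (i : Fin C.m) : Set (Fin n → ℂ) :=
  coordSet (C.φ i) (proj Γ X ⁻¹' C.piece i)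

/-- The square of the `L²` norm of a form over the fundamental domain made of the cells. -/
def energy (f : TopForm n X) : ℝ≥0∞ :=
  ∑ i, ∫⁻ z in C.cell i, ‖formCoeff (C.φ i) f z‖ₑ ^ 2

theorem ball_subset_target (i : Fin C.m) :
    ball (C.center i) (C.radius i) ⊆ (C.φ i).target := by
  rw [C.target_eq]
  exact ball_subset_ball (by linarith [C.radius_pos i])

theorem eq_of_proj_eq {i : Fin C.m} {x y : X} (hx : x ∈ (C.φ i).source) (hy : y ∈ (C.φ i).source)
    (h : proj Γ X x = proj Γ X y) : x = y := by
  obtain ⟨γ, rfl⟩ := exists_smul_eq_of_proj_eq h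
  rw [C.eq_one_of_smul_mem i γ x hx hy, one_smul]

/-- A cell is cut out of the large polydisc, but its image has a preimage in the small one, and
`proj` is injective on the chart domain. -/
theorem cell_subset_ball (i : Fin C.m) : C.cell i ⊆ ball (C.center i) (C.radius i) := by
  rintro z ⟨hz, hzp⟩
  obtain ⟨w, hw, hwz⟩ := C.piece_subset i _ hzp
  have hw' := C.ball_subset_target i hw
  have h := C.eq_of_proj_eq ((C.φ i).map_target hw') ((C.φ i).map_target hz) hwz
  rwa [← (C.φ i).symm.injOn hw' hz h]

theorem exists_mem_cell (x : X) : ∃ (γ : Γ) (i : Fin C.m), ∃ z ∈ C.cell i, γ • (C.φ i).symm z = x := by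
  obtain ⟨i, hi⟩ := mem_iUnion.1 (C.iUnion_piece ▸ mem_univ (proj Γ X x))
  obtain ⟨z, hz, hzx⟩ := C.piece_subset i _ hi
  obtain ⟨γ, hγ⟩ := exists_smul_eq_of_proj_eq hzx
  exact ⟨γ, i, z, ⟨C.ball_subset_target i hz, by simpa [hzx] using hi⟩, hγ⟩

theorem volume_cell_lt_top (i : Fin C.m) : volume (C.cell i) < ⊤ :=
  (measure_mono (C.cell_subset_ball i)).trans_lt measure_ball_lt_top

/-- The orbit of one point meets each compact set for only finitely many group elements, and `X` is
σ-compact. Without charts the product is empty and nothing is claimed about `Γ`. -/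
theorem countable_index [LocallyCompactSpace X] [SecondCountableTopology X]
    [ProperlyDiscontinuousSMul Γ X] : Countable (Γ × Fin C.m) := by
  rcases isEmpty_or_nonempty (Fin C.m) with h | ⟨⟨i⟩⟩
  · infer_instance
  have : Countable Γ := by
    set x : X := (C.φ i).symm (C.center i)
    have hfin : ∀ k, {γ : Γ | ((γ • ·) '' {x} ∩ compactCovering X k).Nonempty}.Finite := fun k =>
      ProperlyDiscontinuousSMul.finite_disjoint_inter_image isCompact_singleton
        (isCompact_compactCovering X k)
    have huniv : (univ : Set Γ) ⊆
        ⋃ k, {γ : Γ | ((γ • ·) '' {x} ∩ compactCovering X k).Nonempty} := by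
      intro γ _
      obtain ⟨k, hk⟩ := mem_iUnion.1 (iUnion_compactCovering X ▸ mem_univ (γ • x))
      exact mem_iUnion.2 ⟨k, γ • x, ⟨x, rfl, rfl⟩, hk⟩
    exact countable_univ_iff.1 ((countable_iUnion fun k => (hfin k).countable).mono huniv)
  infer_instance

theorem measurableSet_cell (i : Fin C.m) : MeasurableSet (C.cell i) := by
  borelize X (MulAction.orbitRel.Quotient Γ X)
  have hc : Continuous (proj Γ X) := continuous_quotient_mk'
  exact measurableSet_coordSet _ (hc.measurable (C.measurableSet_piece _))

variable [ContinuousConstSMul Γ X]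

/-- The translates of the adapted charts. -/
def chart (a : Γ × Fin C.m) : OpenPartialHomeomorph X (Fin n → ℂ) := translateChart a.1 (C.φ a.2)

/-- The translates of the cells, in `X`. -/
def part (a : Γ × Fin C.m) : Set X := (C.chart a).source ∩ proj Γ X ⁻¹' C.piece a.2

theorem coordSet_part_inter (a : Γ × Fin C.m) (P : Set X) :
    coordSet (C.chart a) (C.part a ∩ P) = C.cell a.2 ∩ {z | a.1 • (C.φ a.2).symm z ∈ P} := by
  ext z
  simp only [coordSet, cell, part, mem_inter_iff, mem_preimage, mem_ofPred_eq,
    chart, translateChart_symm_apply, proj_smul, mem_translateChart_source,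
    inv_smul_smul]
  constructor
  · rintro ⟨h1, ⟨-, h2⟩, h3⟩
    exact ⟨⟨h1, h2⟩, h3⟩
  · rintro ⟨⟨h1, h2⟩, h3⟩
    exact ⟨h1, ⟨(C.φ a.2).map_target h1, h2⟩, h3⟩

theorem coordSet_part (a : Γ × Fin C.m) : coordSet (C.chart a) (C.part a) = C.cell a.2 := by
  have := C.coordSet_part_inter a univ
  simpa using this

theorem isChartPartition
    (hΓ : ∀ γ : Γ, ContMDiff 𝓘(ℂ, Fin n → ℂ) 𝓘(ℂ, Fin n → ℂ) ω fun x : X => γ • x) :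
    IsChartPartition C.chart C.part where
  isHolChart a := (C.isHolChart a.2).translateChart hΓ a.1
  measurableSet a := by
    borelize X (MulAction.orbitRel.Quotient Γ X)
    have hc : Continuous (proj Γ X) := continuous_quotient_mk'
    exact (C.chart a).open_source.measurableSet.inter (hc.measurable (C.measurableSet_piece _))
  subset_source a := inter_subset_left
  disjoint := by
    rintro ⟨γ, i⟩ ⟨σ, k⟩ hab
    refine disjoint_left.2 ?_
    rintro x ⟨hx1, hx2⟩ ⟨hy1, hy2⟩
    refine hab ?_
    have hik : i = k := by
      by_contra h
      exact disjoint_left.1 (C.disjoint_piece h) hx2 hy2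
    subst hik
    have h1 := C.eq_one_of_smul_mem i (σ⁻¹ * γ) (γ⁻¹ • x) hx1
      (by simpa [mul_smul] using (mem_translateChart_source σ (C.φ i) x).1 hy1)
    rw [inv_mul_eq_one.1 h1]
  iUnion := by
    refine eq_univ_of_forall fun x => ?_
    obtain ⟨γ, i, z, hz, rfl⟩ := C.exists_mem_cell x
    refine mem_iUnion.2 ⟨(γ, i), ?_, ?_⟩
    · rw [chart, mem_translateChart_source, inv_smul_smul]
      exact (C.φ i).map_target hz.1
    · rw [mem_preimage, proj_smul]
      exact hz.2

variable [LocallyCompactSpace X] [SecondCountableTopology X] [ProperlyDiscontinuousSMul Γ X]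

/-- The polydisc is cut along the translates of the cells, and each part is moved back to the
fundamental domain, which pulls `f` back by `γ`. -/
theorem lintegral_target_eq
    (hΓ : ∀ γ : Γ, ContMDiff 𝓘(ℂ, Fin n → ℂ) 𝓘(ℂ, Fin n → ℂ) ω fun x : X => γ • x)
    (i : Fin C.m) (f : TopForm n X) :
    ∫⁻ z in (C.φ i).target, ‖formCoeff (C.φ i) f z‖ₑ ^ 2 =
      ∑' γ : Γ, ∑ k, ∫⁻ z in C.cell k ∩ {z | γ • (C.φ k).symm z ∈ (C.φ i).source},
        ‖formCoeff (C.φ k) (pullback (fun x : X => γ • x) f) z‖ₑ ^ 2 := by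
  borelize X
  have := C.countable_index
  have h := (C.isChartPartition hΓ).chartMeasure_eq_tsum (C.isHolChart i) (isDensity_enorm_sq f)
    (MeasurableSet.univ)
  rw [chartMeasure_apply _ _ MeasurableSet.univ] at h
  have h1 : coordSet (C.φ i) univ = (C.φ i).target := by simp [coordSet]
  rw [h1] at h
  refine Eq.trans h ?_
  rw [ENNReal.tsum_prod']
  refine tsum_congr fun γ => ?_
  rw [tsum_fintype]
  refine Finset.sum_congr rfl fun k _ => ?_
  have hm : MeasurableSet (C.part (γ, k) ∩ (univ ∩ (C.φ i).source)) :=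
    ((C.isChartPartition hΓ).measurableSet _).inter
      (MeasurableSet.univ.inter (C.φ i).open_source.measurableSet)
  rw [chartMeasure_apply _ _ hm, coordSet_part_inter, univ_inter]
  have hm2 := measurableSet_coordSet (C.chart (γ, k)) hm
  rw [coordSet_part_inter, univ_inter] at hm2
  refine setLIntegral_congr_fun hm2 fun z hz => ?_
  have hz' : z ∈ (C.φ k).target := hz.1.1
  rw [← formCoeff_translateChart hΓ (C.isHolChart k) γ f hz']
  rfl

variable [IsManifold 𝓘(ℂ, Fin n → ℂ) ω X]

theorem lintegralForm_eq
    (hΓ : ∀ γ : Γ, ContMDiff 𝓘(ℂ, Fin n → ℂ) 𝓘(ℂ, Fin n → ℂ) ω fun x : X => γ • x)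
    {η : FrameFun n X ℝ≥0∞} (hη : IsDensity η) :
    lintegralForm η = ∑' a, ∫⁻ z in C.cell a.2, frameCoeff (C.chart a) η z := by
  have := C.countable_index
  rw [(C.isChartPartition hΓ).lintegralForm_eq hη]
  simp only [coordSet_part]

theorem normSq_eq
    (hΓ : ∀ γ : Γ, ContMDiff 𝓘(ℂ, Fin n → ℂ) 𝓘(ℂ, Fin n → ℂ) ω fun x : X => γ • x)
    (f : TopForm n X) :
    normSq f = ∑' γ : Γ, C.energy (pullback (fun x : X => γ • x) f) := by
  rw [normSq, C.lintegralForm_eq hΓ (isDensity_enorm_sq f), ENNReal.tsum_prod']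
  refine tsum_congr fun γ => ?_
  rw [tsum_fintype]
  refine Finset.sum_congr rfl fun k _ => ?_
  refine setLIntegral_congr_fun (C.measurableSet_cell k) fun z hz => ?_
  rw [← formCoeff_translateChart hΓ (C.isHolChart k) γ f hz.1]
  rfl

/-- The charts `φ i` descend to the quotient because `proj` is injective on their domains. There the
pieces form a chart partition whose coordinate sets are exactly the cells. -/
theorem lintegralForm_pushDown [T2Space X] [IsCancelSMul Γ X]
    (hΓ : ∀ γ : Γ, ContMDiff 𝓘(ℂ, Fin n → ℂ) 𝓘(ℂ, Fin n → ℂ) ω fun x : X => γ • x)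
    {η : FrameFun n X ℝ≥0∞} (hη : IsDensity η) (hinv : IsInvariant Γ η) :
    lintegralForm (pushDown Γ η) = ∑ i, ∫⁻ z in C.cell i, frameCoeff (C.φ i) η z := by
  have := isManifold_quotient Γ hΓ
  have : SecondCountableTopology (MulAction.orbitRel.Quotient Γ X) :=
    ContinuousConstSMul.secondCountableTopology
  have hex := fun i => by
    have : Nonempty X := ⟨(C.φ i).symm (C.center i)⟩
    exact exists_quotient_chart Γ hΓ (C.isHolChart i) fun x hx y hy h => C.eq_of_proj_eq hx hy h
  choose e he het hes hesymm using hex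
  have hpart : IsChartPartition e C.piece :=
    { isHolChart := he
      measurableSet := C.measurableSet_piece
      subset_source := by
        intro i y hy
        obtain ⟨z, hz, rfl⟩ := C.piece_subset i y hy
        rw [hes]
        exact ⟨_, (C.φ i).map_target (C.ball_subset_target i hz), rfl⟩
      disjoint := C.disjoint_piece
      iUnion := C.iUnion_piece }
  rw [hpart.lintegralForm_eq (hη.pushDown Γ), tsum_fintype]
  refine Finset.sum_congr rfl fun i _ => ?_
  have hcell : coordSet (e i) (C.piece i) = C.cell i := by
    ext z
    simp only [coordSet, cell, het, mem_inter_iff, mem_preimage, hesymm]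
  rw [hcell]
  refine setLIntegral_congr_fun (C.measurableSet_cell i) fun z hz => ?_
  refine Eq.trans ?_ (pushDown_apply Γ hΓ hinv _ _)
  exact apply_congr_point (fun y (v : Fin n → Fin n → ℂ) => pushDown Γ η y v) (hesymm i z)
    (funext fun j => coordFrame_eq_mfderiv (C.isHolChart i) (contMDiff_proj Γ hΓ)
      (fun w _ => hesymm i w) hz.1 j)

end AdaptedCharts

/-! ### The extremal property of orthonormal families. -/

section Hilbert

variable {V H : Type*} [AddCommGroup V] [Module ℂ V] [NormedAddCommGroup H] [InnerProductSpace ℂ H]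

theorem norm_sq_sum_smul_of_orthonormal {ι : Type*} [Fintype ι] {e : ι → H} (he : Orthonormal ℂ e)
    (c : ι → ℂ) : ‖∑ i, c i • e i‖ ^ 2 = ∑ i, ‖c i‖ ^ 2 := by
  have h := he.inner_sum c c Finset.univ
  rw [inner_self_eq_norm_sq_to_K] at h
  have h2 : ∀ i, conj (c i) * c i = ((‖c i‖ ^ 2 : ℝ) : ℂ) := fun i => by
    rw [mul_comm, Complex.mul_conj, Complex.normSq_eq_norm_sq]
  simp only [h2] at h
  rw [← Complex.ofReal_inj, Complex.ofReal_sum, ← h, Complex.ofReal_pow]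
  rfl

/-- The extremal property of evaluation kernels: if a functional is bounded on the unit ball then the
sum of its squared values on an orthonormal family satisfies the same bound. -/
theorem sum_enorm_sq_le_of_orthonormal (Φ : V →ₗ[ℂ] H) {ι : Type*} [Fintype ι] {v : ι → V}
    (hv : Orthonormal ℂ fun i => Φ (v i)) (ev : V →ₗ[ℂ] ℂ) {k : ℝ≥0∞}
    (hk : ∀ u, ‖Φ u‖ ≤ 1 → ‖ev u‖ₑ ^ 2 ≤ k) : ∑ i, ‖ev (v i)‖ₑ ^ 2 ≤ k := by
  set s : ℝ := ∑ i, ‖ev (v i)‖ ^ 2 with hs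
  have hs0 : 0 ≤ s := Finset.sum_nonneg fun i _ => by positivity
  have hsum : ∑ i, ‖ev (v i)‖ₑ ^ 2 = ENNReal.ofReal s := by
    rw [hs, ENNReal.ofReal_sum_of_nonneg fun i _ => by positivity]
    refine Finset.sum_congr rfl fun i _ => ?_
    rw [ENNReal.ofReal_pow (norm_nonneg _), ofReal_norm]
  rw [hsum]
  rcases hs0.eq_or_lt with h0 | hpos
  · simp [← h0]
  -- The vector representing `ev` on the span of the family, normalised: its image has norm 1 and
  -- `ev` takes the value `√s` there.
  set c : ι → ℂ := fun i => conj (ev (v i)) / (Real.sqrt s : ℂ) with hc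
  have hsq : Real.sqrt s * Real.sqrt s = s := Real.mul_self_sqrt hs0
  have hsqpos : 0 < Real.sqrt s := Real.sqrt_pos.2 hpos
  have hΦ : ‖Φ (∑ i, c i • v i)‖ ^ 2 = 1 := by
    simp only [map_sum, map_smul]
    rw [norm_sq_sum_smul_of_orthonormal hv]
    simp only [hc, norm_div, RCLike.norm_conj, Complex.norm_real, Real.norm_eq_abs,
      abs_of_pos hsqpos, div_pow]
    rw [← Finset.sum_div, ← hs, sq, hsq, div_self hpos.ne']
  have hev : ev (∑ i, c i • v i) = (Real.sqrt s : ℂ) := by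
    simp only [map_sum, map_smul, hc, smul_eq_mul]
    have h1 : ∀ i, conj (ev (v i)) / (Real.sqrt s : ℂ) * ev (v i) =
        ((‖ev (v i)‖ ^ 2 : ℝ) : ℂ) / (Real.sqrt s : ℂ) := fun i => by
      rw [div_mul_eq_mul_div, mul_comm, Complex.mul_conj, Complex.normSq_eq_norm_sq]
    simp only [h1]
    rw [← Finset.sum_div, ← Complex.ofReal_sum, ← hs, ← Complex.ofReal_div]
    congr 1
    rw [div_eq_iff hsqpos.ne', hsq]
  have h := hk (∑ i, c i • v i) (by
    rw [← sq_le_one_iff₀ (norm_nonneg _)]; exact hΦ.le)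
  rw [hev] at h
  refine le_of_eq_of_le ?_ h
  rw [← ofReal_norm, Complex.norm_real, Real.norm_eq_abs, abs_of_pos hsqpos,
    ← ENNReal.ofReal_pow hsqpos.le, sq, hsq]

end Hilbert

/-! ### `L²` classes and the dimension bound. -/

section SquareIntegrable

variable {Ω : Type*} [MeasurableSpace Ω] {μ : Measure Ω}

theorem eLpNorm_two_sq (g : Ω → ℂ) : eLpNorm g 2 μ ^ 2 = ∫⁻ x, ‖g x‖ₑ ^ 2 ∂μ := by
  have h := eLpNorm_nnreal_pow_eq_lintegral (μ := μ) (f := g) (p := 2) two_ne_zero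
  simp only [NNReal.coe_ofNat, ENNReal.rpow_ofNat] at h
  exact_mod_cast h

theorem memLp_two_of_lintegral_lt_top {g : Ω → ℂ} (hg : Measurable g)
    (h : ∫⁻ x, ‖g x‖ₑ ^ 2 ∂μ < ⊤) : MemLp g 2 μ := by
  refine ⟨hg.aestronglyMeasurable, ?_⟩
  rw [← eLpNorm_two_sq] at h
  by_contra hc
  rw [not_lt_top_iff.1 hc] at h
  simp at h

theorem enorm_toLp_sq {g : Ω → ℂ} (hg : MemLp g 2 μ) :
    ‖hg.toLp g‖ₑ ^ 2 = ∫⁻ x, ‖g x‖ₑ ^ 2 ∂μ := by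
  rw [Lp.enorm_toLp, eLpNorm_two_sq]

theorem norm_toLp_le_one_iff {g : Ω → ℂ} (hg : MemLp g 2 μ) :
    ‖hg.toLp g‖ ≤ 1 ↔ ∫⁻ x, ‖g x‖ₑ ^ 2 ∂μ ≤ 1 := by
  rw [← enorm_toLp_sq hg, ← ENNReal.ofReal_le_one, ofReal_norm]
  constructor
  · intro h; exact pow_le_one' h 2
  · intro h
    by_contra hc
    exact absurd h (not_le.2 (one_lt_pow₀ (not_le.1 hc) two_ne_zero))

/-- The class in `L²` of a family of square integrable functions depending linearly on a parameter. -/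
def toLpMap {V : Type*} [AddCommGroup V] [Module ℂ V] (T : V →ₗ[ℂ] (Ω → ℂ))
    (hT : ∀ v, MemLp (T v) 2 μ) : V →ₗ[ℂ] Lp ℂ 2 μ where
  toFun v := (hT v).toLp (T v)
  map_add' v w := by
    rw [← MemLp.toLp_add]
    congr 1
    exact map_add T v w
  map_smul' c v := by
    rw [RingHom.id_apply, ← MemLp.toLp_const_smul]
    congr 1
    exact map_smul T c v

/-- A finite dimensional space of square integrable functions has dimension at most the integral of
any bound for the extremal function of its unit ball. -/
theorem finrank_le_lintegral {V : Type*} [AddCommGroup V] [Module ℂ V] [FiniteDimensional ℂ V]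
    (T : V →ₗ[ℂ] (Ω → ℂ)) (hT : ∀ v, MemLp (T v) 2 μ)
    (hinj : ∀ v, ∫⁻ x, ‖T v x‖ₑ ^ 2 ∂μ = 0 → v = 0) {k : Ω → ℝ≥0∞}
    (hk : ∀ v, ∫⁻ x, ‖T v x‖ₑ ^ 2 ∂μ ≤ 1 → ∀ x, ‖T v x‖ₑ ^ 2 ≤ k x) :
    (Module.finrank ℂ V : ℝ≥0∞) ≤ ∫⁻ x, k x ∂μ := by
  set Φ := toLpMap T hT with hΦ
  have hΦinj : Function.Injective Φ := by
    rw [injective_iff_map_eq_zero]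
    intro v hv
    refine hinj v ?_
    rw [← enorm_toLp_sq (hT v)]
    have : (hT v).toLp (T v) = 0 := hv
    simp [this]
  have hfr := LinearMap.finrank_range_of_inj hΦinj
  -- `V` carries no inner product, so an orthonormal basis of its image in `L²` is lifted to `V`.
  let b := stdOrthonormalBasis ℂ (LinearMap.range Φ)
  have hb : ∀ i, ∃ v, Φ v = (b i : Lp ℂ 2 μ) := fun i => (b i).2
  choose v hv using hb
  have hon : Orthonormal ℂ fun i => Φ (v i) := by
    simp only [hv]
    exact b.orthonormal.comp_linearIsometry (LinearMap.range Φ).subtypeₗᵢ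
  have hsum : ∀ x, ∑ i, ‖T (v i) x‖ₑ ^ 2 ≤ k x := fun x =>
    sum_enorm_sq_le_of_orthonormal Φ hon ((LinearMap.proj x).comp T) fun u hu =>
      hk u ((norm_toLp_le_one_iff (hT u)).1 hu) x
  have hone : ∀ i, ∫⁻ x, ‖T (v i) x‖ₑ ^ 2 ∂μ = 1 := by
    intro i
    rw [← enorm_toLp_sq (hT (v i))]
    have h1 : ‖(hT (v i)).toLp (T (v i))‖ = 1 := hon.1 i
    rw [← ofReal_norm, h1]
    simp
  calc (Module.finrank ℂ V : ℝ≥0∞)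
      = ∑ i : Fin (Module.finrank ℂ (LinearMap.range Φ)), ∫⁻ x, ‖T (v i) x‖ₑ ^ 2 ∂μ := by
        simp only [hone, Finset.sum_const, Finset.card_univ, Fintype.card_fin, hfr, nsmul_eq_mul,
          mul_one]
    _ = ∫⁻ x, ∑ i, ‖T (v i) x‖ₑ ^ 2 ∂μ := by
        rw [lintegral_finsetSum' _ fun i _ => (hT (v i)).1.enorm.pow_const 2]
    _ ≤ ∫⁻ x, k x ∂μ := lintegral_mono hsum

/-- The dimension bound of `finrank_le_lintegral` also proves finite dimensionality. -/
theorem finiteDimensional_and_finrank_le_lintegral {V : Type*} [AddCommGroup V] [Module ℂ V]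
    (T : V →ₗ[ℂ] (Ω → ℂ)) (hT : ∀ v, MemLp (T v) 2 μ)
    (hinj : ∀ v, ∫⁻ x, ‖T v x‖ₑ ^ 2 ∂μ = 0 → v = 0) {k : Ω → ℝ≥0∞}
    (hk : ∀ v, ∫⁻ x, ‖T v x‖ₑ ^ 2 ∂μ ≤ 1 → ∀ x, ‖T v x‖ₑ ^ 2 ≤ k x)
    (hfin : ∫⁻ x, k x ∂μ < ⊤) :
    FiniteDimensional ℂ V ∧ (Module.finrank ℂ V : ℝ≥0∞) ≤ ∫⁻ x, k x ∂μ := by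
  have hfd : FiniteDimensional ℂ V := by
    obtain ⟨N, hN⟩ := ENNReal.exists_nat_gt hfin.ne
    have hrank : Module.rank ℂ V ≤ N := by
      -- Finite dimension is not yet known, so the bound is applied to the span of each finite
      -- independent set.
      refine rank_le fun s hs => ?_
      have hcard := finrank_span_finset_eq_card hs
      have h := finrank_le_lintegral (T.comp (Submodule.span ℂ (s : Set V)).subtype)
        (fun v => hT v) (fun v hv => Subtype.ext (hinj v hv)) (fun v hv => hk v hv)
      rw [hcard] at h
      exact_mod_cast (h.trans_lt hN).le
    exact Module.rank_lt_aleph0_iff.1 (hrank.trans_lt (Cardinal.natCast_lt_aleph0))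
  exact ⟨hfd, finrank_le_lintegral T hT hinj hk⟩

end SquareIntegrable

/-- An uncountable supremum of such indicators is still lower semicontinuous, hence Borel. This is
why extremal functions are cut off along open polydiscs and not along cells. -/
theorem lowerSemicontinuous_indicator_of_continuousOn {α : Type*} [TopologicalSpace α] {U : Set α}
    (hU : IsOpen U) {g : α → ℝ≥0∞} (hg : ContinuousOn g U) :
    LowerSemicontinuous (U.indicator g) := by
  rw [lowerSemicontinuous_iff_isOpen_preimage]
  intro y
  have : U.indicator g ⁻¹' Ioi y = U ∩ g ⁻¹' Ioi y := by
    ext x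
    by_cases hx : x ∈ U <;> simp [hx]
  rw [this]
  exact hg.isOpen_inter_preimage hU isOpen_Ioi

/-! ### Coefficients and extremal functions on the cells. -/

namespace AdaptedCharts

variable {n : ℕ} {Γ : Type*} [Group Γ] {X : Type*} [TopologicalSpace X] [MulAction Γ X]
  [ChartedSpace (Fin n → ℂ) X] (C : AdaptedCharts n Γ X) {A : Type*} (a : A → Γ × Fin C.m)

/-- The coefficients of a form in a family of translates of the adapted charts. -/
def coef : TopForm n X →ₗ[ℂ] (A × (Fin n → ℂ) → ℂ) where
  toFun f p := (ball (C.center (a p.1).2) (C.radius (a p.1).2)).indicator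
    (formCoeff (C.φ (a p.1).2) (pullback (fun x : X => (a p.1).1 • x) f)) p.2
  map_add' f g := by
    funext p
    rw [map_add]
    exact congrFun (indicator_add _ _ _) p.2
  map_smul' c f := by
    funext p
    rw [map_smul]
    exact congrFun (indicator_const_smul _ c _) p.2

/-- Lebesgue measure on a family of cells. -/
def cellMeasure [MeasurableSpace A] : Measure (A × (Fin n → ℂ)) :=
  Measure.sum fun j => (volume.restrict (C.cell (a j).2)).map (Prod.mk j)

theorem coef_of_mem_ball (f : TopForm n X) {j : A} {z : Fin n → ℂ}
    (hz : z ∈ ball (C.center (a j).2) (C.radius (a j).2)) :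
    C.coef a f (j, z) = formCoeff (C.φ (a j).2) (pullback (fun x : X => (a j).1 • x) f) z :=
  indicator_of_mem hz _

theorem lintegral_cellMeasure [MeasurableSpace A] {F : A × (Fin n → ℂ) → ℝ≥0∞} (hF : Measurable F) :
    ∫⁻ p, F p ∂C.cellMeasure a = ∑' j, ∫⁻ z in C.cell (a j).2, F (j, z) := by
  rw [cellMeasure, lintegral_sum_measure]
  exact tsum_congr fun j => lintegral_map hF measurable_prodMk_left

/-- The extremal function of a set of forms. -/
def extremal (F : Set (TopForm n X)) (i : Fin C.m) : (Fin n → ℂ) → ℝ≥0∞ :=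
  fun z => ⨆ f ∈ F, (ball (C.center i) (C.radius i)).indicator
    (fun z => ‖formCoeff (C.φ i) f z‖ₑ ^ 2) z

/-- The reciprocal of the volume of the polydisc `i`. -/
def bound (i : Fin C.m) : ℝ≥0∞ := (volume (ball (0 : Fin n → ℂ) (C.radius i)))⁻¹

theorem bound_lt_top (i : Fin C.m) : C.bound i < ⊤ :=
  ENNReal.inv_lt_top.2 (measure_ball_pos volume _ (C.radius_pos i))

variable [IsManifold 𝓘(ℂ, Fin n → ℂ) ω X]

theorem differentiableOn_ball (i : Fin C.m) {f : TopForm n X} (hf : f ∈ holomorphicForms n X) :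
    DifferentiableOn ℂ (formCoeff (C.φ i) f) (ball (C.center i) (C.radius i)) :=
  (differentiableOn_formCoeff (C.isHolChart i) hf).mono (C.ball_subset_target i)

theorem measurable_extremal {F : Set (TopForm n X)} (hF : F ⊆ holomorphicForms n X)
    (i : Fin C.m) : Measurable (C.extremal F i) := by
  refine LowerSemicontinuous.measurable ?_
  refine lowerSemicontinuous_biSup fun f hf => ?_
  refine lowerSemicontinuous_indicator_of_continuousOn isOpen_ball ?_
  exact ((ENNReal.continuous_pow 2).comp continuous_enorm).comp_continuousOn
    (C.differentiableOn_ball i (hF hf)).continuousOn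

theorem measurable_coef [Countable A] [MeasurableSpace A] [DiscreteMeasurableSpace A]
    (hΓ : ∀ γ : Γ, ContMDiff 𝓘(ℂ, Fin n → ℂ) 𝓘(ℂ, Fin n → ℂ) ω fun x : X => γ • x)
    {f : TopForm n X} (hf : f ∈ holomorphicForms n X) : Measurable (C.coef a f) := by
  refine measurable_from_prod_countable_right fun j => ?_
  have h : Measurable ((ball (C.center (a j).2) (C.radius (a j).2)).indicator
      (formCoeff (C.φ (a j).2) (pullback (fun x : X => (a j).1 • x) f))) :=
    measurable_indicator_of_continuousOn measurableSet_ball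
      (C.differentiableOn_ball _ (pullback_mem_holomorphicForms (hΓ (a j).1) hf)).continuousOn
  exact h

theorem lintegral_coef [Countable A] [MeasurableSpace A] [DiscreteMeasurableSpace A]
    [ContinuousConstSMul Γ X]
    (hΓ : ∀ γ : Γ, ContMDiff 𝓘(ℂ, Fin n → ℂ) 𝓘(ℂ, Fin n → ℂ) ω fun x : X => γ • x)
    {f : TopForm n X} (hf : f ∈ holomorphicForms n X) :
    ∫⁻ p, ‖C.coef a f p‖ₑ ^ 2 ∂C.cellMeasure a = ∑' j, ∫⁻ z in C.cell (a j).2,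
      ‖formCoeff (C.φ (a j).2) (pullback (fun x : X => (a j).1 • x) f) z‖ₑ ^ 2 := by
  rw [C.lintegral_cellMeasure a ((C.measurable_coef a hΓ hf).enorm.pow_const 2)]
  refine tsum_congr fun j => setLIntegral_congr_fun (C.measurableSet_cell _) fun z hz => ?_
  rw [C.coef_of_mem_ball a f (C.cell_subset_ball _ hz)]

/-- The polydisc of radius `C.radius i` about `z` still lies in the chart target, whose radius is
twice that, so the sub-mean value property applies on it. -/
theorem enorm_formCoeff_sq_le (i : Fin C.m) {f : TopForm n X} (hf : f ∈ holomorphicForms n X)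
    {z : Fin n → ℂ} (hz : z ∈ ball (C.center i) (C.radius i)) :
    ‖formCoeff (C.φ i) f z‖ₑ ^ 2 ≤
      C.bound i * ∫⁻ w in (C.φ i).target, ‖formCoeff (C.φ i) f w‖ₑ ^ 2 := by
  have hsub : ball z (C.radius i) ⊆ (C.φ i).target := by
    rw [C.target_eq, two_mul]
    exact ball_subset_ball' (by rw [add_le_add_iff_left]; exact (mem_ball.1 hz).le)
  have h := enorm_sq_mul_volume_ball_le
    ((differentiableOn_formCoeff (C.isHolChart i) hf).mono hsub)
  rw [Measure.addHaar_ball_center volume z] at h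
  have h2 := h.trans (lintegral_mono_set hsub)
  rw [bound, mul_comm, ← div_eq_mul_inv]
  exact (ENNReal.le_div_iff_mul_le (.inl (measure_ball_pos volume _ (C.radius_pos i)).ne')
    (.inl measure_ball_lt_top.ne)).2 h2

end AdaptedCharts

/-! ### Cosets and forms invariant under a normal subgroup. -/

section Cosets

variable {Γ : Type*} [Group Γ]

/-- Every element of `Γ` is uniquely `c.out * s` with `c` a coset of `S` and `s ∈ S`. -/
def outMulEquiv (S : Subgroup Γ) : (Γ ⧸ S) × S ≃ Γ where
  toFun p := p.1.out * p.2
  invFun γ := (γ, ⟨(γ : Γ ⧸ S).out⁻¹ * γ, QuotientGroup.eq.1 (QuotientGroup.out_eq' _)⟩)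
  left_inv := by
    rintro ⟨c, s⟩
    have h : ((c.out * s : Γ) : Γ ⧸ S) = c := by
      rw [QuotientGroup.mk_mul_of_mem _ s.2, QuotientGroup.out_eq']
    refine Prod.ext h (Subtype.ext ?_)
    simp only [h, inv_mul_cancel_left]
  right_inv γ := by simp

variable {n : ℕ} {X : Type*} [TopologicalSpace X] [MulAction Γ X] [ChartedSpace (Fin n → ℂ) X]

/-- Forms invariant under `S`. -/
def IsInvariantForm (S : Subgroup Γ) (f : TopForm n X) : Prop :=
  ∀ σ ∈ S, pullback (fun x : X => σ • x) f = f

variable (hΓ : ∀ γ : Γ, ContMDiff 𝓘(ℂ, Fin n → ℂ) 𝓘(ℂ, Fin n → ℂ) ω fun x : X => γ • x)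
  {S : Subgroup Γ} (hS : S.Normal) {f : TopForm n X} (hf : IsInvariantForm S f)
include hΓ hS hf

/-- Invariance makes the pullback constant on the classes `S * γ`; normality identifies these with
the left cosets. -/
theorem IsInvariantForm.pullback_congr {γ γ' : Γ} (h : (γ : Γ ⧸ S) = γ') :
    pullback (fun x : X => γ • x) f = pullback (fun x : X => γ' • x) f := by
  have h1 : γ' * γ⁻¹ ∈ S := by
    have h2 := hS.conj_mem _ (QuotientGroup.eq.1 h) γ
    simpa [mul_assoc] using h2
  have h3 := pullback_smul_pullback_smul hΓ γ (γ' * γ⁻¹) f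
  rw [hf _ h1, inv_mul_cancel_right] at h3
  exact h3

theorem IsInvariantForm.pullback (g : Γ) :
    IsInvariantForm S (BergmanTower.pullback (fun x : X => g • x) f) := by
  intro σ hσ
  rw [pullback_smul_pullback_smul hΓ]
  refine hf.pullback_congr hΓ hS ?_
  rw [QuotientGroup.mk_mul_of_mem _ hσ]

end Cosets

/-! ### Norms over the intermediate quotients. -/

namespace AdaptedCharts

variable {n : ℕ} {Γ : Type*} [Group Γ] {X : Type*} [TopologicalSpace X] [MulAction Γ X]
  [ChartedSpace (Fin n → ℂ) X] (C : AdaptedCharts n Γ X)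

/-- The square of the `L²` norm over `X / S` of an `S`-invariant form. -/
def normSqMod (S : Subgroup Γ) (f : TopForm n X) : ℝ≥0∞ :=
  ∑' c : Γ ⧸ S, C.energy (pullback (fun x : X => c.out • x) f)

variable (hΓ : ∀ γ : Γ, ContMDiff 𝓘(ℂ, Fin n → ℂ) 𝓘(ℂ, Fin n → ℂ) ω fun x : X => γ • x)
  {S : Subgroup Γ} (hS : S.Normal) {f : TopForm n X} (hf : IsInvariantForm S f)
include hΓ hS hf

/-- Translation by `g` only permutes the cosets over which the energies are summed. -/
theorem normSqMod_pullback (g : Γ) :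
    C.normSqMod S (pullback (fun x : X => g • x) f) = C.normSqMod S f := by
  unfold normSqMod
  rw [← (MulAction.toPerm g : Equiv.Perm (Γ ⧸ S)).tsum_eq
    fun c : Γ ⧸ S => C.energy (pullback (fun x : X => c.out • x) f)]
  refine tsum_congr fun c => ?_
  rw [pullback_smul_pullback_smul hΓ, hf.pullback_congr hΓ hS (γ' := (g • c).out)]
  · rfl
  · rw [QuotientGroup.out_eq', ← smul_eq_mul, MulAction.Quotient.coe_smul_out]

/-- Translates of the fundamental domain by representatives of distinct cosets are disjoint in `X /
S`, so their energies are among the terms of the norm. -/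
theorem sum_energy_le_normSqMod (t : Finset Γ) (ht : ∀ γ ∈ t, ∀ γ' ∈ t, (γ : Γ ⧸ S) = γ' → γ = γ') :
    ∑ γ ∈ t, C.energy (pullback (fun x : X => γ • x) f) ≤ C.normSqMod S f := by
  classical
  have h1 : ∑ γ ∈ t, C.energy (pullback (fun x : X => γ • x) f) =
      ∑ c ∈ t.image (QuotientGroup.mk : Γ → Γ ⧸ S),
        C.energy (pullback (fun x : X => c.out • x) f) := by
    rw [Finset.sum_image fun γ hγ γ' hγ' h => ht γ hγ γ' hγ' h]
    refine Finset.sum_congr rfl fun γ _ => ?_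
    rw [hf.pullback_congr hΓ hS (QuotientGroup.out_eq' (γ : Γ ⧸ S)).symm]
  rw [h1]
  exact ENNReal.sum_le_tsum _

variable [ContinuousConstSMul Γ X] [LocallyCompactSpace X] [SecondCountableTopology X]
  [ProperlyDiscontinuousSMul Γ X]

/-- The polydisc injects into `X / S`. Writing `γ = c.out * s`, the pulled-back form depends only on
`c`, and for fixed `c` the parts of a cell belonging to different `s` are disjoint, so together they
cost at most one energy. -/
theorem lintegral_target_le_normSqMod (i : Fin C.m) :
    ∫⁻ z in (C.φ i).target, ‖formCoeff (C.φ i) f z‖ₑ ^ 2 ≤ C.normSqMod S f := by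
  have : Countable (Γ × Fin C.m) := C.countable_index
  have : Countable Γ := (Prod.mk_left_injective i).countable
  rw [C.lintegral_target_eq hΓ, ← (outMulEquiv S).tsum_eq, ENNReal.tsum_prod', normSqMod]
  refine ENNReal.tsum_le_tsum fun c => ?_
  have hp : ∀ s : S, pullback (fun x : X => outMulEquiv S (c, s) • x) f =
      pullback (fun x : X => c.out • x) f := fun s =>
    hf.pullback_congr hΓ hS (QuotientGroup.mk_mul_of_mem _ s.2)
  simp only [hp]
  rw [energy, Summable.tsum_finsetSum fun _ _ => ENNReal.summable]
  refine Finset.sum_le_sum fun k _ => ?_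
  have hm : ∀ γ : Γ, MeasurableSet (C.cell k ∩ {z | γ • (C.φ k).symm z ∈ (C.φ i).source}) := by
    intro γ
    borelize X
    have h1 := measurableSet_coordSet (C.φ k)
      ((continuous_const_smul γ).measurable (C.φ i).open_source.measurableSet)
    have h2 := (C.measurableSet_cell k).inter h1
    convert h2 using 1
    ext z
    exact ⟨fun h => ⟨h.1, h.1.1, h.2⟩, fun h => ⟨h.1, h.2.2⟩⟩
  rw [← lintegral_iUnion (fun s : S => hm _)]
  · exact lintegral_mono_set (iUnion_subset fun s => inter_subset_left)
  · intro s s' hss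
    refine disjoint_left.2 fun z hz hz' => hss ?_
    have h := C.eq_one_of_smul_mem i (outMulEquiv S (c, s') * (outMulEquiv S (c, s))⁻¹) _ hz.2
      (by rw [mul_smul, inv_smul_smul]; exact hz'.2)
    have h2 := (outMulEquiv S).injective (mul_inv_eq_one.1 h)
    exact (congrArg Prod.snd h2).symm

end AdaptedCharts

/-- A form is determined at a point by its coefficient in a chart. -/
theorem IsHolChart.exists_apply_eq {n : ℕ} {X : Type*} [TopologicalSpace X]
    [ChartedSpace (Fin n → ℂ) X] {ψ : OpenPartialHomeomorph X (Fin n → ℂ)} (hψ : IsHolChart ψ)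
    {x : X} (hx : x ∈ ψ.source) : ∃ d : ℂ, ∀ (f : TopForm n X) (v : Fin n → Fin n → ℂ),
      f x v = (Matrix.of v).det * (d * formCoeff ψ f (ψ x)) := by
  have h1 : HasMFDerivAt 𝓘(ℂ, Fin n → ℂ) 𝓘(ℂ, Fin n → ℂ) (fun y => ψ.symm (ψ y)) x
      ((mfderiv 𝓘(ℂ, Fin n → ℂ) 𝓘(ℂ, Fin n → ℂ) ψ.symm (ψ x)).comp
        (mfderiv 𝓘(ℂ, Fin n → ℂ) 𝓘(ℂ, Fin n → ℂ) ψ x)) :=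
    ((hψ.contMDiffAt_symm (ψ.map_source hx)).mdifferentiableAt (by simp)).hasMFDerivAt.comp x
      ((hψ.contMDiffAt hx).mdifferentiableAt (by simp)).hasMFDerivAt
  have h2 := h1.congr_of_eventuallyEq (f₁ := fun y => y) (by
    filter_upwards [ψ.open_source.mem_nhds hx] with y hy using (ψ.left_inv hy).symm)
  have h3 := hasMFDerivAt_unique h2 (hasMFDerivAt_id x)
  set A : (Fin n → ℂ) →L[ℂ] (Fin n → ℂ) := mfderiv 𝓘(ℂ, Fin n → ℂ) 𝓘(ℂ, Fin n → ℂ) ψ.symm (ψ x)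
  set L : (Fin n → ℂ) →L[ℂ] (Fin n → ℂ) := mfderiv 𝓘(ℂ, Fin n → ℂ) 𝓘(ℂ, Fin n → ℂ) ψ x
  have hAL : ∀ v, A (L v) = v := fun v =>
    congrArg (fun B : (Fin n → ℂ) →L[ℂ] (Fin n → ℂ) => B v) h3
  refine ⟨L.det, fun f v => ?_⟩
  have e1 : f x v = (Matrix.of v).det * f x fun i => (Pi.single i 1 : Fin n → ℂ) :=
    alternatingMap_eq_det_mul (f x) v
  have e2 : formCoeff ψ f (ψ x) = f x fun i => A (Pi.single i 1 : Fin n → ℂ) :=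
    apply_congr_point (fun y (v : Fin n → Fin n → ℂ) => f y v) (ψ.left_inv hx) rfl
  have e3 : (f x fun i => A (Pi.single i 1 : Fin n → ℂ)) =
      A.det * f x fun i => (Pi.single i 1 : Fin n → ℂ) := by
    have h := det_of_map (A : (Fin n → ℂ) →ₗ[ℂ] (Fin n → ℂ)) fun i => (Pi.single i 1 : Fin n → ℂ)
    rw [det_of_single, mul_one] at h
    refine (alternatingMap_eq_det_mul (f x) _).trans ?_
    exact congrArg (· * _) h
  have e4 : L.det * A.det = 1 := by
    have h : A.comp L = ContinuousLinearMap.id ℂ _ := ContinuousLinearMap.ext hAL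
    have h' := congrArg (fun B : (Fin n → ℂ) →L[ℂ] (Fin n → ℂ) => B.det) h
    simp only [ContinuousLinearMap.det] at h' ⊢
    rw [ContinuousLinearMap.toLinearMap_comp, LinearMap.det_comp] at h'
    rw [mul_comm, h']
    simp
  rw [e1, e2, e3, ← mul_assoc L.det, e4, one_mul]

/-! ### Normal families along a tower. -/

namespace AdaptedCharts

variable {n : ℕ} {Γ : Type*} [Group Γ] {X : Type*} [TopologicalSpace X] [MulAction Γ X]
  [ChartedSpace (Fin n → ℂ) X] (C : AdaptedCharts n Γ X)

/-- The unit ball of the `S`-invariant holomorphic forms, for the norm of `X / S`. -/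
def unitBall (S : Subgroup Γ) : Set (TopForm n X) :=
  {f | f ∈ holomorphicForms n X ∧ IsInvariantForm S f ∧ C.normSqMod S f ≤ 1}

variable [IsManifold 𝓘(ℂ, Fin n → ℂ) ω X]
  (hΓ : ∀ γ : Γ, ContMDiff 𝓘(ℂ, Fin n → ℂ) 𝓘(ℂ, Fin n → ℂ) ω fun x : X => γ • x)
include hΓ

theorem pullback_mem_unitBall {S : Subgroup Γ} (hS : S.Normal) {f : TopForm n X}
    (hf : f ∈ C.unitBall S) (g : Γ) : pullback (fun x : X => g • x) f ∈ C.unitBall S :=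
  ⟨pullback_mem_holomorphicForms (hΓ g) hf.1, hf.2.1.pullback hΓ hS g,
    (C.normSqMod_pullback hΓ hS hf.2.1 g).trans_le hf.2.2⟩

variable [ContinuousConstSMul Γ X] [LocallyCompactSpace X] [SecondCountableTopology X]
  [ProperlyDiscontinuousSMul Γ X]

/-- The bound does not depend on `S`; it feeds both Montel's theorem and the dominated limit of the
integrals. -/
theorem enorm_formCoeff_sq_le_of_mem_unitBall {S : Subgroup Γ} (hS : S.Normal) {f : TopForm n X}
    (hf : f ∈ C.unitBall S) (i : Fin C.m) {z : Fin n → ℂ}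
    (hz : z ∈ ball (C.center i) (C.radius i)) : ‖formCoeff (C.φ i) f z‖ₑ ^ 2 ≤ C.bound i := by
  refine (C.enorm_formCoeff_sq_le i hf.1 hz).trans ?_
  calc C.bound i * _ ≤ C.bound i * 1 := by
        gcongr
        exact (C.lintegral_target_le_normSqMod hΓ hS hf.2.1 i).trans hf.2.2
    _ = C.bound i := mul_one _

/-- Normal families: forms in the unit balls of `X / S l`, where the `S l` eventually avoid every
nontrivial element of `Γ`, subconverge to a form in the unit ball of `X`. -/
theorem exists_subseq_tendsto_form {S : ℕ → Subgroup Γ} (hS : ∀ l, (S l).Normal)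
    (hsep : ∀ γ : Γ, γ ≠ 1 → ∀ᶠ l in atTop, γ ∉ S l) {f : ℕ → TopForm n X}
    (hf : ∀ l, f l ∈ C.unitBall (S l)) :
    ∃ φ : ℕ → ℕ, StrictMono φ ∧ ∃ g ∈ holomorphicForms n X, normSq g ≤ 1 ∧
      ∀ (x : X) (v : Fin n → Fin n → ℂ), Tendsto (fun l => f (φ l) x v) atTop (𝓝 (g x v)) := by
  have hcount : Countable (Γ × Fin C.m) := C.countable_index
  have hdiff : ∀ l (a : Γ × Fin C.m), DifferentiableOn ℂ
      (formCoeff (C.φ a.2) (pullback (fun x : X => a.1 • x) (f l)))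
      (ball (C.center a.2) (C.radius a.2)) := fun l a =>
    C.differentiableOn_ball _ (pullback_mem_holomorphicForms (hΓ a.1) (hf l).1)
  have hbdd : ∀ l (a : Γ × Fin C.m), ∀ z ∈ ball (C.center a.2) (C.radius a.2),
      ‖formCoeff (C.φ a.2) (pullback (fun x : X => a.1 • x) (f l)) z‖ ≤
        Real.sqrt (C.bound a.2).toReal := by
    intro l a z hz
    have h := C.enorm_formCoeff_sq_le_of_mem_unitBall hΓ (hS l)
      (C.pullback_mem_unitBall hΓ (hS l) (hf l) a.1) a.2 hz
    refine Real.le_sqrt_of_sq_le ?_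
    have h2 := ENNReal.toReal_mono (C.bound_lt_top a.2).ne h
    simpa using h2
  obtain ⟨φ, hφ, hlim⟩ := exists_subseq_tendsto_of_bounded (fun _ => isOpen_ball) _ hdiff hbdd
  have hpt : ∀ x : X, ∃ w : ℂ, ∀ v : Fin n → Fin n → ℂ,
      Tendsto (fun l => f (φ l) x v) atTop (𝓝 ((Matrix.of v).det * w)) := by
    intro x
    obtain ⟨γ, i, z, hz, rfl⟩ := C.exists_mem_cell x
    obtain ⟨w, hw⟩ := hlim (γ, i) z (C.cell_subset_ball i hz)
    have hx : γ • (C.φ i).symm z ∈ (C.chart (γ, i)).source := by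
      rw [chart, mem_translateChart_source, inv_smul_smul]
      exact (C.φ i).map_target hz.1
    obtain ⟨d, hd⟩ := ((C.isHolChart i).translateChart hΓ γ).exists_apply_eq hx
    refine ⟨d * w, fun v => ?_⟩
    have hzx : translateChart γ (C.φ i) (γ • (C.φ i).symm z) = z := by
      rw [translateChart_apply, inv_smul_smul, (C.φ i).right_inv hz.1]
    have hd' : ∀ l, f (φ l) (γ • (C.φ i).symm z) v = (Matrix.of v).det *
        (d * formCoeff (C.φ i) (pullback (fun x : X => γ • x) (f (φ l))) z) := fun l => by
      refine (hd (f (φ l)) v).trans ?_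
      rw [hzx, formCoeff_translateChart hΓ (C.isHolChart i) γ _ hz.1]
    exact ((hw.const_mul d).const_mul _).congr fun l => (hd' l).symm
  choose w hw using hpt
  -- At each point all the forms are multiples of the determinant, so the limit form is determined
  -- by the limit of one coefficient.
  set g : TopForm n X := fun x => w x • (Pi.basisFun ℂ (Fin n)).det with hg
  have hgx : ∀ (x : X) (v : Fin n → Fin n → ℂ), g x v = (Matrix.of v).det * w x := by
    intro x v
    have h : (w x • (Pi.basisFun ℂ (Fin n)).det) v = (Matrix.of v).det * w x := by
      rw [AlternatingMap.smul_apply, Pi.basisFun_det, smul_eq_mul, mul_comm]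
      rfl
    exact h
  have hconv : ∀ (x : X) (v : Fin n → Fin n → ℂ),
      Tendsto (fun l => f (φ l) x v) atTop (𝓝 (g x v)) := fun x v => by
    rw [hgx]; exact hw x v
  have hcoef : ∀ (a : Γ × Fin C.m) (z : Fin n → ℂ), Tendsto
      (fun l => formCoeff (C.φ a.2) (pullback (fun x : X => a.1 • x) (f (φ l))) z) atTop
      (𝓝 (formCoeff (C.φ a.2) (pullback (fun x : X => a.1 • x) g) z)) := fun a z => hconv _ _
  have hghol : g ∈ holomorphicForms n X := by
    refine mem_holomorphicForms_of_cover fun x => ?_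
    obtain ⟨γ, i, z, hz, rfl⟩ := C.exists_mem_cell x
    refine ⟨translateChart γ (C.φ i), (C.isHolChart i).translateChart hΓ γ, ?_, ?_⟩
    · rw [mem_translateChart_source, inv_smul_smul]
      exact (C.φ i).map_target hz.1
    · rw [translateChart_apply, inv_smul_smul, (C.φ i).right_inv hz.1]
      have hd := differentiableOn_of_tendsto_of_bounded isOpen_ball
        (fun l => hdiff (φ l) (γ, i)) (fun l => hbdd (φ l) (γ, i)) fun z _ => hcoef (γ, i) z
      have hzb := isOpen_ball.mem_nhds (C.cell_subset_ball i hz)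
      refine (hd.differentiableAt hzb).congr_of_eventuallyEq ?_
      filter_upwards [hzb] with y hy
      exact formCoeff_translateChart hΓ (C.isHolChart i) γ g (C.ball_subset_target i hy)
  refine ⟨φ, hφ, g, hghol, ?_, hconv⟩
  -- It suffices to bound the energy over each finite set `t` of translates of the fundamental
  -- domain; Fatou's lemma is applied there.
  rw [C.normSq_eq hΓ, ENNReal.tsum_eq_iSup_sum]
  refine iSup_le fun t => ?_
  let : MeasurableSpace (t × Fin C.m) := ⊤
  have : DiscreteMeasurableSpace (t × Fin C.m) := ⟨fun _ => trivial⟩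
  let a : t × Fin C.m → Γ × Fin C.m := fun p => (p.1, p.2)
  have hint : ∀ h ∈ holomorphicForms n X, ∫⁻ p, ‖C.coef a h p‖ₑ ^ 2 ∂C.cellMeasure a =
      ∑ γ ∈ t, C.energy (pullback (fun x : X => γ • x) h) := by
    intro h hh
    rw [C.lintegral_coef a hΓ hh, ENNReal.tsum_prod', tsum_fintype, ← Finset.sum_coe_sort t]
    refine Finset.sum_congr rfl fun γ _ => ?_
    rw [tsum_fintype]
    rfl
  have hlimcoef : ∀ p, Tendsto (fun l => ‖C.coef a (f (φ l)) p‖ₑ ^ 2) atTop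
      (𝓝 (‖C.coef a g p‖ₑ ^ 2)) := by
    rintro ⟨j, z⟩
    refine ((ENNReal.continuous_pow 2).comp continuous_enorm).continuousAt.tendsto.comp ?_
    by_cases hz : z ∈ ball (C.center (a j).2) (C.radius (a j).2)
    · simp only [C.coef_of_mem_ball a _ hz]
      exact hcoef (a j) z
    · have h0 : ∀ h : TopForm n X, C.coef a h (j, z) = 0 := fun h => indicator_of_notMem hz _
      simp only [h0]
      exact tendsto_const_nhds
  rw [← hint g hghol]
  have hle : ∀ᶠ l in atTop, ∫⁻ p, ‖C.coef a (f (φ l)) p‖ₑ ^ 2 ∂C.cellMeasure a ≤ 1 := by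
    -- Only finitely many nontrivial elements `γ⁻¹ * γ'` arise from `t`. Once `S (φ l)` avoids them,
    -- distinct elements of `t` lie in distinct cosets.
    have hev : ∀ᶠ l in atTop, ∀ p ∈ t ×ˢ t, p.1⁻¹ * p.2 ≠ 1 → p.1⁻¹ * p.2 ∉ S (φ l) := by
      rw [Filter.eventually_all_finset]
      intro p _
      by_cases hp : p.1⁻¹ * p.2 = 1
      · simp [hp]
      · filter_upwards [hφ.tendsto_atTop.eventually (hsep _ hp)] with l hl _ using hl
    filter_upwards [hev] with l hl
    rw [hint _ (hf _).1]
    refine (C.sum_energy_le_normSqMod hΓ (hS _) (hf (φ l)).2.1 t ?_).trans (hf (φ l)).2.2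
    intro γ hγ γ' hγ' h
    by_contra hne
    exact hl (γ, γ') (Finset.mk_mem_product hγ hγ') (fun h1 => hne (inv_mul_eq_one.1 h1))
      (QuotientGroup.eq.1 h)
  calc ∫⁻ p, ‖C.coef a g p‖ₑ ^ 2 ∂C.cellMeasure a
      = ∫⁻ p, liminf (fun l => ‖C.coef a (f (φ l)) p‖ₑ ^ 2) atTop ∂C.cellMeasure a :=
        lintegral_congr fun p => (hlimcoef p).liminf_eq.symm
    _ ≤ liminf (fun l => ∫⁻ p, ‖C.coef a (f (φ l)) p‖ₑ ^ 2 ∂C.cellMeasure a) atTop :=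
        lintegral_liminf_le fun l => (C.measurable_coef a hΓ (hf _).1).enorm.pow_const 2
    _ ≤ 1 := liminf_le_of_frequently_le' hle.frequently

end AdaptedCharts

/-! ### Evaluation functionals on the closed span of an orthonormal family. -/

section Hilbert

variable {V H : Type*} [AddCommGroup V] [Module ℂ V] [NormedAddCommGroup H] [InnerProductSpace ℂ H]

/-- Cauchy–Schwarz for the finite expansion of `u` in the family. -/
theorem norm_le_of_mem_span_of_orthonormal (Φ : V →ₗ[ℂ] H) {ι : Type*} {e : ι → V}
    (he : Orthonormal ℂ fun i => Φ (e i)) (ev : V →ₗ[ℂ] ℂ)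
    (hK : ∑' i, ‖ev (e i)‖ₑ ^ 2 ≠ ⊤) {u : V} (hu : u ∈ Submodule.span ℂ (range e)) :
    ‖ev u‖ ≤ Real.sqrt (∑' i, ‖ev (e i)‖ₑ ^ 2).toReal * ‖Φ u‖ := by
  obtain ⟨c, rfl⟩ := Finsupp.mem_span_range_iff_exists_finsupp.1 hu
  have hev : ev (c.sum fun i a => a • e i) = ∑ i : c.support, c i * ev (e i) := by
    rw [Finsupp.sum, map_sum, ← Finset.sum_coe_sort]
    simp only [map_smul, smul_eq_mul]
  have hn : ‖Φ (c.sum fun i a => a • e i)‖ ^ 2 = ∑ i : c.support, ‖c i‖ ^ 2 := by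
    rw [Finsupp.sum, map_sum, ← Finset.sum_coe_sort]
    simp only [map_smul]
    exact norm_sq_sum_smul_of_orthonormal
      (he.comp (fun i : c.support => (i : ι)) Subtype.val_injective) fun i => c i
  have hs : ∑ i : c.support, ‖ev (e i)‖ ^ 2 ≤ (∑' i, ‖ev (e i)‖ₑ ^ 2).toReal := by
    rw [Finset.sum_coe_sort c.support fun i => ‖ev (e i)‖ ^ 2,
      ← ENNReal.ofReal_le_iff_le_toReal hK, ENNReal.ofReal_sum_of_nonneg fun _ _ => by positivity]
    refine le_of_eq_of_le (Finset.sum_congr rfl fun i _ => ?_) (ENNReal.sum_le_tsum c.support)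
    rw [ENNReal.ofReal_pow (norm_nonneg _), ofReal_norm]
  refine (abs_le_of_sq_le_sq' ?_ (by positivity)).2
  rw [hev, mul_pow, Real.sq_sqrt ENNReal.toReal_nonneg, hn, mul_comm]
  calc ‖∑ i : c.support, c i * ev (e i)‖ ^ 2
      ≤ (∑ i : c.support, ‖c i‖ * ‖ev (e i)‖) ^ 2 := by
        gcongr
        refine (norm_sum_le _ _).trans (le_of_eq ?_)
        simp only [norm_mul]
    _ ≤ (∑ i : c.support, ‖c i‖ ^ 2) * ∑ i : c.support, ‖ev (e i)‖ ^ 2 :=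
        Finset.sum_mul_sq_le_sq_mul_sq _ _ _
    _ ≤ _ := by gcongr

/-- The sum of the squared values of a bounded functional on an orthonormal family bounds its squared
values on the part of the unit ball in the closed span of the family. -/
theorem enorm_sq_le_tsum_of_orthonormal (Φ : V →ₗ[ℂ] H) {ι : Type*} {e : ι → V}
    (he : Orthonormal ℂ fun i => Φ (e i)) (ev : V →ₗ[ℂ] ℂ) {κ : ℝ≥0∞} (hκ : κ ≠ ⊤)
    (hev : ∀ u, ‖ev u‖ₑ ^ 2 ≤ κ * ‖Φ u‖ₑ ^ 2) {u : V} (hu : ‖Φ u‖ₑ ^ 2 ≤ 1)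
    (hdense : ∀ ε : ℝ≥0∞, 0 < ε → ∃ w ∈ Submodule.span ℂ (range e), ‖Φ (u - w)‖ₑ ^ 2 < ε) :
    ‖ev u‖ₑ ^ 2 ≤ ∑' i, ‖ev (e i)‖ₑ ^ 2 := by
  by_cases hK : ∑' i, ‖ev (e i)‖ₑ ^ 2 = ⊤
  · rw [hK]; exact le_top
  set k : ℝ := Real.sqrt (∑' i, ‖ev (e i)‖ₑ ^ 2).toReal with hk
  have hk0 : 0 ≤ k := Real.sqrt_nonneg _
  set q : ℝ := Real.sqrt κ.toReal with hq
  have hq0 : 0 ≤ q := Real.sqrt_nonneg _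
  have hnorm : ∀ (w : H) (δ : ℝ), 0 ≤ δ → ‖w‖ₑ ^ 2 ≤ ENNReal.ofReal (δ ^ 2) → ‖w‖ ≤ δ := by
    intro w δ hδ h
    rw [ENNReal.ofReal_pow hδ, ENNReal.pow_le_pow_left_iff two_ne_zero, ← ofReal_norm] at h
    exact (ENNReal.ofReal_le_ofReal_iff hδ).1 h
  have hevq : ∀ w, ‖ev w‖ ≤ q * ‖Φ w‖ := by
    intro w
    have h := ENNReal.toReal_mono (ENNReal.mul_ne_top hκ (ENNReal.pow_ne_top enorm_ne_top)) (hev w)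
    rw [ENNReal.toReal_mul, ENNReal.toReal_pow, ENNReal.toReal_pow, toReal_enorm,
      toReal_enorm] at h
    refine (abs_le_of_sq_le_sq' ?_ (by positivity)).2
    rwa [mul_pow, hq, Real.sq_sqrt ENNReal.toReal_nonneg]
  have hreal : ‖ev u‖ ≤ k := by
    refine le_of_forall_pos_le_add fun ε hε => ?_
    -- An approximation within `δ` costs `k * δ` through the norm of `w` and `q * δ` through the
    -- error `u - w`; together these stay below `ε`.
    set δ : ℝ := ε / (k + q + 1) with hδ
    have hδ0 : 0 < δ := by positivity
    obtain ⟨w, hw, huw⟩ := hdense (ENNReal.ofReal (δ ^ 2)) (ENNReal.ofReal_pos.2 (by positivity))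
    have h1 := norm_le_of_mem_span_of_orthonormal Φ he ev hK hw
    have h2 := hnorm _ δ hδ0.le huw.le
    have h3 : ‖Φ u‖ ≤ 1 := hnorm _ 1 zero_le_one (by simpa using hu)
    have h4 : ‖Φ w‖ ≤ 1 + δ := by
      rw [map_sub] at h2
      linarith [norm_sub_norm_le (Φ w) (Φ u), norm_sub_rev (Φ w) (Φ u)]
    have h5 := hevq (u - w)
    have h6 : ev u = ev w + ev (u - w) := by rw [map_sub]; ring
    have h7 : δ * (k + q + 1) = ε := by rw [hδ]; field_simp
    calc ‖ev u‖ ≤ ‖ev w‖ + ‖ev (u - w)‖ := by rw [h6]; exact norm_add_le _ _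
      _ ≤ k * (1 + δ) + q * δ := by
          refine add_le_add (h1.trans ?_) (h5.trans ?_) <;> gcongr
      _ ≤ k + ε := by nlinarith
  rw [← ofReal_norm, ← ENNReal.ofReal_pow (norm_nonneg _)]
  refine (ENNReal.ofReal_le_ofReal (pow_le_pow_left₀ (norm_nonneg _) hreal 2)).trans ?_
  rw [hk, Real.sq_sqrt ENNReal.toReal_nonneg, ENNReal.ofReal_toReal hK]

end Hilbert

/-- The unit ball of the square integrable holomorphic forms. -/
def normBall (n : ℕ) (X : Type*) [TopologicalSpace X] [ChartedSpace (Fin n → ℂ) X] :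
    Set (TopForm n X) :=
  {f | f ∈ holomorphicForms n X ∧ normSq f ≤ 1}

/-- Evaluation of forms at a frame. -/
def evalForm {n : ℕ} {X : Type*} [TopologicalSpace X] [ChartedSpace (Fin n → ℂ) X] (x : X)
    (v : Fin n → Fin n → ℂ) : TopForm n X →ₗ[ℂ] ℂ where
  toFun f := f x v
  map_add' _ _ := rfl
  map_smul' _ _ := rfl

/-! ### The Bergman kernel as an extremal function. -/

namespace AdaptedCharts

variable {n : ℕ} {Γ : Type*} [Group Γ] {X : Type*} [TopologicalSpace X] [MulAction Γ X]
  [ChartedSpace (Fin n → ℂ) X] (C : AdaptedCharts n Γ X) [IsManifold 𝓘(ℂ, Fin n → ℂ) ω X]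
  (hΓ : ∀ γ : Γ, ContMDiff 𝓘(ℂ, Fin n → ℂ) 𝓘(ℂ, Fin n → ℂ) ω fun x : X => γ • x)
  [ContinuousConstSMul Γ X] [LocallyCompactSpace X] [SecondCountableTopology X]
  [ProperlyDiscontinuousSMul Γ X]
include C hΓ

theorem normSq_pullback (f : TopForm n X) (γ : Γ) :
    normSq (pullback (fun x : X => γ • x) f) = normSq f := by
  rw [C.normSq_eq hΓ, C.normSq_eq hΓ]
  simp only [pullback_smul_pullback_smul hΓ]
  exact (Equiv.mulLeft γ).tsum_eq fun σ => C.energy (pullback (fun x : X => σ • x) f)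

theorem enorm_formCoeff_sq_le_normSq (i : Fin C.m) {f : TopForm n X}
    (hf : f ∈ holomorphicForms n X) {z : Fin n → ℂ} (hz : z ∈ ball (C.center i) (C.radius i)) :
    ‖formCoeff (C.φ i) f z‖ₑ ^ 2 ≤ C.bound i * normSq f := by
  refine (C.enorm_formCoeff_sq_le i hf hz).trans ?_
  gcongr
  rw [C.lintegral_target_eq hΓ, C.normSq_eq hΓ]
  refine ENNReal.tsum_le_tsum fun γ => Finset.sum_le_sum fun k _ => ?_
  exact lintegral_mono_set inter_subset_left

/-- Point evaluations are bounded on the square integrable holomorphic forms. -/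
theorem exists_enorm_apply_sq_le (x : X) (v : Fin n → Fin n → ℂ) :
    ∃ κ : ℝ≥0∞, κ < ⊤ ∧ ∀ f ∈ holomorphicForms n X, ‖f x v‖ₑ ^ 2 ≤ κ * normSq f := by
  obtain ⟨γ, i, z, hz, rfl⟩ := C.exists_mem_cell x
  obtain ⟨d, hd⟩ := ((C.isHolChart i).translateChart hΓ γ).exists_apply_eq
    (x := γ • (C.φ i).symm z) (by
      rw [mem_translateChart_source, inv_smul_smul]
      exact (C.φ i).map_target hz.1)
  refine ⟨‖(Matrix.of v).det‖ₑ ^ 2 * (‖d‖ₑ ^ 2 * C.bound i), ?_, fun f hf => ?_⟩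
  · have h1 : ∀ w : ℂ, ‖w‖ₑ ^ 2 < ⊤ := fun w => ENNReal.pow_lt_top enorm_lt_top
    exact ENNReal.mul_lt_top (h1 _) (ENNReal.mul_lt_top (h1 _) (C.bound_lt_top i))
  · have h1 : f (γ • (C.φ i).symm z) v = (Matrix.of v).det *
        (d * formCoeff (C.φ i) (pullback (fun x : X => γ • x) f) z) := by
      refine (hd f v).trans ?_
      rw [translateChart_apply, inv_smul_smul, (C.φ i).right_inv hz.1,
        formCoeff_translateChart hΓ (C.isHolChart i) γ _ hz.1]
    have h2 := C.enorm_formCoeff_sq_le_normSq hΓ i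
      (pullback_mem_holomorphicForms (hΓ γ) hf) (C.cell_subset_ball i hz)
    rw [C.normSq_pullback hΓ] at h2
    refine (congrArg (fun w : ℂ => ‖w‖ₑ ^ 2) h1).trans_le ?_
    simp only [enorm_mul, mul_pow]
    rw [mul_assoc, mul_assoc]
    gcongr

variable {A : Type*} [MeasurableSpace A] [DiscreteMeasurableSpace A] (e : A ≃ Γ × Fin C.m)

theorem normSq_eq_lintegral {f : TopForm n X} (hf : f ∈ holomorphicForms n X) :
    normSq f = ∫⁻ p, ‖C.coef e f p‖ₑ ^ 2 ∂C.cellMeasure e := by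
  have := C.countable_index
  have : Countable A := e.injective.countable
  rw [C.lintegral_coef e hΓ hf, C.normSq_eq hΓ,
    e.tsum_eq fun j => ∫⁻ z in C.cell j.2,
      ‖formCoeff (C.φ j.2) (pullback (fun x : X => j.1 • x) f) z‖ₑ ^ 2, ENNReal.tsum_prod']
  exact tsum_congr fun γ => (tsum_fintype _).symm

theorem memLp_coef {f : TopForm n X} (hf : f ∈ squareIntegrableForms n X) :
    MemLp (C.coef e f) 2 (C.cellMeasure e) := by
  have := C.countable_index
  have : Countable A := e.injective.countable
  refine memLp_two_of_lintegral_lt_top (C.measurable_coef e hΓ hf.1) ?_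
  rw [← C.normSq_eq_lintegral hΓ e hf.1]
  exact hf.2

theorem lintegralForm_mul_conj {c : ℂ → ℝ} (hc : ∀ (r : ℝ) z, 0 ≤ r → c (r * z) = r * c z)
    (hcm : Measurable c) {f g : TopForm n X} (hf : f ∈ holomorphicForms n X)
    (hg : g ∈ holomorphicForms n X) :
    lintegralForm (fun x v => ENNReal.ofReal (c (f x v * conj (g x v)))) =
      ∫⁻ p, ENNReal.ofReal (c (C.coef e f p * conj (C.coef e g p))) ∂C.cellMeasure e := by
  have := C.countable_index
  have : Countable A := e.injective.countable
  have hm : Measurable fun p => ENNReal.ofReal (c (C.coef e f p * conj (C.coef e g p))) :=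
    (hcm.comp ((C.measurable_coef e hΓ hf).mul
      (Complex.continuous_conj.measurable.comp (C.measurable_coef e hΓ hg)))).ennreal_ofReal
  rw [C.lintegralForm_eq hΓ (isDensity_ofReal hc f g), C.lintegral_cellMeasure e hm,
    ← e.tsum_eq]
  refine tsum_congr fun j => setLIntegral_congr_fun (C.measurableSet_cell _) fun z hz => ?_
  have hb := C.cell_subset_ball _ hz
  rw [C.coef_of_mem_ball e f hb, C.coef_of_mem_ball e g hb,
    ← formCoeff_translateChart hΓ (C.isHolChart _) _ f hz.1,
    ← formCoeff_translateChart hΓ (C.isHolChart _) _ g hz.1]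
  rfl

/-- Identifies the inner product assembled from four nonnegative integrals with an `L²` inner
product, so that orthonormality of forms becomes orthonormality in a Hilbert space. -/
theorem innerForm_eq_integral {f g : TopForm n X} (hf : f ∈ squareIntegrableForms n X)
    (hg : g ∈ squareIntegrableForms n X) :
    innerForm f g = ∫ p, C.coef e f p * conj (C.coef e g p) ∂C.cellMeasure e := by
  have hi : Integrable (fun p => C.coef e f p * conj (C.coef e g p)) (C.cellMeasure e) :=
    (C.memLp_coef hΓ e hf).integrable_mul ((C.memLp_coef hΓ e hg).star)
  rw [← integral_re_add_im hi, innerForm, integralForm,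
    integral_eq_lintegral_pos_part_sub_lintegral_neg_part hi.re,
    integral_eq_lintegral_pos_part_sub_lintegral_neg_part hi.im,
    C.lintegralForm_mul_conj hΓ e (c := fun z => z.re) (by intro r z _; simp)
      Complex.measurable_re hf.1 hg.1,
    C.lintegralForm_mul_conj hΓ e (c := fun z => -z.re) (by intro r z _; simp)
      Complex.measurable_re.neg hf.1 hg.1,
    C.lintegralForm_mul_conj hΓ e (c := fun z => z.im) (by intro r z _; simp)
      Complex.measurable_im hf.1 hg.1,
    C.lintegralForm_mul_conj hΓ e (c := fun z => -z.im) (by intro r z _; simp)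
      Complex.measurable_im.neg hf.1 hg.1]
  simp only [RCLike.re_to_complex, RCLike.im_to_complex, RCLike.I_to_complex]
  rw [mul_comm Complex.I]
  rfl

/-- The square integrable holomorphic forms as a subspace. -/
def squareIntegrableSubmodule : Submodule ℂ (TopForm n X) where
  carrier := squareIntegrableForms n X
  zero_mem' := by
    let : MeasurableSpace (Γ × Fin C.m) := ⊤
    have : DiscreteMeasurableSpace (Γ × Fin C.m) := ⟨fun _ => trivial⟩
    refine ⟨Submodule.zero_mem _, ?_⟩
    rw [C.normSq_eq_lintegral hΓ (Equiv.refl _) (Submodule.zero_mem _)]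
    simp
  add_mem' := by
    let : MeasurableSpace (Γ × Fin C.m) := ⊤
    have : DiscreteMeasurableSpace (Γ × Fin C.m) := ⟨fun _ => trivial⟩
    intro f g hf hg
    have hfg := Submodule.add_mem _ hf.1 hg.1
    refine ⟨hfg, ?_⟩
    have h := (C.memLp_coef hΓ (Equiv.refl _) hf).add (C.memLp_coef hΓ (Equiv.refl _) hg)
    rw [C.normSq_eq_lintegral hΓ (Equiv.refl _) hfg, map_add, ← eLpNorm_two_sq]
    exact ENNReal.pow_lt_top h.2
  smul_mem' := by
    let : MeasurableSpace (Γ × Fin C.m) := ⊤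
    have : DiscreteMeasurableSpace (Γ × Fin C.m) := ⟨fun _ => trivial⟩
    intro c f hf
    have hcf := Submodule.smul_mem _ c hf.1
    refine ⟨hcf, ?_⟩
    have h := (C.memLp_coef hΓ (Equiv.refl _) hf).const_smul c
    rw [C.normSq_eq_lintegral hΓ (Equiv.refl _) hcf, map_smul, ← eLpNorm_two_sq]
    exact ENNReal.pow_lt_top h.2

/-- The Hilbert space norm and inner product of the square integrable holomorphic forms are those of
an `L²` space. -/
theorem exists_isometry_lp : ∃ Φ : C.squareIntegrableSubmodule hΓ →ₗ[ℂ]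
      Lp ℂ 2 (@cellMeasure n Γ _ X _ _ _ C _ (Equiv.refl (Γ × Fin C.m)) ⊤),
    (∀ f, ‖Φ f‖ₑ ^ 2 = normSq (f : TopForm n X)) ∧
    ∀ f g, inner ℂ (Φ g) (Φ f) = innerForm (f : TopForm n X) g := by
  let : MeasurableSpace (Γ × Fin C.m) := ⊤
  have : DiscreteMeasurableSpace (Γ × Fin C.m) := ⟨fun _ => trivial⟩
  set e := Equiv.refl (Γ × Fin C.m)
  have hmem : ∀ f : C.squareIntegrableSubmodule hΓ,
      MemLp ((C.coef e).comp (C.squareIntegrableSubmodule hΓ).subtype f) 2 (C.cellMeasure e) :=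
    fun f => C.memLp_coef hΓ e f.2
  refine ⟨toLpMap _ hmem, fun f => ?_, fun f g => ?_⟩
  · rw [C.normSq_eq_lintegral hΓ e f.2.1]
    exact enorm_toLp_sq (hmem f)
  · rw [C.innerForm_eq_integral hΓ e f.2 g.2, L2.inner_def]
    refine integral_congr_ae ?_
    filter_upwards [(hmem f).coeFn_toLp, (hmem g).coeFn_toLp] with p hp1 hp2
    have h1 : (toLpMap _ hmem f : (Γ × Fin C.m) × (Fin n → ℂ) → ℂ) p = C.coef e f p := hp1
    have h2 : (toLpMap _ hmem g : (Γ × Fin C.m) × (Fin n → ℂ) → ℂ) p = C.coef e g p := hp2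
    rw [h1, h2, RCLike.inner_apply]

/-- The Bergman kernel is the extremal function of the unit ball. -/
theorem bergmanKernel_eq_iSup {B : Set (TopForm n X)} (hB : IsOrthonormalBasis B) (x : X)
    (v : Fin n → Fin n → ℂ) :
    bergmanKernel B x v = ⨆ f ∈ normBall n X, ‖f x v‖ₑ ^ 2 := by
  obtain ⟨Φ, hnorm, hinner⟩ := C.exists_isometry_lp hΓ
  let b : B → C.squareIntegrableSubmodule hΓ := fun b => ⟨b, hB.subset b.2⟩
  have hon : Orthonormal ℂ fun i : B => Φ (b i) := by
    classical
    rw [orthonormal_iff_ite]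
    intro i j
    rw [hinner]
    split_ifs with h
    · subst h
      exact hB.inner_self i i.2
    · exact hB.inner_of_ne j j.2 i i.2 fun h' => h (Subtype.ext h'.symm)
  let ev := (evalForm x v).comp (C.squareIntegrableSubmodule hΓ).subtype
  obtain ⟨κ, hκ, hκf⟩ := C.exists_enorm_apply_sq_le hΓ x v
  -- Upper bound: the extremal property for finite subfamilies. Lower bound: density of the span
  -- together with continuity of evaluation.
  refine le_antisymm ?_ (iSup₂_le fun f hf => ?_)
  · change ∑' i : B, ‖ev (b i)‖ₑ ^ 2 ≤ _
    rw [ENNReal.tsum_eq_iSup_sum]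
    refine iSup_le fun t => ?_
    rw [← Finset.sum_coe_sort]
    refine sum_enorm_sq_le_of_orthonormal Φ (hon.comp (fun i : t => (i : B))
      Subtype.val_injective) ev fun u hu => ?_
    refine le_iSup₂_of_le (u : TopForm n X) ⟨u.2.1, ?_⟩ le_rfl
    rw [← hnorm u, ← ofReal_norm]
    exact pow_le_one' (ENNReal.ofReal_le_one.2 hu) 2
  · refine enorm_sq_le_tsum_of_orthonormal Φ hon ev hκ.ne
      (u := ⟨f, hf.1, hf.2.trans_lt ENNReal.one_lt_top⟩) (fun u => ?_) ?_ fun ε hε => ?_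
    · rw [hnorm]
      exact hκf u u.2.1
    · rw [hnorm]
      exact hf.2
    · obtain ⟨g, hg, hfg⟩ := hB.dense_span f ⟨hf.1, hf.2.trans_lt ENNReal.one_lt_top⟩ ε hε
      have hspan : Submodule.map (C.squareIntegrableSubmodule hΓ).subtype
          (Submodule.span ℂ (range b)) = Submodule.span ℂ B := by
        rw [Submodule.map_span, ← range_comp]
        exact congrArg _ Subtype.range_coe
      rw [← hspan] at hg
      obtain ⟨w, hw, rfl⟩ := hg
      refine ⟨w, hw, ?_⟩
      rw [hnorm]
      exact hfg

/-- The extremal description no longer mentions the basis, and pullback by `Γ` preserves the unit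
ball. -/
theorem isInvariant_bergmanKernel {B : Set (TopForm n X)} (hB : IsOrthonormalBasis B) :
    IsInvariant Γ (bergmanKernel B) := by
  intro γ x v
  have h1 := C.bergmanKernel_eq_iSup hΓ hB x v
  have h2 := C.bergmanKernel_eq_iSup hΓ hB (γ • x) fun i =>
    mfderiv 𝓘(ℂ, Fin n → ℂ) 𝓘(ℂ, Fin n → ℂ) (fun x : X => γ • x) x (v i)
  refine h2.trans (Eq.trans ?_ h1.symm)
  have hmem : ∀ f ∈ normBall n X, ∀ σ : Γ, pullback (fun x : X => σ • x) f ∈ normBall n X :=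
    fun f hf σ => ⟨pullback_mem_holomorphicForms (hΓ σ) hf.1,
      (C.normSq_pullback hΓ f σ).trans_le hf.2⟩
  refine le_antisymm (iSup₂_le fun f hf => ?_) (iSup₂_le fun f hf => ?_)
  · exact le_iSup₂_of_le (pullback (fun x : X => γ • x) f) (hmem f hf γ) le_rfl
  · refine le_iSup₂_of_le (pullback (fun x : X => γ⁻¹ • x) f) (hmem f hf γ⁻¹) (le_of_eq ?_)
    have h3 : pullback (fun x : X => γ • x) (pullback (fun x : X => γ⁻¹ • x) f) = f := by
      rw [pullback_smul_pullback_smul hΓ]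
      simp only [inv_mul_cancel, one_smul]
      exact pullback_id f
    exact congrArg (fun g : TopForm n X => ‖g x v‖ₑ ^ 2) h3.symm

end AdaptedCharts

/-! ### Dimension bounds and upper semicontinuity of the extremal integrals. -/

namespace AdaptedCharts

variable {n : ℕ} {Γ : Type*} [Group Γ] {X : Type*} [TopologicalSpace X] [MulAction Γ X]
  [ChartedSpace (Fin n → ℂ) X] (C : AdaptedCharts n Γ X)

theorem extremal_le {F : Set (TopForm n X)} {i : Fin C.m} {z : Fin n → ℂ} {k : ℝ≥0∞}
    (h : z ∈ ball (C.center i) (C.radius i) → ∀ f ∈ F, ‖formCoeff (C.φ i) f z‖ₑ ^ 2 ≤ k) :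
    C.extremal F i z ≤ k := by
  refine iSup₂_le fun f hf => ?_
  by_cases hz : z ∈ ball (C.center i) (C.radius i)
  · rw [indicator_of_mem hz]
    exact h hz f hf
  · rw [indicator_of_notMem hz]
    exact zero_le

theorem extremal_of_mem_ball (F : Set (TopForm n X)) {i : Fin C.m} {z : Fin n → ℂ}
    (hz : z ∈ ball (C.center i) (C.radius i)) :
    C.extremal F i z = ⨆ f ∈ F, ‖formCoeff (C.φ i) f z‖ₑ ^ 2 := by
  simp only [extremal, indicator_of_mem hz]

/-- The integral over the fundamental domain of the extremal function of a set of forms. -/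
def extremalIntegral (F : Set (TopForm n X)) : ℝ≥0∞ := ∑ i, ∫⁻ z in C.cell i, C.extremal F i z

theorem sum_bound_lt_top : ∑ i, C.bound i * volume (C.cell i) < ⊤ :=
  ENNReal.sum_lt_top.2 fun i _ => ENNReal.mul_lt_top (C.bound_lt_top i) (C.volume_cell_lt_top i)

theorem extremalIntegral_lt_top {F : Set (TopForm n X)} (h : ∀ i z, C.extremal F i z ≤ C.bound i) :
    C.extremalIntegral F < ⊤ := by
  refine lt_of_le_of_lt (Finset.sum_le_sum fun i _ => ?_) C.sum_bound_lt_top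
  exact (lintegral_mono fun z => h i z).trans_eq (setLIntegral_const _ _)

variable [IsManifold 𝓘(ℂ, Fin n → ℂ) ω X]

/-- Each cell lies in a compact polydisc inside the chart target, so the coefficient is bounded on
it. -/
theorem energy_lt_top {f : TopForm n X} (hf : f ∈ holomorphicForms n X) : C.energy f < ⊤ := by
  refine ENNReal.sum_lt_top.2 fun i _ => ?_
  have hsub : closedBall (C.center i) (C.radius i) ⊆ (C.φ i).target := by
    rw [C.target_eq]
    exact closedBall_subset_ball (by linarith [C.radius_pos i])
  obtain ⟨k, hk⟩ := (isCompact_closedBall (C.center i) (C.radius i)).exists_bound_of_continuousOn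
    ((differentiableOn_formCoeff (C.isHolChart i) hf).continuousOn.mono hsub)
  calc ∫⁻ z in C.cell i, ‖formCoeff (C.φ i) f z‖ₑ ^ 2
      ≤ ∫⁻ _ in C.cell i, ENNReal.ofReal k ^ 2 := by
        refine setLIntegral_mono measurable_const fun z hz => ?_
        gcongr
        rw [← ofReal_norm]
        exact ENNReal.ofReal_le_ofReal (hk z (ball_subset_closedBall (C.cell_subset_ball i hz)))
    _ = ENNReal.ofReal k ^ 2 * volume (C.cell i) := setLIntegral_const _ _
    _ < ⊤ := ENNReal.mul_lt_top (ENNReal.pow_lt_top ENNReal.ofReal_lt_top) (C.volume_cell_lt_top i)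

variable (hΓ : ∀ γ : Γ, ContMDiff 𝓘(ℂ, Fin n → ℂ) 𝓘(ℂ, Fin n → ℂ) ω fun x : X => γ • x)
include hΓ

theorem normSqMod_lt_top (S : Subgroup Γ) [S.FiniteIndex] {f : TopForm n X}
    (hf : f ∈ holomorphicForms n X) : C.normSqMod S f < ⊤ := by
  have := Fintype.ofFinite (Γ ⧸ S)
  rw [normSqMod, tsum_fintype]
  exact ENNReal.sum_lt_top.2 fun c _ =>
    C.energy_lt_top (pullback_mem_holomorphicForms (hΓ c.out) hf)

variable [ContinuousConstSMul Γ X] [LocallyCompactSpace X] [SecondCountableTopology X]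
  [ProperlyDiscontinuousSMul Γ X]

theorem eq_zero_of_normSqMod_eq_zero {S : Subgroup Γ} (hS : S.Normal) {f : TopForm n X}
    (hf : f ∈ holomorphicForms n X) (hfS : IsInvariantForm S f) (h0 : C.normSqMod S f = 0) :
    f = 0 := by
  funext x
  refine AlternatingMap.ext fun v => ?_
  obtain ⟨γ, i, z, hz, rfl⟩ := C.exists_mem_cell x
  obtain ⟨d, hd⟩ := ((C.isHolChart i).translateChart hΓ γ).exists_apply_eq
    (x := γ • (C.φ i).symm z) (by
      rw [mem_translateChart_source, inv_smul_smul]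
      exact (C.φ i).map_target hz.1)
  refine (hd f v).trans ?_
  rw [translateChart_apply, inv_smul_smul, (C.φ i).right_inv hz.1,
    formCoeff_translateChart hΓ (C.isHolChart i) γ _ hz.1]
  have h1 := C.enorm_formCoeff_sq_le i (pullback_mem_holomorphicForms (hΓ γ) hf)
    (C.cell_subset_ball i hz)
  have h2 := C.lintegral_target_le_normSqMod hΓ hS (hfS.pullback hΓ hS γ) i
  rw [C.normSqMod_pullback hΓ hS hfS, h0, nonpos_iff_eq_zero] at h2
  rw [h2, mul_zero, nonpos_iff_eq_zero] at h1
  have h3 := enorm_eq_zero.1 (pow_eq_zero_iff two_ne_zero |>.1 h1)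
  rw [h3, mul_zero, mul_zero]
  rfl

theorem extremal_unitBall_le {S : Subgroup Γ} (hS : S.Normal) (i : Fin C.m) (z : Fin n → ℂ) :
    C.extremal (C.unitBall S) i z ≤ C.bound i :=
  C.extremal_le fun hz _ hf => C.enorm_formCoeff_sq_le_of_mem_unitBall hΓ hS hf i hz

/-- The space of holomorphic forms of `X / S` has finite dimension, at most the index of `S` times the
integral over the fundamental domain of the extremal function of `X / S`. -/
theorem finiteDimensional_and_hodgeNumber_le [T2Space X] [IsCancelSMul Γ X] {S : Subgroup Γ}
    (hS : S.Normal) [S.FiniteIndex] :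
    FiniteDimensional ℂ (holomorphicForms n (MulAction.orbitRel.Quotient S X)) ∧
    (hodgeNumber n (MulAction.orbitRel.Quotient S X) : ℝ≥0∞) ≤
      S.index * C.extremalIntegral (C.unitBall S) := by
  have := Fintype.ofFinite (Γ ⧸ S)
  have hΓS : ∀ s : S, ContMDiff 𝓘(ℂ, Fin n → ℂ) 𝓘(ℂ, Fin n → ℂ) ω fun x : X => s • x :=
    fun s => hΓ s
  have := isManifold_quotient S hΓS
  let : MeasurableSpace ((Γ ⧸ S) × Fin C.m) := ⊤
  have : DiscreteMeasurableSpace ((Γ ⧸ S) × Fin C.m) := ⟨fun _ => trivial⟩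
  -- One copy of the fundamental domain for each coset models integration over `X / S`.
  let a : (Γ ⧸ S) × Fin C.m → Γ × Fin C.m := fun p => (p.1.out, p.2)
  let P : holomorphicForms n (MulAction.orbitRel.Quotient S X) →ₗ[ℂ] TopForm n X :=
    (pullback (proj S X)).comp (Submodule.subtype _)
  have hPhol : ∀ f, P f ∈ holomorphicForms n X := fun f =>
    pullback_mem_holomorphicForms (contMDiff_proj S hΓS) f.2
  have hPinv : ∀ f, IsInvariantForm S (P f) := fun f σ hσ =>
    pullback_smul_pullback_proj S hΓS f ⟨σ, hσ⟩
  have hint : ∀ f, ∫⁻ p, ‖(C.coef a).comp P f p‖ₑ ^ 2 ∂C.cellMeasure a = C.normSqMod S (P f) := by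
    intro f
    rw [normSqMod, LinearMap.comp_apply, C.lintegral_coef a hΓ (hPhol f), ENNReal.tsum_prod']
    exact tsum_congr fun c => tsum_fintype _
  set k : ((Γ ⧸ S) × Fin C.m) × (Fin n → ℂ) → ℝ≥0∞ :=
    fun p => C.extremal (C.unitBall S) (a p.1).2 p.2 with hk
  have hkm : Measurable k := by
    refine measurable_from_prod_countable_right fun j => ?_
    exact C.measurable_extremal (fun f hf => hf.1) (a j).2
  have hkint : ∫⁻ p, k p ∂C.cellMeasure a = S.index * C.extremalIntegral (C.unitBall S) := by
    rw [C.lintegral_cellMeasure a hkm, ENNReal.tsum_prod', tsum_fintype]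
    simp only [tsum_fintype]
    change ∑ _ : Γ ⧸ S, C.extremalIntegral (C.unitBall S) = _
    rw [Finset.sum_const, Finset.card_univ, nsmul_eq_mul, S.index_eq_card,
      Nat.card_eq_fintype_card]
  rw [← hkint]
  refine finiteDimensional_and_finrank_le_lintegral ((C.coef a).comp P) (fun f => ?_)
    (fun f hf => ?_) (fun f hf p => ?_) ?_
  · refine memLp_two_of_lintegral_lt_top (C.measurable_coef a hΓ (hPhol f)) ?_
    rw [hint]
    exact C.normSqMod_lt_top hΓ S (hPhol f)
  · rw [hint] at hf
    have h := C.eq_zero_of_normSqMod_eq_zero hΓ hS (hPhol f) (hPinv f) hf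
    exact Subtype.ext (pullback_proj_injective S hΓS (h.trans (map_zero _).symm))
  · rw [hint] at hf
    obtain ⟨j, z⟩ := p
    -- The translated form stays in the unit ball, so the same extremal function serves every coset;
    -- summing over the cosets produces the factor `S.index`.
    have hmem := C.pullback_mem_unitBall hΓ hS (f := P f) ⟨hPhol f, hPinv f, hf⟩ (a j).1
    refine le_trans (le_of_eq ?_) (le_iSup₂ (f := fun g (_ : g ∈ C.unitBall S) =>
      (ball (C.center (a j).2) (C.radius (a j).2)).indicator
      (fun z => ‖formCoeff (C.φ (a j).2) g z‖ₑ ^ 2) z) _ hmem)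
    by_cases hz : z ∈ ball (C.center (a j).2) (C.radius (a j).2)
    · rw [indicator_of_mem hz, LinearMap.comp_apply, C.coef_of_mem_ball a _ hz]
    · have h0 : (C.coef a).comp P f (j, z) = 0 := indicator_of_notMem hz _
      rw [h0, indicator_of_notMem hz]
      simp
  · rw [hkint]
    exact ENNReal.mul_lt_top (ENNReal.natCast_lt_top _)
      (C.extremalIntegral_lt_top (C.extremal_unitBall_le hΓ hS))

/-- Upper semicontinuity of the extremal functions along a tower. -/
theorem limsup_extremal_le {S : ℕ → Subgroup Γ} (hS : ∀ l, (S l).Normal)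
    (hsep : ∀ γ : Γ, γ ≠ 1 → ∀ᶠ l in atTop, γ ∉ S l) (i : Fin C.m) (z : Fin n → ℂ) :
    limsup (fun l => C.extremal (C.unitBall (S l)) i z) atTop ≤
      C.extremal (normBall n X) i z := by
  by_cases hz : z ∈ ball (C.center i) (C.radius i)
  swap
  · have h0 : ∀ F, C.extremal F i z = 0 := fun F =>
      nonpos_iff_eq_zero.1 (C.extremal_le fun h => (hz h).elim)
    simp [h0]
  refine le_of_forall_lt fun y hy => ?_
  -- The limit form only satisfies a weak inequality with `y'`; the gap between `y` and `y'` absorbs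
  -- this.
  obtain ⟨y', hyy', hy'⟩ := exists_between hy
  obtain ⟨ψ, hψ, hlt⟩ := extraction_of_frequently_atTop
    (frequently_lt_of_lt_limsup (by isBoundedDefault) hy')
  simp only [C.extremal_of_mem_ball _ hz, lt_iSup_iff] at hlt
  choose f hf hfy using hlt
  obtain ⟨φ, -, g, hg, hg1, hlim⟩ := C.exists_subseq_tendsto_form hΓ (fun l => hS (ψ l))
    (fun γ hγ => hψ.tendsto_atTop.eventually (hsep γ hγ)) hf
  have h1 : Tendsto (fun l => ‖formCoeff (C.φ i) (f (φ l)) z‖ₑ ^ 2) atTop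
      (𝓝 (‖formCoeff (C.φ i) g z‖ₑ ^ 2)) :=
    ((ENNReal.continuous_pow 2).comp continuous_enorm).continuousAt.tendsto.comp (hlim _ _)
  refine hyy'.trans_le ((ge_of_tendsto' h1 fun l => (hfy (φ l)).le).trans ?_)
  rw [C.extremal_of_mem_ball _ hz]
  exact le_iSup₂_of_le g ⟨hg, hg1⟩ le_rfl

/-- Reverse Fatou lemma: the extremal functions are dominated by a constant on each cell, and the
cells have finite volume. -/
theorem limsup_extremalIntegral_le {S : ℕ → Subgroup Γ} (hS : ∀ l, (S l).Normal)
    (hsep : ∀ γ : Γ, γ ≠ 1 → ∀ᶠ l in atTop, γ ∉ S l) :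
    limsup (fun l => C.extremalIntegral (C.unitBall (S l))) atTop ≤
      C.extremalIntegral (normBall n X) := by
  have key : ∀ F : Set (TopForm n X), F ⊆ holomorphicForms n X → C.extremalIntegral F =
      ∫⁻ p, C.extremal F p.1 p.2 ∂C.cellMeasure fun i : Fin C.m => ((1 : Γ), i) := by
    intro F hF
    rw [C.lintegral_cellMeasure _ (measurable_from_prod_countable_right fun i =>
      C.measurable_extremal hF i), tsum_fintype]
    rfl
  rw [key (normBall n X) fun f hf => hf.1]
  simp only [fun l => key (C.unitBall (S l)) fun f hf => hf.1]
  refine (limsup_lintegral_le (fun p => C.bound p.1) (fun l =>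
    measurable_from_prod_countable_right fun i =>
      C.measurable_extremal (fun f hf => hf.1) i) (fun l => ?_) ?_).trans ?_
  · exact Eventually.of_forall fun p => C.extremal_unitBall_le hΓ (hS l) _ _
  · rw [C.lintegral_cellMeasure _ (measurable_from_prod_countable_right fun i =>
      show Measurable fun _ => C.bound i from measurable_const), tsum_fintype]
    simp only [setLIntegral_const]
    exact C.sum_bound_lt_top.ne
  · exact lintegral_mono fun p => C.limsup_extremal_le hΓ hS hsep p.1 p.2

theorem lintegralForm_pushDown_bergmanKernel [T2Space X] [IsCancelSMul Γ X]
    {B : Set (TopForm n X)} (hB : IsOrthonormalBasis B) :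
    lintegralForm (pushDown Γ (bergmanKernel B)) = C.extremalIntegral (normBall n X) := by
  rw [C.lintegralForm_pushDown hΓ (η := bergmanKernel B)
    (IsDensity.tsum fun b : B => isDensity_enorm_sq (b : TopForm n X))
    (C.isInvariant_bergmanKernel hΓ hB)]
  refine Finset.sum_congr rfl fun i _ =>
    setLIntegral_congr_fun (C.measurableSet_cell i) fun z hz => ?_
  rw [C.extremal_of_mem_ball _ (C.cell_subset_ball i hz)]
  exact C.bergmanKernel_eq_iSup hΓ hB _ _

theorem extremal_normBall_le (i : Fin C.m) (z : Fin n → ℂ) :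
    C.extremal (normBall n X) i z ≤ C.bound i :=
  C.extremal_le fun hz _ hf => (C.enorm_formCoeff_sq_le_normSq hΓ i hf.1 hz).trans
    (mul_le_of_le_one_right' hf.2)

end AdaptedCharts

/-- A tower eventually avoids every nontrivial element. -/
theorem IsTower.eventually_notMem {Γ : Type*} [Group Γ] {S : ℕ → Subgroup Γ} (hS : IsTower Γ S)
    {γ : Γ} (hγ : γ ≠ 1) : ∀ᶠ l in atTop, γ ∉ S l := by
  have h : ∃ k, γ ∉ S k := by
    by_contra! h
    have h2 : γ ∈ ⨅ j, S j := Subgroup.mem_iInf.2 h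
    rw [hS.iInf] at h2
    exact hγ (Subgroup.mem_bot.1 h2)
  obtain ⟨k, hk⟩ := h
  filter_upwards [eventually_ge_atTop k] with l hl using fun hγl => hk (hS.antitone hl hγl)

end BergmanTower

end

theorem proposition2p3 {n : ℕ} {X : Type*} [TopologicalSpace X] [T2Space X]
    [SecondCountableTopology X] [LocallyCompactSpace X] [ChartedSpace (Fin n → ℂ) X]
    [IsManifold 𝓘(ℂ, Fin n → ℂ) ω X]
    {Γ : Type*} [Group Γ] [MulAction Γ X] [ContinuousConstSMul Γ X]
    [ProperlyDiscontinuousSMul Γ X] [IsCancelSMul Γ X]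
    (hΓ : ∀ γ : Γ, ContMDiff 𝓘(ℂ, Fin n → ℂ) 𝓘(ℂ, Fin n → ℂ) ω fun x : X => γ • x)
    (S : ℕ → Subgroup Γ) (hS : BergmanTower.IsTower Γ S)
    [CompactSpace (MulAction.orbitRel.Quotient Γ X)]
    (B : Set (BergmanTower.TopForm n X)) (hB : BergmanTower.IsOrthonormalBasis B) :
    (∀ j, FiniteDimensional ℂ
      (BergmanTower.holomorphicForms n (MulAction.orbitRel.Quotient (S j) X))) ∧
    BergmanTower.lintegralForm (BergmanTower.pushDown Γ (BergmanTower.bergmanKernel B)) < ⊤ ∧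
    Filter.limsup (fun j =>
        (BergmanTower.hodgeNumber n (MulAction.orbitRel.Quotient (S j) X) : ℝ≥0∞) /
          ((S j).index : ℝ≥0∞)) Filter.atTop ≤
      BergmanTower.lintegralForm
        (BergmanTower.pushDown Γ (BergmanTower.bergmanKernel B)) := by
  obtain ⟨C⟩ := BergmanTower.AdaptedCharts.nonempty n Γ X
  have hdim : ∀ j, _ := fun j => by
    have := hS.finiteIndex j
    exact C.finiteDimensional_and_hodgeNumber_le hΓ (hS.normal j)
  rw [C.lintegralForm_pushDown_bergmanKernel hΓ hB]
  refine ⟨fun j => (hdim j).1, C.extremalIntegral_lt_top (C.extremal_normBall_le hΓ), ?_⟩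
  refine (Filter.limsup_le_limsup (Filter.Eventually.of_forall fun j => ?_)).trans
    (C.limsup_extremalIntegral_le hΓ hS.normal fun γ hγ => hS.eventually_notMem hγ)
  exact ENNReal.div_le_of_le_mul' (hdim j).2
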